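/- Everything is in the piecewise linear category. Let $k\ge 0$ and let $\triangle\subset\mathbb R^k$ be a $k$-simplex with ordered vertices $e_1,\dots,e_{k+1}$ and barycenter $\beta$; for a face $\alpha$ of $\triangle$ let $\mathring\alpha$ be its relative interior, and for $f\colon X\to\triangle$ and $J\subseteq\triangle$ put $X_J=f^{-1}(J)$. *Hyperbolized simplex.* Let $f\colon (X,\partial X)\to(\triangle,\partial\triangle)$ be a hyperbolized simplex: $X$ is a compact connected $k$-manifold with boundary, $f$ has degree one mod $2$, and for every face $\alpha$ of $\triangle$ the set $X_\alpha$ is a $\dim(\alpha)$-dimensional submanifold of $X$ with boundary $X_{\partial\alpha}$. *Properness.* For a face $\alpha\ne\triangle$ and $y\in\mathring\alpha$, a square at $y$ is a set of the form $\{u\in\triangle : \pi(u)\in B,\ d(u,\alpha)\le\delta\}$ contained in the union of the relative interiors of the faces containing $\alpha$, where $\pi$ is the orthogonal projection onto the affine span of $\alpha$, $B\subset\mathring\alpha$ is a disk that is a neighborhood of $y$ in $\mathring\alpha$, $\delta>0$, and $d(u,\alpha)$ is the sum of the barycentric coordinates of $u$ at the vertices not in $\alpha$; it is a disk bundle over $B$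 via $\pi$. The map $f$ is *proper* if for every face $\alpha\neq\triangle$ and every $z\in X_{\mathring\alpha}$ there are a square $U'$ at $f(z)$, a neighborhood $U$ of $z$ in $X$ for which $V=U\cap X_{\mathring\alpha}$ is a disk of dimension $\dim\alpha$, and a retraction $r\colon U\to V$ such that $x\mapsto(r(x),f(x))$ is a homeomorphism of $U$ onto the pullback $\{(v,u)\in V\times U' : \pi(u)=f(v)\}$. *Ambient manifold.* Let $K$ be a finite simplicial complex of dimension at most $k$ whose underlying space is a closed $k$-manifold, let $K'$ be its first barycentric subdivision, and let $p_K\colon K'\to\triangle$ be the simplicial map that sends the barycenter of every $i$-simplex to $e_{i+1}$. Let $\bar X=X\cup(\partial X\times[0,1])$ be $X$ with a collar attached along the boundary and let $\bar\triangle$ be the image of $\triangle$ under $x\mapsto\beta+2(x-\beta)$. Let $\bar f\colon\bar X\to\bar\triangle$ be the extension of $f$ given on the collar by $\bar f(x,t)=G(f(x),t)$, where $G\colon\partial\triangle\times[0,1]\to\bar\triangle\setminus\operatorname{Int}\triangle$ is any (PL) homeomorphism with $G(y,0)=y$ and $G(y,1)=\beta+2(y-\beta)$. Put $\mathcal K=K\times\bar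 X$, and let $$\Gamma\subset\mathcal K\times\mathbb R^{2k}\ \text{ be the graph of } p_K\times\bar f,\qquad \mathcal P=\mathcal K\times\{(u,u):u\in\mathbb R^k\},$$ $$\mathbf K=\{(s,x)\in K\times X : p_K(s)=f(x)\}\subset\mathcal K .$$ **Lemma.** If $f$ is proper, then $\Gamma$ and $\mathcal P$ are transverse in $\mathcal K\times\mathbb R^{2k}$: near each point of $\Gamma\cap\mathcal P$ there is a chart of $\mathcal K\times\mathbb R^{2k}$ onto an open subset of $\mathbb R^{4k}$ that takes $\Gamma$ and $\mathcal P$ to linear subspaces whose sum is $\mathbb R^{4k}$. Moreover, $\mathbf K$ is a locally flat $k$-dimensional submanifold of the $2k$-dimensional manifold $\mathcal K$ (near each of its points there is a chart of $\mathcal K$ onto an open subset of $\mathbb R^{2k}$ that takes $\mathbf K$ to a $k$-dimensional linear subspace), and it has trivial normal bundle: there is a homeomorphism of $\mathbf K\times[-1,1]^k$ onto a neighborhood of $\mathbf K$ in $\mathcal K$ that restricts to the identity $\mathbf K\times\{0\}\to\mathbf K$. -/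

import Mathlib

open scoped Topology

namespace PL

section Category

variable {E F : Type*} [NormedAddCommGroup E] [NormedSpace ℝ E]
  [NormedAddCommGroup F] [NormedSpace ℝ F]

/-- `f` is piecewise linear on the subset `S` of a vector space: every point of `S` has a
neighbourhood in `S` which is a finite union of convex polytopes contained in `S`, on each of which
`f` is affine. In particular `S` is then a (not necessarily compact) polyhedron, and `f` is
continuous on `S`. -/
def IsPLOn (f : E → F) (S : Set E) : Prop :=
  ∀ x ∈ S, ∃ T : Finset (Finset E),
    (∀ t ∈ T, convexHull ℝ (t : Set E) ⊆ S ∧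
      ∃ A : E →ᵃ[ℝ] F, Set.EqOn f A (convexHull ℝ (t : Set E))) ∧
    (⋃ t ∈ T, convexHull ℝ (t : Set E)) ∈ 𝓝[S] x

/-- `f` restricts to a PL homeomorphism of the polyhedron `S` onto the polyhedron `T`. -/
def IsPLHomeoOn (f : E → F) (S : Set E) (T : Set F) : Prop :=
  ∃ g : F → E, IsPLOn f S ∧ IsPLOn g T ∧ Set.MapsTo f S T ∧ Set.MapsTo g T S ∧ Set.InvOn g f S T

/-- `B` is a PL `n`-ball (an `n`-dimensional disk). -/
def IsPLBall (n : ℕ) (B : Set E) : Prop :=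
  ∃ φ : E → (Fin n → ℝ), IsPLHomeoOn φ B (Set.Icc 0 1)

/-- `φ` is a PL chart of `M` with domain `M ∩ O` and image the open subset `O'` of `ℝⁿ`. -/
def IsPLChart {n : ℕ} (M O : Set E) (φ : E → (Fin n → ℝ)) (O' : Set (Fin n → ℝ)) : Prop :=
  IsOpen O ∧ IsOpen O' ∧ IsPLHomeoOn φ (M ∩ O) O'

/-- `M` is a PL `n`-manifold, possibly with boundary: every point of `M` has a neighbourhood PL
homeomorphic to an open subset of a set `{y ∈ ℝⁿ | 0 ≤ ℓ y}` with `ℓ` linear, which is a half-space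
if `ℓ ≠ 0` and `ℝⁿ` if `ℓ = 0`. -/
def IsPLManifold (n : ℕ) (M : Set E) : Prop :=
  ∀ x ∈ M, ∃ (O : Set E) (ℓ : (Fin n → ℝ) →ₗ[ℝ] ℝ) (O' : Set (Fin n → ℝ)) (φ : E → (Fin n → ℝ)),
    x ∈ O ∧ IsOpen O ∧ IsOpen O' ∧ IsPLHomeoOn φ (M ∩ O) ({y | 0 ≤ ℓ y} ∩ O')

/-- The manifold interior: the points with a neighbourhood PL homeomorphic to an open subset
of `ℝⁿ`. -/
def manifoldInterior (n : ℕ) (M : Set E) : Set E :=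
  {x ∈ M | ∃ (O : Set E) (φ : E → (Fin n → ℝ)) (O' : Set (Fin n → ℝ)), x ∈ O ∧ IsPLChart M O φ O'}

/-- The manifold boundary: the complement of the manifold interior. -/
def manifoldBoundary (n : ℕ) (M : Set E) : Set E := M \ manifoldInterior n M

/-- A closed PL `n`-manifold: compact and without boundary. -/
def IsClosedPLManifold (n : ℕ) (M : Set E) : Prop :=
  IsCompact M ∧ IsPLManifold n M ∧ manifoldBoundary n M = ∅

/-- The subsets `M`, `N` of the `d`-dimensional manifold `W` are transverse: around every point of
`M ∩ N` there is a PL chart of `W` with image an open subset of `ℝᵈ`, in which `M` and `N` become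
linear subspaces `A`, `B` in general position, that is `A + B = ℝᵈ`. (The chart is always one at an
interior point of `W`, so this includes that `M ∩ N` misses the boundary of `W`.) -/
def AreTransverse (d : ℕ) (W M N : Set E) : Prop :=
  M ⊆ W ∧ N ⊆ W ∧ ∀ w ∈ M ∩ N, ∃ (O : Set E) (φ : E → (Fin d → ℝ)) (O' : Set (Fin d → ℝ))
    (A B : Submodule ℝ (Fin d → ℝ)),
    w ∈ O ∧ IsPLChart W O φ O' ∧ A ⊔ B = ⊤ ∧
      φ '' (M ∩ O) = (A : Set (Fin d → ℝ)) ∩ O' ∧ φ '' (N ∩ O) = (B : Set (Fin d → ℝ)) ∩ O'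

/-- `M` is a locally flat `m`-dimensional submanifold (in the interior) of the `d`-dimensional
manifold `W`: around every point of `M` there is a PL chart of `W` in which `M` becomes an
`m`-dimensional linear subspace of `ℝᵈ`. -/
def IsLocallyFlat (m d : ℕ) (M W : Set E) : Prop :=
  M ⊆ W ∧ ∀ w ∈ M, ∃ (O : Set E) (φ : E → (Fin d → ℝ)) (O' : Set (Fin d → ℝ))
    (A : Submodule ℝ (Fin d → ℝ)),
    w ∈ O ∧ IsPLChart W O φ O' ∧ Module.finrank ℝ A = m ∧
      φ '' (M ∩ O) = (A : Set (Fin d → ℝ)) ∩ O'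

/-- `M ⊆ W` has a trivial normal `c`-disk bundle in `W`: there is a PL homeomorphism `Φ` of
`M × [-1, 1]ᶜ` onto a neighbourhood `T` of `M` in `W` which is the identity on the zero section. -/
def HasTrivialNormalBundle (c : ℕ) (M W : Set E) : Prop :=
  ∃ (T : Set E) (Φ : E × (Fin c → ℝ) → E), T ⊆ W ∧ (∀ x ∈ M, T ∈ 𝓝[W] x) ∧
    IsPLHomeoOn Φ (M ×ˢ Set.Icc (-1) 1) T ∧ ∀ x ∈ M, Φ (x, 0) = x

end Category

section Simplex

variable {k : ℕ} (b : AffineBasis (Fin (k + 1)) ℝ (EuclideanSpace ℝ (Fin k)))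

/-- The face of the `k`-simplex with vertices `b 0, …, b k` that is spanned by the `b i`, `i ∈ s`;
the simplex itself is `face b Finset.univ`. -/
def face (s : Finset (Fin (k + 1))) : Set (EuclideanSpace ℝ (Fin k)) :=
  convexHull ℝ (b '' (s : Set (Fin (k + 1))))

/-- The whole simplex. -/
def simplex : Set (EuclideanSpace ℝ (Fin k)) := face b Finset.univ

/-- The relative interior of a face, in barycentric coordinates. -/
def openFace (s : Finset (Fin (k + 1))) : Set (EuclideanSpace ℝ (Fin k)) :=
  {y | (∀ i ∈ s, 0 < b.coord i y) ∧ ∀ i ∉ s, b.coord i y = 0}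

/-- The boundary of a face (the union of its proper faces). -/
def faceBoundary (s : Finset (Fin (k + 1))) : Set (EuclideanSpace ℝ (Fin k)) :=
  face b s \ openFace b s

/-- The simplex concentric to the given one and twice as large: its image under
`x ↦ β + 2 (x - β)`, where `β` is the barycenter. -/
def bigSimplex : Set (EuclideanSpace ℝ (Fin k)) :=
  AffineMap.homothety (Finset.univ.centroid ℝ b) (2 : ℝ) '' simplex b

/-- `q` is the orthogonal projection of `u` to the affine span of the face `s`. -/
def IsFoot (s : Finset (Fin (k + 1))) (u q : EuclideanSpace ℝ (Fin k)) : Prop :=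
  q ∈ affineSpan ℝ (b '' (s : Set (Fin (k + 1)))) ∧
    ∀ i ∈ s, ∀ j ∈ s, inner ℝ (u - q) (b i - b j) = 0

/-- The total space of a square with base `B ⊆ openFace b s`: the points of the simplex which
project orthogonally into `B` and lie in a tube about the face `s`. The (polyhedral) distance to
the face which defines the tube is the sum of the barycentric coordinates that vanish on the face.
-/
def tube (s : Finset (Fin (k + 1))) (B : Set (EuclideanSpace ℝ (Fin k))) (δ : ℝ) :
    Set (EuclideanSpace ℝ (Fin k)) :=
  {u ∈ simplex b | (∃ q ∈ B, IsFoot b s u q) ∧ ∑ j ∈ sᶜ, b.coord j u ≤ δ}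

/-- `tube b s B δ`, with the orthogonal projection to `B`, is a square at the point `y` of
`openFace b s`: its base `B` is a disk that is a neighbourhood of `y` in the open face, and the
square lies in the open star of the face. -/
def IsSquareAt (s : Finset (Fin (k + 1))) (y : EuclideanSpace ℝ (Fin k))
    (B : Set (EuclideanSpace ℝ (Fin k))) (δ : ℝ) : Prop :=
  B ⊆ openFace b s ∧ B ∈ 𝓝[openFace b s] y ∧ IsPLBall (s.card - 1) B ∧ 0 < δ ∧
    ∀ u ∈ tube b s B δ, ∀ i ∈ s, 0 < b.coord i u

/-- A collar of the simplex in the concentric larger simplex: a PL homeomorphism of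
`∂△ × [0, 1]` onto the closed region between the two simplices, which is the identity on `∂△ × 0`
and is `y ↦ β + 2 (y - β)` on `∂△ × 1`, where `β` is the barycenter. -/
def IsCollarMap (G : EuclideanSpace ℝ (Fin k) × ℝ → EuclideanSpace ℝ (Fin k)) : Prop :=
  IsPLHomeoOn G (faceBoundary b Finset.univ ×ˢ Set.Icc 0 1) (bigSimplex b \ interior (simplex b)) ∧
    ∀ y ∈ faceBoundary b Finset.univ, G (y, 0) = y ∧
      G (y, 1) = AffineMap.homothety (Finset.univ.centroid ℝ b) (2 : ℝ) y

end Simplex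

section Hyperbolized

variable {k : ℕ} (b : AffineBasis (Fin (k + 1)) ℝ (EuclideanSpace ℝ (Fin k)))
  {E : Type*} [NormedAddCommGroup E] [NormedSpace ℝ E]

/-- `f : X → △` has degree one mod 2 (as a map `(X, ∂X) → (△, ∂△)` of compact `k`-manifolds): a
generic point in the interior of `△` has an odd number of preimages. -/
def HasOddDegree (X : Set E) (f : E → EuclideanSpace ℝ (Fin k)) : Prop :=
  ∃ D ⊆ openFace b Finset.univ, IsOpen D ∧ openFace b Finset.univ ⊆ closure D ∧
    ∀ y ∈ D, (X ∩ f ⁻¹' {y}).Finite ∧ Odd (X ∩ f ⁻¹' {y}).ncard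

/-- `f : (X, ∂X) → (△, ∂△)` is a hyperbolized `k`-simplex: `X` is a compact connected PL
`k`-manifold, `f` is PL of degree one mod 2, and the preimage of each face of `△` is a manifold of
the same dimension as the face, with boundary the preimage of the boundary of the face. (For the
face `△` itself this says that `X` is a `k`-manifold with `∂X = f⁻¹(∂△)`.) -/
structure IsHyperbolizedSimplex (X : Set E) (f : E → EuclideanSpace ℝ (Fin k)) : Prop where
  isCompact : IsCompact X
  isConnected : IsConnected X
  isPLOn : IsPLOn f X
  mapsTo : Set.MapsTo f X (simplex b)
  isPLManifold : ∀ s : Finset (Fin (k + 1)), s.Nonempty →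
    IsPLManifold (s.card - 1) (X ∩ f ⁻¹' face b s)
  boundary_eq : ∀ s : Finset (Fin (k + 1)), s.Nonempty →
    manifoldBoundary (s.card - 1) (X ∩ f ⁻¹' face b s) = X ∩ f ⁻¹' faceBoundary b s
  hasOddDegree : HasOddDegree b X f

/-- `f : X → △` is proper: for every proper face `s` of `△` and every point `z` of the preimage of
its relative interior there are a square at `f z`, a neighbourhood `U` of `z` in `X` and a
retraction `r` of `U` onto the disk `V = U ∩ f⁻¹(openFace b s)` such that `r : U → V` is the
pullback via `f : V → B` of the disk bundle of the square, i.e. `x ↦ (r x, f x)` is a PL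
homeomorphism of `U` onto the pullback. -/
def IsProperSimplexMap (X : Set E) (f : E → EuclideanSpace ℝ (Fin k)) : Prop :=
  ∀ s : Finset (Fin (k + 1)), s.Nonempty → s ≠ Finset.univ → ∀ z ∈ X ∩ f ⁻¹' openFace b s,
    ∃ (B : Set (EuclideanSpace ℝ (Fin k))) (δ : ℝ) (U : Set E) (r : E → E),
      IsSquareAt b s (f z) B δ ∧
      U ⊆ X ∧ U ∈ 𝓝[X] z ∧
      IsPLBall (s.card - 1) (U ∩ f ⁻¹' openFace b s) ∧
      (∀ v ∈ U ∩ f ⁻¹' openFace b s, r v = v) ∧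
      IsPLHomeoOn (fun x => (r x, f x)) U
        {p | p.1 ∈ U ∩ f ⁻¹' openFace b s ∧ p.2 ∈ tube b s B δ ∧ IsFoot b s p.2 (f p.1)}

/-- `X` with the collar `∂X × [0, 1]` attached along the boundary, realized in `E × ℝ`. -/
def collared (k : ℕ) (X : Set E) : Set (E × ℝ) :=
  X ×ˢ {0} ∪ manifoldBoundary k X ×ˢ Set.Icc 0 1

open Classical in
/-- The extension of `f : X → △` to a map of the collared manifold to the larger simplex, which on
the collar is `(x, t) ↦ G (f x, t)`. -/
noncomputable def extendToCollar (f : E → EuclideanSpace ℝ (Fin k))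
    (G : EuclideanSpace ℝ (Fin k) × ℝ → EuclideanSpace ℝ (Fin k)) (x : E × ℝ) :
    EuclideanSpace ℝ (Fin k) :=
  if x.2 = 0 then f x.1 else G (f x.1, x.2)

end Hyperbolized

section Folding

variable {E : Type*} [NormedAddCommGroup E] [NormedSpace ℝ E]

/-- The point `s` is the convex combination with weights `w` of the barycenters of the simplices
`σ ∈ C`, where `C` is a chain of simplices of `K`, i.e. a simplex of the barycentric subdivision. -/
def IsFlagCombination (K : Geometry.SimplicialComplex ℝ E) (s : E) (C : Finset (Finset E))
    (w : Finset E → ℝ) : Prop :=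
  (∀ σ ∈ C, σ ∈ K.faces) ∧ IsChain (· ⊆ ·) (C : Set (Finset E)) ∧ (∀ σ ∈ C, 0 ≤ w σ) ∧
    ∑ σ ∈ C, w σ = 1 ∧ ∑ σ ∈ C, w σ • ((σ.card : ℝ)⁻¹ • ∑ v ∈ σ, v) = s

variable {k : ℕ} (b : AffineBasis (Fin (k + 1)) ℝ (EuclideanSpace ℝ (Fin k)))

open Classical in
/-- The folding map: the simplicial map from the barycentric subdivision of `K` to the simplex with
vertices `b 0, …, b k` which sends the barycenter of every `i`-dimensional simplex to `b i`. -/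
noncomputable def foldMap (K : Geometry.SimplicialComplex ℝ E) (s : E) :
    EuclideanSpace ℝ (Fin k) :=
  if h : ∃ (C : Finset (Finset E)) (w : Finset E → ℝ), IsFlagCombination K s C w then
    ∑ σ ∈ h.choose, h.choose_spec.choose σ • b (Fin.ofNat (k + 1) (σ.card - 1))
  else 0

/-- Barycentric coordinates of a point of `K` are unique. -/
theorem barycentric_unique (K : Geometry.SimplicialComplex ℝ E) {S T : Finset E}
    (hS : S ∈ K.faces) (hT : T ∈ K.faces) {c d : E → ℝ}
    (hc : ∀ v, 0 ≤ c v) (hd : ∀ v, 0 ≤ d v) (hcS : ∀ v ∉ S, c v = 0) (hdT : ∀ v ∉ T, d v = 0)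
    (hc1 : ∑ v ∈ S, c v = 1) (hd1 : ∑ v ∈ T, d v = 1)
    (h : ∑ v ∈ S, c v • v = ∑ v ∈ T, d v • v) : c = d := by
  classical
  have hx : ∑ v ∈ S, c v • v ∈ convexHull ℝ (S ∩ T : Set E) := by
    refine K.inter_subset_convexHull hS hT ⟨?_, ?_⟩
    · exact Finset.mem_convexHull'.2 ⟨c, fun v _ => hc v, hc1, rfl⟩
    · exact Finset.mem_convexHull'.2 ⟨d, fun v _ => hd v, hd1, h.symm⟩
  rw [← Finset.coe_inter, Finset.mem_convexHull'] at hx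
  obtain ⟨e, -, he1, hes⟩ := hx
  have key : ∀ (R : Finset E) (a : E → ℝ), R ∈ K.faces → S ∩ T ⊆ R → (∀ v ∉ R, a v = 0) →
      ∑ v ∈ R, a v = 1 → ∑ v ∈ R, a v • v = ∑ v ∈ S, c v • v →
      ∀ v, a v = if v ∈ S ∩ T then e v else 0 := by
    intro R a hR hsub ha ha1 has v
    have e1 : ∑ v ∈ R, (if v ∈ S ∩ T then e v else 0) = 1 := by
      rw [← he1, ← Finset.sum_filter, Finset.filter_mem_eq_inter, Finset.inter_eq_right.2 hsub]
    have e2 : ∑ v ∈ R, (if v ∈ S ∩ T then e v else 0) • v = ∑ v ∈ S, c v • v := by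
      rw [← hes]
      simp only [ite_smul, zero_smul]
      rw [← Finset.sum_filter, Finset.filter_mem_eq_inter, Finset.inter_eq_right.2 hsub]
    have := (K.indep hR).eq_zero_of_sum_eq_zero_subtype
      (w := fun v => a v - if v ∈ S ∩ T then e v else 0)
      (by rw [Finset.sum_sub_distrib, ha1, e1, sub_self])
      (by simp only [sub_smul]; rw [Finset.sum_sub_distrib, has, e2, sub_self])
    by_cases hv : v ∈ R
    · exact sub_eq_zero.1 (this v hv)
    · rw [ha v hv, if_neg (fun h => hv (hsub h))]
  funext v
  rw [key S c hS Finset.inter_subset_left hcS hc1 rfl v,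
    key T d hT Finset.inter_subset_right hdT hd1 h.symm v]

open Classical in
/-- Comparison of the weights of two chains with the same barycentric coordinates. -/
theorem chain_tail_le {ι : Type*} {C D : Finset (Finset ι)} {w u : Finset ι → ℝ}
    (hC : IsChain (· ⊆ ·) (C : Set (Finset ι))) (hD : IsChain (· ⊆ ·) (D : Set (Finset ι)))
    (hw : ∀ σ ∈ C, 0 ≤ w σ) (hu : ∀ σ ∈ D, 0 ≤ u σ)
    (h : ∀ v, ∑ σ ∈ C with v ∈ σ, w σ = ∑ σ ∈ D with v ∈ σ, u σ) (j : ℕ) :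
    ∑ σ ∈ C with j < σ.card, w σ ≤ ∑ σ ∈ D with j < σ.card, u σ := by
  have hDn : 0 ≤ ∑ σ ∈ D with j < σ.card, u σ :=
    Finset.sum_nonneg fun σ hσ => hu σ (Finset.mem_filter.1 hσ).1
  rcases (C.filter fun σ => j < σ.card).eq_empty_or_nonempty with he | hne
  · rw [he]; simpa using hDn
  obtain ⟨σ, hσ, hmin⟩ := Finset.exists_min_image _ Finset.card hne
  rw [Finset.mem_filter] at hσ
  -- a vertex of `σ` that lies in no member of `D` with at most `j` elements
  obtain ⟨v, hvσ, hv⟩ : ∃ v ∈ σ, ∀ τ ∈ D, v ∈ τ → j < τ.card := by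
    rcases (D.filter fun τ => τ.card ≤ j).eq_empty_or_nonempty with he | hne'
    · obtain ⟨v, hv⟩ := Finset.card_pos.1 (lt_of_le_of_lt (Nat.zero_le j) hσ.2)
      refine ⟨v, hv, fun τ hτ _ => ?_⟩
      by_contra hcon
      have : τ ∈ D.filter fun τ => τ.card ≤ j := Finset.mem_filter.2 ⟨hτ, not_lt.1 hcon⟩
      rw [he] at this
      simp at this
    · obtain ⟨ρ, hρ, hmax⟩ := Finset.exists_max_image _ Finset.card hne'
      rw [Finset.mem_filter] at hρ
      obtain ⟨v, hvσ, hvρ⟩ := Finset.exists_mem_notMem_of_card_lt_card (lt_of_le_of_lt hρ.2 hσ.2)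
      refine ⟨v, hvσ, fun τ hτ hvτ => ?_⟩
      by_contra hcon
      have hle := hmax τ (Finset.mem_filter.2 ⟨hτ, not_lt.1 hcon⟩)
      rcases hD.total hτ hρ.1 with hs | hs
      · exact hvρ (hs hvτ)
      · exact hvρ ((Finset.eq_of_subset_of_card_le hs hle) ▸ hvτ)
  calc ∑ τ ∈ C with j < τ.card, w τ ≤ ∑ τ ∈ C with v ∈ τ, w τ := by
        refine Finset.sum_le_sum_of_subset_of_nonneg (fun τ hτ => ?_)
          fun τ hτ _ => hw τ (Finset.mem_filter.1 hτ).1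
        have hle := hmin τ hτ
        rw [Finset.mem_filter] at hτ ⊢
        refine ⟨hτ.1, ?_⟩
        rcases hC.total hσ.1 hτ.1 with hs | hs
        · exact hs hvσ
        · exact (Finset.eq_of_subset_of_card_le hs hle) ▸ hvσ
    _ = ∑ τ ∈ D with v ∈ τ, u τ := h v
    _ ≤ ∑ τ ∈ D with j < τ.card, u τ := by
        refine Finset.sum_le_sum_of_subset_of_nonneg (fun τ hτ => ?_)
          fun τ hτ _ => hu τ (Finset.mem_filter.1 hτ).1
        rw [Finset.mem_filter] at hτ ⊢
        exact ⟨hτ.1, hv τ hτ.1 hτ.2⟩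

open Classical in
/-- The barycentric coordinates of a combination of barycenters. -/
theorem IsFlagCombination.exists_top {K : Geometry.SimplicialComplex ℝ E} {s : E}
    {C : Finset (Finset E)} {w : Finset E → ℝ} (h : IsFlagCombination K s C w) :
    ∃ T ∈ K.faces, (∀ v ∉ T, ∑ σ ∈ C with v ∈ σ, w σ * (σ.card : ℝ)⁻¹ = 0) ∧
      ∑ v ∈ T, ∑ σ ∈ C with v ∈ σ, w σ * (σ.card : ℝ)⁻¹ = 1 ∧
      ∑ v ∈ T, (∑ σ ∈ C with v ∈ σ, w σ * (σ.card : ℝ)⁻¹) • v = s := by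
  obtain ⟨hK, hC, hw, h1, hs⟩ := h
  have hne : C.Nonempty := by
    by_contra hcon
    rw [Finset.not_nonempty_iff_eq_empty] at hcon
    simp [hcon] at h1
  obtain ⟨T, hT, hmax⟩ := Finset.exists_max_image C Finset.card hne
  have hsub : ∀ σ ∈ C, σ ⊆ T := fun σ hσ => by
    rcases hC.total hσ hT with h | h
    · exact h
    · exact (Finset.eq_of_subset_of_card_le h (hmax σ hσ)).symm.subset
  refine ⟨T, hK T hT, fun v hv => ?_, ?_, ?_⟩
  · rw [Finset.filter_false_of_mem fun σ hσ hvσ => hv (hsub σ hσ hvσ), Finset.sum_empty]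
  · simp only [Finset.sum_filter]
    rw [Finset.sum_comm, ← h1]
    refine Finset.sum_congr rfl fun σ hσ => ?_
    rw [← Finset.sum_filter, Finset.filter_mem_eq_inter, Finset.inter_eq_right.2 (hsub σ hσ),
      Finset.sum_const, nsmul_eq_mul]
    have : (σ.card : ℝ) ≠ 0 :=
      Nat.cast_ne_zero.2 (Finset.card_ne_zero.2 (K.nonempty_of_mem_faces (hK σ hσ)))
    field_simp
  · rw [← hs]
    simp only [Finset.sum_filter, Finset.sum_smul, ite_smul, zero_smul]
    rw [Finset.sum_comm]
    refine Finset.sum_congr rfl fun σ hσ => ?_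
    rw [← Finset.sum_filter, Finset.filter_mem_eq_inter, Finset.inter_eq_right.2 (hsub σ hσ),
      smul_smul, Finset.smul_sum]

/-- The folding map is well defined: it can be computed from any representation of a point as a
convex combination of barycenters, so it is affine on the simplices of the barycentric subdivision.
-/
theorem foldMap_eq (K : Geometry.SimplicialComplex ℝ E) {s : E} {C : Finset (Finset E)}
    {w : Finset E → ℝ} (h : IsFlagCombination K s C w) :
    foldMap b K s = ∑ σ ∈ C, w σ • b (Fin.ofNat (k + 1) (σ.card - 1)) := by
  classical
  have hex : ∃ (C : Finset (Finset E)) (w : Finset E → ℝ), IsFlagCombination K s C w := ⟨C, w, h⟩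
  rw [foldMap, dif_pos hex]
  have h' : IsFlagCombination K s hex.choose hex.choose_spec.choose := hex.choose_spec.choose_spec
  generalize hex.choose_spec.choose = u at *
  generalize hex.choose = D at *
  -- the barycentric coordinates agree
  have hcoord : ∀ v, ∑ σ ∈ D with v ∈ σ, u σ * (σ.card : ℝ)⁻¹ =
      ∑ σ ∈ C with v ∈ σ, w σ * (σ.card : ℝ)⁻¹ := by
    obtain ⟨S, hS, hS0, hS1, hSs⟩ := h'.exists_top
    obtain ⟨T, hT, hT0, hT1, hTs⟩ := h.exists_top
    have := barycentric_unique K hS hT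
      (fun v => Finset.sum_nonneg fun σ hσ => mul_nonneg
        (h'.2.2.1 σ (Finset.mem_filter.1 hσ).1) (by positivity))
      (fun v => Finset.sum_nonneg fun σ hσ => mul_nonneg
        (h.2.2.1 σ (Finset.mem_filter.1 hσ).1) (by positivity)) hS0 hT0 hS1 hT1 (hSs.trans hTs.symm)
    exact fun v => congrFun this v
  have htail : ∀ j : ℕ, ∑ σ ∈ D with j < σ.card, u σ * (σ.card : ℝ)⁻¹ =
      ∑ σ ∈ C with j < σ.card, w σ * (σ.card : ℝ)⁻¹ := fun j =>
    le_antisymm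
      (chain_tail_le h'.2.1 h.2.1 (fun σ hσ => mul_nonneg (h'.2.2.1 σ hσ) (by positivity))
        (fun σ hσ => mul_nonneg (h.2.2.1 σ hσ) (by positivity)) hcoord j)
      (chain_tail_le h.2.1 h'.2.1 (fun σ hσ => mul_nonneg (h.2.2.1 σ hσ) (by positivity))
        (fun σ hσ => mul_nonneg (h'.2.2.1 σ hσ) (by positivity)) (fun v => (hcoord v).symm) j)
  -- the total weight of the simplices with `j + 1` vertices, from the tails
  have hlevel : ∀ (A : Finset (Finset E)) (a : Finset E → ℝ) (j : ℕ),
      ∑ σ ∈ A with σ.card = j + 1, a σ = (j + 1 : ℝ) *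
        (∑ σ ∈ A with j < σ.card, a σ * (σ.card : ℝ)⁻¹ -
          ∑ σ ∈ A with j + 1 < σ.card, a σ * (σ.card : ℝ)⁻¹) := by
    intro A a j
    simp only [Finset.sum_filter]
    rw [← Finset.sum_sub_distrib, Finset.mul_sum]
    refine Finset.sum_congr rfl fun σ _ => ?_
    rcases lt_trichotomy σ.card (j + 1) with hlt | heq | hgt
    · rw [if_neg hlt.ne, if_neg (by omega), if_neg (by omega)]; ring
    · rw [if_pos heq, if_pos (by omega), if_neg (by omega), heq]
      push_cast
      have : (j + 1 : ℝ) ≠ 0 := by positivity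
      field_simp
      ring
    · rw [if_neg hgt.ne', if_pos (by omega), if_pos (by omega)]; ring
  have hsum : ∀ (A : Finset (Finset E)) (a : Finset E → ℝ) (N : ℕ), (∀ σ ∈ A, σ ∈ K.faces) →
      (∀ σ ∈ A, σ.card ≤ N) →
      ∑ σ ∈ A, a σ • b (Fin.ofNat (k + 1) (σ.card - 1)) =
        ∑ j ∈ Finset.range N, (∑ σ ∈ A with σ.card = j + 1, a σ) • b (Fin.ofNat (k + 1) j) := by
    intro A a N hA hN
    rw [← Finset.sum_fiberwise_of_maps_to (t := Finset.range N) (g := fun σ => σ.card - 1)]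
    · refine Finset.sum_congr rfl fun j _ => ?_
      rw [Finset.sum_smul]
      refine Finset.sum_congr ?_ ?_
      · ext σ
        simp only [Finset.mem_filter, and_congr_right_iff]
        intro hσ
        have := Finset.card_pos.2 (K.nonempty_of_mem_faces (hA σ hσ))
        omega
      · intro σ hσ
        rw [(Finset.mem_filter.1 hσ).2, Nat.add_sub_cancel]
    · intro σ hσ
      have := Finset.card_pos.2 (K.nonempty_of_mem_faces (hA σ hσ))
      have := hN σ hσ
      simp only [Finset.mem_range]
      omega
  have hb : ∀ σ ∈ D ∪ C, σ.card ≤ (D ∪ C).sup Finset.card := fun σ hσ =>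
    Finset.le_sup (f := Finset.card) hσ
  rw [hsum D u _ h'.1 fun σ hσ => hb σ (Finset.mem_union_left _ hσ),
    hsum C w _ h.1 fun σ hσ => hb σ (Finset.mem_union_right _ hσ)]
  refine Finset.sum_congr rfl fun j _ => ?_
  rw [hlevel, hlevel, htail, htail]

end Folding

section Ambient

variable {k : ℕ} (b : AffineBasis (Fin (k + 1)) ℝ (EuclideanSpace ℝ (Fin k)))
  {E E' : Type*} [NormedAddCommGroup E] [NormedSpace ℝ E]
  [NormedAddCommGroup E'] [NormedSpace ℝ E']

/-- The product of (the space of) `K` and the collared `X`. -/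
def ambient (k : ℕ) (K : Geometry.SimplicialComplex ℝ E) (X : Set E') : Set (E × (E' × ℝ)) :=
  K.space ×ˢ collared k X

/-- The fiber product of the folding map `p` and `f`, as a subset of `ambient k K X`. -/
def fiberProduct (K : Geometry.SimplicialComplex ℝ E) (X : Set E')
    (f : E' → EuclideanSpace ℝ (Fin k)) : Set (E × (E' × ℝ)) :=
  {w | w.1 ∈ K.space ∧ w.2.1 ∈ X ∧ w.2.2 = 0 ∧ foldMap b K w.1 = f w.2.1}

/-- The graph of the product `p × f̄` of the folding map and the extension `f̄` of `f` to the
collared manifold. -/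
def productGraph (K : Geometry.SimplicialComplex ℝ E) (X : Set E')
    (f : E' → EuclideanSpace ℝ (Fin k))
    (G : EuclideanSpace ℝ (Fin k) × ℝ → EuclideanSpace ℝ (Fin k)) :
    Set ((E × (E' × ℝ)) × (EuclideanSpace ℝ (Fin k) × EuclideanSpace ℝ (Fin k))) :=
  {q | q.1 ∈ ambient k K X ∧ q.2 = (foldMap b K q.1.1, extendToCollar f G q.1.2)}

/-- The product of `ambient k K X` and the diagonal of `ℝᵏ × ℝᵏ`. -/
def diagonalProduct (k : ℕ) (K : Geometry.SimplicialComplex ℝ E) (X : Set E') :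
    Set ((E × (E' × ℝ)) × (EuclideanSpace ℝ (Fin k) × EuclideanSpace ℝ (Fin k))) :=
  ambient k K X ×ˢ Set.diagonal (EuclideanSpace ℝ (Fin k))

end Ambient

end PL

/-! Everything rests on one local normal form. Let `p` be the folding map, let `p(s₀) = f(z) = y₀`
lie in the open face `α`, and let `L` be the direction of `α`, with orthogonal projection `P` onto
`L`. The two factors have complementary freedom.

On the side of `K`, every simplex of the subdivision that contains a point near `s₀` also contains
the open simplex around `s₀`, whose vertices correspond bijectively to those of `α`. Shifting weight
between these vertices gives one linear map `Λ` with `p(s + Λa) = p(s) + a` for small `a ∈ L`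
(`exists_slide`). On the side of `X`, properness and the manifold structure of the preimage of `α`
show that `X` is near `z` the product of `L` with an orthant, the orthant coordinates being the
barycentric coordinates of `f` at the vertices off `α` (`exists_faceModel`). The coordinate `c`
along `L` is a chart of the preimage of `α` and need not be related to `f`. The collar turns the
orthant into a vector space, with coordinates `y_j - t` (`exists_collarModel`).

Let `F` be a map on the collared `X` with `F(z, 0) = y₀` whose barycentric coordinates off `α` are
these `y_j - t`. Then `(s, q) ↦ (s + Λ(c(q) - P(p(s) - y₀)), p(s) - F(q))` is a local PL
homeomorphism to `K × ℝᵏ` (`exists_productGerm`). Indeed, if `s'` is its first component, then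
`P(p(s') - y₀) = c(q)`, while the coordinates of `p` off `α` are unchanged by the slide; so `s'` and
`d = p(s) - F(q)` determine first `q`, then `p(s)`, then `s`. Hence `p - F` is locally a linear
projection, although neither `p` nor `F` need be.

For the statements about the fiber product, `F` is `f` plus a global PL displacement that makes
small barycentric coordinates decrease along the collar (`exists_shift`). Then `D = p - F` vanishes
exactly on the fiber product, and local flatness is immediate. For the normal bundle, the zero set
of the first component of `D` is locally collared from both sides; local collars merge to collars
near compact sets (`CollaredNear.union`), and induction on the number of components builds the
trivialization (`hasTrivialNormalBundle_of_hasProductGerm`).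

For transversality the collar map `G` is arbitrary, so the extension of `f` need not have the
required coordinates. A local homeomorphism `H` of `ℝᵏ` that is the identity on the simplex
transforms `G` into the linear collar (`IsCollarMap.exists_straightening`). After applying `H` to
both factors of `ℝᵏ × ℝᵏ`, a shear by `p` makes the graph and the diagonal product linear. -/

open scoped Topology

namespace PL

/-! ### Convex polytopes and affine maps on them. -/

section Polytope

variable {E F : Type*} [NormedAddCommGroup E] [NormedSpace ℝ E]
  [NormedAddCommGroup F] [NormedSpace ℝ F]

/-- A convex polytope: the convex hull of a finite set. -/
def IsPolytope (P : Set E) : Prop := ∃ t : Finset E, P = convexHull ℝ (t : Set E)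

theorem isPolytope_convexHull {s : Set E} (hs : s.Finite) : IsPolytope (convexHull ℝ s) :=
  ⟨hs.toFinset, by simp⟩

theorem IsPolytope.isCompact {P : Set E} (hP : IsPolytope P) : IsCompact P := by
  obtain ⟨t, rfl⟩ := hP
  exact t.finite_toSet.isCompact_convexHull (𝕜 := ℝ)

theorem IsPolytope.image {P : Set E} (hP : IsPolytope P) (A : E →ᵃ[ℝ] F) : IsPolytope (A '' P) := by
  obtain ⟨t, rfl⟩ := hP
  rw [AffineMap.image_convexHull]
  exact isPolytope_convexHull (t.finite_toSet.image _)

theorem IsPolytope.prod {P : Set E} {Q : Set F} (hP : IsPolytope P) (hQ : IsPolytope Q) :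
    IsPolytope (P ×ˢ Q) := by
  obtain ⟨t, rfl⟩ := hP
  obtain ⟨u, rfl⟩ := hQ
  rw [← convexHull_prod]
  exact isPolytope_convexHull (t.finite_toSet.prod u.finite_toSet)

/-- A bounded set given by a linear system in nonnegative unknowns is a polytope. -/
theorem isPolytope_of_linear_system {ι : Type*} [Fintype ι] (A : (ι → ℝ) →ₗ[ℝ] F) (c : F)
    (hb : ∀ x : ι → ℝ, 0 ≤ x → A x = c → x ≤ 1) :
    IsPolytope {x : ι → ℝ | 0 ≤ x ∧ A x = c} := by
  set H : Set (ι → ℝ) := {x | 0 ≤ x ∧ A x = c} with hH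
  have hconv : Convex ℝ H := by
    intro x hx y hy a b ha hb hab
    refine ⟨?_, ?_⟩
    · have h1 : 0 ≤ a • x := smul_nonneg ha hx.1
      have h2 : 0 ≤ b • y := smul_nonneg hb hy.1
      exact add_nonneg h1 h2
    · rw [map_add, map_smul, map_smul, hx.2, hy.2, ← add_smul, hab, one_smul]
  have hcl : IsClosed H := by
    have h1 : IsClosed {x : ι → ℝ | 0 ≤ x} := isClosed_le continuous_const continuous_id
    have h2 : IsClosed {x : ι → ℝ | A x = c} :=
      isClosed_eq A.continuous_of_finiteDimensional continuous_const
    exact h1.inter h2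
  have hcomp : IsCompact H :=
    (isCompact_Icc (a := (0 : ι → ℝ)) (b := 1)).of_isClosed_subset hcl
      fun x hx => ⟨hx.1, hb x hx.1 hx.2⟩
  -- An extreme point is determined by its support, and there are finitely many supports.
  have hfin : (H.extremePoints ℝ).Finite := by
    classical
    refine Set.Finite.of_injOn (f := fun x => Finset.univ.filter fun i => x i ≠ 0)
      (t := Set.univ) (fun _ _ => Set.mem_univ _) ?_ Set.finite_univ
    intro x hx y hy hxy
    have hsupp : ∀ i, x i = 0 ↔ y i = 0 := by
      intro i
      have := Finset.ext_iff.1 hxy i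
      simp only [Finset.mem_filter, Finset.mem_univ, true_and] at this
      exact not_iff_not.1 this
    have hxH := extremePoints_subset hx
    have hyH := extremePoints_subset hy
    -- Equal supports: where `x` vanishes so does `x - y`, so a small multiple of `x - y` may be
    -- added to or subtracted from `x` without leaving the orthant.
    obtain ⟨ε, hε0, hε⟩ : ∃ ε > 0, ∀ i, ε * |x i - y i| ≤ x i := by
      have : ∀ i, ∃ ε > 0, ε * |x i - y i| ≤ x i := by
        intro i
        by_cases h : x i = 0
        · exact ⟨1, one_pos, by rw [h, (hsupp i).1 h]; simp⟩
        · have h0 : 0 < x i := lt_of_le_of_ne (hxH.1 i) (Ne.symm h)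
          refine ⟨x i / (|x i - y i| + 1), by positivity, ?_⟩
          rw [div_mul_eq_mul_div, div_le_iff₀ (by positivity)]
          nlinarith [abs_nonneg (x i - y i)]
      choose e he0 he using this
      by_cases hne : Nonempty ι
      · obtain ⟨i₀, hi₀⟩ := Finite.exists_min e
        exact ⟨e i₀, he0 i₀, fun i =>
          (mul_le_mul_of_nonneg_right (hi₀ i) (abs_nonneg _)).trans (he i)⟩
      · exact ⟨1, one_pos, fun i => (hne ⟨i⟩).elim⟩
    by_contra hne
    have hmem : ∀ σ : ℝ, |σ| = ε → x + σ • (x - y) ∈ H := by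
      intro σ hσ
      refine ⟨fun i => ?_, ?_⟩
      · have h1 := hε i
        rw [← hσ, ← abs_mul] at h1
        have := neg_abs_le (σ * (x i - y i))
        simp only [Pi.zero_apply, Pi.add_apply, Pi.smul_apply, Pi.sub_apply, smul_eq_mul]
        linarith
      · rw [map_add, map_smul, map_sub, hxH.2, hyH.2, sub_self, smul_zero, add_zero]
    have := (mem_extremePoints.1 hx).2 _ (hmem ε (abs_of_pos hε0)) _
      (hmem (-ε) (by rw [abs_neg, abs_of_pos hε0]))
      ⟨1 / 2, 1 / 2, by norm_num, by norm_num, by norm_num, by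
        ext i; simp; ring⟩
    have h2 : ε • (x - y) = 0 := by simpa using this.1
    rcases smul_eq_zero.1 h2 with h | h
    · exact hε0.ne' h
    · exact hne (sub_eq_zero.1 h)
  -- Krein–Milman; the hull of the finite set of extreme points is already closed.
  have := closure_convexHull_extremePoints hcomp hconv
  rw [(hfin.isClosed_convexHull (𝕜 := ℝ)).closure_eq] at this
  rw [← this]
  exact isPolytope_convexHull hfin

/-- Convex weights on the vertices of `P` together with convex weights on the vertices of `Q` that
give the same point of `F` form a bounded linear system in nonnegative unknowns. The set in question
is the affine image of its solution set. -/
theorem IsPolytope.inter_preimage {P : Set E} {Q : Set F} (hP : IsPolytope P) (hQ : IsPolytope Q)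
    (A : E →ᵃ[ℝ] F) : IsPolytope (P ∩ A ⁻¹' Q) := by
  classical
  obtain ⟨t, rfl⟩ := hP
  obtain ⟨u, rfl⟩ := hQ
  let p : (t ⊕ u → ℝ) →ₗ[ℝ] E := ∑ i : t, (LinearMap.proj (Sum.inl i)).smulRight (i : E)
  let L₁ : (t ⊕ u → ℝ) →ₗ[ℝ] ℝ := ∑ i : t, LinearMap.proj (Sum.inl i)
  let L₂ : (t ⊕ u → ℝ) →ₗ[ℝ] ℝ := ∑ i : u, LinearMap.proj (Sum.inr i)
  let L₃ : (t ⊕ u → ℝ) →ₗ[ℝ] F := ∑ i : t, (LinearMap.proj (Sum.inl i)).smulRight (A i) -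
    ∑ i : u, (LinearMap.proj (Sum.inr i)).smulRight (i : F)
  let L : (t ⊕ u → ℝ) →ₗ[ℝ] ℝ × ℝ × F := L₁.prod (L₂.prod L₃)
  have hp : ∀ x, p x = ∑ i : t, x (Sum.inl i) • (i : E) := fun x => by
    simp [p, LinearMap.sum_apply]
  have hL : ∀ x, L x = (∑ i : t, x (Sum.inl i), ∑ i : u, x (Sum.inr i),
      ∑ i : t, x (Sum.inl i) • A i - ∑ i : u, x (Sum.inr i) • (i : F)) := fun x => by
    simp [L, L₁, L₂, L₃, LinearMap.sum_apply]
  have hA : ∀ w : t → ℝ, ∑ i, w i = 1 → A (∑ i, w i • (i : E)) = ∑ i, w i • A i := by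
    intro w hw
    have h := Finset.univ.map_affineCombination (fun i : t => (i : E)) w hw A
    rw [Finset.affineCombination_eq_linear_combination _ _ _ hw,
      Finset.affineCombination_eq_linear_combination _ _ _ hw] at h
    exact h
  have key : convexHull ℝ (t : Set E) ∩ A ⁻¹' convexHull ℝ (u : Set F) =
      p.toAffineMap '' {x | 0 ≤ x ∧ L x = (1, 1, 0)} := by
    ext y
    simp only [Set.mem_inter_iff, Set.mem_preimage, Set.mem_image, LinearMap.coe_toAffineMap]
    constructor
    · rintro ⟨h1, h2⟩
      obtain ⟨w, hw0, hw1, rfl⟩ := Finset.mem_convexHull'.1 h1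
      obtain ⟨v, hv0, hv1, hv⟩ := Finset.mem_convexHull'.1 h2
      have e1 : ∑ i : t, w i • (i : E) = ∑ i ∈ t, w i • i := Finset.sum_coe_sort t fun i => w i • i
      have e2 : ∑ i : u, v i • (i : F) = ∑ i ∈ u, v i • i := Finset.sum_coe_sort u fun i => v i • i
      have e3 : ∑ i : t, w i = 1 := (Finset.sum_coe_sort t w).trans hw1
      have e4 : ∑ i : u, v i = 1 := (Finset.sum_coe_sort u v).trans hv1
      refine ⟨Sum.elim (fun i : t => w i) (fun i : u => v i), ⟨?_, ?_⟩, ?_⟩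
      · rintro (i | i)
        · exact hw0 i i.2
        · exact hv0 i i.2
      · rw [hL]
        simp only [Sum.elim_inl, Sum.elim_inr, e3, e4, e2, hv]
        rw [← hA _ e3, e1, sub_self]
      · rw [hp]; exact e1
    · rintro ⟨x, ⟨hx0, hx⟩, rfl⟩
      rw [hL, Prod.mk.injEq, Prod.mk.injEq] at hx
      obtain ⟨h1, h2, h3⟩ := hx
      have hm : ∀ {G : Type _} [NormedAddCommGroup G] [NormedSpace ℝ G] (s : Finset G)
          (w : s → ℝ), (∀ i, 0 ≤ w i) → ∑ i, w i = 1 →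
          ∑ i, w i • (i : G) ∈ convexHull ℝ (s : Set G) := fun s w h0 h1 =>
        (convex_convexHull ℝ _).sum_mem (fun i _ => h0 i) h1
          fun i _ => subset_convexHull ℝ _ i.2
      rw [hp]
      refine ⟨hm t _ (fun i => hx0 _) h1, ?_⟩
      rw [hA _ h1, sub_eq_zero.1 h3]
      exact (convex_convexHull ℝ _).sum_mem (fun i _ => hx0 _) h2
          fun i _ => subset_convexHull ℝ _ i.2
  rw [key]
  refine (isPolytope_of_linear_system L _ ?_).image _
  intro x hx hxL
  rw [hL, Prod.mk.injEq, Prod.mk.injEq] at hxL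
  rintro (i | i)
  · rw [Pi.one_apply, ← hxL.1]
    exact Finset.single_le_sum (f := fun i : t => x (Sum.inl i)) (fun j _ => hx _)
      (Finset.mem_univ i)
  · rw [Pi.one_apply, ← hxL.2.1]
    exact Finset.single_le_sum (f := fun i : u => x (Sum.inr i)) (fun j _ => hx _)
      (Finset.mem_univ i)

theorem IsPolytope.inter {P Q : Set E} (hP : IsPolytope P) (hQ : IsPolytope Q) :
    IsPolytope (P ∩ Q) := hP.inter_preimage hQ (AffineMap.id ℝ E)

theorem isPolytope_Icc (a b : ℝ) : IsPolytope (Set.Icc a b) := by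
  rcases le_or_gt a b with h | h
  · rw [← segment_eq_Icc h, ← convexHull_pair]
    exact isPolytope_convexHull (by simp)
  · rw [Set.Icc_eq_empty (not_le.2 h), ← convexHull_empty (𝕜 := ℝ)]
    exact isPolytope_convexHull Set.finite_empty

theorem exists_isPolytope_subset [FiniteDimensional ℝ E] {x : E} {N : Set E} (hN : N ∈ 𝓝 x) :
    ∃ B ∈ 𝓝 x, B ⊆ N ∧ IsPolytope B := by
  obtain ⟨b, hb, hbN⟩ := exists_mem_interior_convexHull_affineBasis hN
  exact ⟨_, mem_interior_iff_mem_nhds.1 hb, hbN, isPolytope_convexHull (Set.finite_range b)⟩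

/-- A map on a polytope that preserves convex combinations of the vertices is affine. -/
theorem exists_affineMap_of_convexCombination (t : Finset E) (h : E → F)
    (hh : ∀ w : E → ℝ, (∀ x ∈ t, 0 ≤ w x) → ∑ x ∈ t, w x = 1 →
      h (∑ x ∈ t, w x • x) = ∑ x ∈ t, w x • h x) :
    ∃ A : E →ᵃ[ℝ] F, Set.EqOn h A (convexHull ℝ (t : Set E)) := by
  classical
  let L : (E → ℝ) →ₗ[ℝ] ℝ × E := (∑ x ∈ t, LinearMap.proj x).prod
    (∑ x ∈ t, (LinearMap.proj x).smulRight x)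
  let M : (E → ℝ) →ₗ[ℝ] F := ∑ x ∈ t, (LinearMap.proj x).smulRight (h x)
  have hL : ∀ w, L w = (∑ x ∈ t, w x, ∑ x ∈ t, w x • x) := fun w => by
    simp [L]
  have hM : ∀ w, M w = ∑ x ∈ t, w x • h x := fun w => by simp [M, LinearMap.sum_apply]
  -- An affine relation among the vertices becomes, on separating positive and negative weights, an
  -- equality of two nonnegative combinations of the same total weight `c`. After division by `c`
  -- the hypothesis applies to both; if `c = 0` all weights vanish.
  have hker : ∀ w, L w = 0 → M w = 0 := by
    intro w hw
    rw [hL, Prod.mk_eq_zero] at hw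
    rw [hM]
    have hsplit : ∀ x, w x = max (w x) 0 - max (-w x) 0 := fun x => by
      rcases le_total (w x) 0 with h | h
      · rw [max_eq_right h, max_eq_left (by linarith)]; ring
      · rw [max_eq_left h, max_eq_right (by linarith)]; ring
    set c := ∑ x ∈ t, max (w x) 0 with hc
    have hc' : ∑ x ∈ t, max (-w x) 0 = c := by
      have := hw.1
      rw [Finset.sum_congr rfl fun x _ => hsplit x, Finset.sum_sub_distrib] at this
      linarith
    have hE : ∑ x ∈ t, max (w x) 0 • x = ∑ x ∈ t, max (-w x) 0 • x := by
      have := hw.2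
      rw [Finset.sum_congr rfl fun x _ => by rw [hsplit x, sub_smul],
        Finset.sum_sub_distrib] at this
      exact sub_eq_zero.1 this
    have hc0 : 0 ≤ c := Finset.sum_nonneg fun _ _ => le_max_right _ _
    rcases hc0.eq_or_lt with h0 | h0
    · refine Finset.sum_eq_zero fun x hx => ?_
      have h1 := (Finset.sum_eq_zero_iff_of_nonneg (fun _ _ => le_max_right _ _)).1 h0.symm x hx
      have h2 := (Finset.sum_eq_zero_iff_of_nonneg
        (fun _ _ => le_max_right _ _)).1 (hc'.trans h0.symm) x hx
      rw [hsplit x, h1, h2, sub_zero, zero_smul]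
    · have e1 := hh (fun x => c⁻¹ * max (w x) 0)
        (fun x _ => mul_nonneg (inv_nonneg.2 hc0) (le_max_right _ _))
        (by rw [← Finset.mul_sum, ← hc, inv_mul_cancel₀ h0.ne'])
      have e2 := hh (fun x => c⁻¹ * max (-w x) 0)
        (fun x _ => mul_nonneg (inv_nonneg.2 hc0) (le_max_right _ _))
        (by rw [← Finset.mul_sum, hc', inv_mul_cancel₀ h0.ne'])
      simp only [mul_smul, ← Finset.smul_sum] at e1 e2
      rw [hE, e2] at e1
      have := smul_right_injective F (inv_ne_zero h0.ne') e1
      rw [Finset.sum_congr rfl fun x _ => by rw [hsplit x, sub_smul], Finset.sum_sub_distrib]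
      exact sub_eq_zero.2 this.symm
  -- By `hker` the map `M` factors through `L`; a linear section over the range of `L` gives the
  -- factor, which is then extended to all of `ℝ × E`.
  obtain ⟨s, hs⟩ := L.rangeRestrict.exists_rightInverse_of_surjective L.range_rangeRestrict
  obtain ⟨N, hN⟩ := (M ∘ₗ s).exists_extend
  have hNL : ∀ w, N (L w) = M w := by
    intro w
    have h1 : N (L w) = M (s (L.rangeRestrict w)) :=
      LinearMap.congr_fun hN (L.rangeRestrict w)
    have h2 : L (w - s (L.rangeRestrict w)) = 0 := by
      have := LinearMap.congr_fun hs (L.rangeRestrict w)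
      have h3 : L (s (L.rangeRestrict w)) = L w := congrArg Subtype.val this
      rw [map_sub, h3, sub_self]
    have h3 := hker _ h2
    rw [map_sub, sub_eq_zero] at h3
    rw [h1, h3]
  -- The affine map is `N` on the hyperplane at height `1`, since convex weights sum to `1`.
  refine ⟨(N ∘ₗ LinearMap.inr ℝ ℝ E).toAffineMap + AffineMap.const ℝ E (N (1, 0)), ?_⟩
  intro y hy
  obtain ⟨w, hw0, hw1, rfl⟩ := Finset.mem_convexHull'.1 hy
  have h2 := hNL w
  rw [hL, hM, hw1] at h2
  rw [hh w hw0 hw1, ← h2]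
  have : ((1 : ℝ), ∑ x ∈ t, w x • x) = (0, ∑ x ∈ t, w x • x) + (1, 0) := by simp
  rw [this, map_add]
  rfl

end Polytope

/-! ### Calculus of piecewise linear germs. -/

section Germ

set_option linter.unusedSectionVars false

variable {E F H : Type*} [NormedAddCommGroup E] [NormedSpace ℝ E]
  [NormedAddCommGroup F] [NormedSpace ℝ F] [NormedAddCommGroup H] [NormedSpace ℝ H]

/-- The germ at `x` of the map `f` on `S` is piecewise linear. -/
def PLAt (f : E → F) (S : Set E) (x : E) : Prop :=
  ∃ 𝒞 : Set (Set E), 𝒞.Finite ∧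
    (∀ P ∈ 𝒞, IsPolytope P ∧ P ⊆ S ∧ ∃ A : E →ᵃ[ℝ] F, Set.EqOn f A P) ∧ ⋃₀ 𝒞 ∈ 𝓝[S] x

/-- The germ of `S` at `x` is a polyhedron. -/
def PolyAt (S : Set E) (x : E) : Prop := PLAt (fun y => y) S x

theorem isPLOn_iff {f : E → F} {S : Set E} : IsPLOn f S ↔ ∀ x ∈ S, PLAt f S x := by
  classical
  refine forall₂_congr fun x _ => ⟨?_, ?_⟩
  · rintro ⟨T, hT, hx⟩
    refine ⟨(fun t : Finset E => convexHull ℝ (t : Set E)) '' T, T.finite_toSet.image _, ?_, ?_⟩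
    · rintro _ ⟨t, ht, rfl⟩
      exact ⟨⟨t, rfl⟩, (hT t ht).1, (hT t ht).2⟩
    · simpa [Set.sUnion_image] using hx
  · rintro ⟨𝒞, hfin, h𝒞, hx⟩
    have hch : ∀ P : Set E, ∃ t : Finset E, P ∈ 𝒞 → P = convexHull ℝ (t : Set E) := fun P => by
      by_cases hP : P ∈ 𝒞
      · obtain ⟨t, ht⟩ := (h𝒞 P hP).1
        exact ⟨t, fun _ => ht⟩
      · exact ⟨∅, fun h => (hP h).elim⟩
    choose t ht using hch
    refine ⟨hfin.toFinset.image t, ?_, ?_⟩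
    · intro u hu
      obtain ⟨P, hP, rfl⟩ := Finset.mem_image.1 hu
      have hP' := hfin.mem_toFinset.1 hP
      rw [← ht P hP']
      exact (h𝒞 P hP').2
    · refine Filter.mem_of_superset hx ?_
      rintro y ⟨P, hP, hy⟩
      simp only [Set.mem_iUnion]
      refine ⟨t P, Finset.mem_image_of_mem _ (hfin.mem_toFinset.2 hP), ?_⟩
      rw [← ht P hP]
      exact hy

theorem PLAt.isPLOn_inter {f : E → F} {S : Set E} {x : E} (h : PLAt f S x) :
    ∀ᶠ y in 𝓝[S] x, PLAt f S y := by
  obtain ⟨𝒞, hfin, h𝒞, hx⟩ := h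
  filter_upwards [eventually_eventually_nhdsWithin.2 hx] with y hy
  exact ⟨𝒞, hfin, h𝒞, hy⟩

theorem PLAt.polyAt {f : E → F} {S : Set E} {x : E} (h : PLAt f S x) : PolyAt S x := by
  obtain ⟨𝒞, hfin, h𝒞, hx⟩ := h
  exact ⟨𝒞, hfin, fun P hP => ⟨(h𝒞 P hP).1, (h𝒞 P hP).2.1, AffineMap.id ℝ E, fun _ _ => rfl⟩, hx⟩

theorem PLAt.continuousWithinAt [FiniteDimensional ℝ E] {f : E → F} {S : Set E} {x : E}
    (h : PLAt f S x) : ContinuousWithinAt f S x := by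
  obtain ⟨𝒞, hfin, h𝒞, hx⟩ := h
  have hcl : IsClosed (⋃₀ 𝒞) := by
    rw [Set.sUnion_eq_biUnion]
    exact hfin.isClosed_biUnion fun P hP => (h𝒞 P hP).1.isCompact.isClosed
  have hc : ContinuousOn f (⋃₀ 𝒞) := by
    have : Finite 𝒞 := hfin
    rw [Set.sUnion_eq_iUnion]
    refine LocallyFinite.continuousOn_iUnion (locallyFinite_of_finite _)
      (fun P => (h𝒞 P P.2).1.isCompact.isClosed) fun P => ?_
    obtain ⟨A, hA⟩ := (h𝒞 P P.2).2.2
    exact A.continuous_of_finiteDimensional.continuousOn.congr hA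
  by_cases hxP : x ∈ ⋃₀ 𝒞
  · exact (hc x hxP).mono_of_mem_nhdsWithin hx
  · have h1 : (⋃₀ 𝒞)ᶜ ∈ 𝓝[S] x := mem_nhdsWithin_of_mem_nhds (hcl.isOpen_compl.mem_nhds hxP)
    have h2 : 𝓝[S] x = ⊥ := by
      rw [← Filter.empty_mem_iff_bot]
      have := Filter.inter_mem hx h1
      rwa [Set.inter_compl_self] at this
    rw [ContinuousWithinAt, h2]
    exact Filter.tendsto_bot

theorem IsPLOn.continuousOn [FiniteDimensional ℝ E] {f : E → F} {S : Set E} (h : IsPLOn f S) :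
    ContinuousOn f S := fun x hx => (isPLOn_iff.1 h x hx).continuousWithinAt

/-- Germs are also taken at points outside `S`, where off the closure there is nothing to check.
Closed pieces can therefore be glued at a point without asking which of them contain it. -/
theorem PLAt.of_bot {f : E → F} {S : Set E} {x : E} (h : 𝓝[S] x = ⊥) : PLAt f S x :=
  ⟨∅, Set.finite_empty, by simp, by simp [h]⟩

variable [FiniteDimensional ℝ E]

/-- The polytopes are cut down by a small polytope neighbourhood of `x`. This localization makes
`PLAt` depend only on the germs of `f` and `S`. -/
theorem PLAt.exists_subset {f : E → F} {S : Set E} {x : E} (h : PLAt f S x) {N : Set E}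
    (hN : N ∈ 𝓝[S] x) : ∃ 𝒞 : Set (Set E), 𝒞.Finite ∧
    (∀ P ∈ 𝒞, IsPolytope P ∧ P ⊆ S ∩ N ∧ ∃ A : E →ᵃ[ℝ] F, Set.EqOn f A P) ∧ ⋃₀ 𝒞 ∈ 𝓝[S] x := by
  obtain ⟨O, hO, hON⟩ := mem_nhdsWithin_iff_exists_mem_nhds_inter.1 hN
  obtain ⟨𝒞, hfin, h𝒞, hx⟩ := h
  obtain ⟨B, hB, hBO, hBp⟩ := exists_isPolytope_subset hO
  refine ⟨(· ∩ B) '' 𝒞, hfin.image _, ?_, ?_⟩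
  · rintro _ ⟨P, hP, rfl⟩
    obtain ⟨h1, h2, A, hA⟩ := h𝒞 P hP
    exact ⟨h1.inter hBp, fun y hy => ⟨h2 hy.1, hON ⟨hBO hy.2, h2 hy.1⟩⟩, A,
      hA.mono Set.inter_subset_left⟩
  · filter_upwards [hx, mem_nhdsWithin_of_mem_nhds hB]
    rintro y ⟨P, hP, hy⟩ hyB
    exact ⟨P ∩ B, ⟨P, hP, rfl⟩, hy, hyB⟩

theorem PLAt.congr {f g : E → F} {S : Set E} {x : E} (h : PLAt f S x)
    (hfg : ∀ᶠ y in 𝓝[S] x, g y = f y) : PLAt g S x := by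
  obtain ⟨𝒞, hfin, h𝒞, hx⟩ := h.exists_subset hfg
  refine ⟨𝒞, hfin, fun P hP => ?_, hx⟩
  obtain ⟨h1, h2, A, hA⟩ := h𝒞 P hP
  exact ⟨h1, fun y hy => (h2 hy).1, A, fun y hy => (h2 hy).2.trans (hA hy)⟩

theorem PLAt.congr_set {f : E → F} {S S' : Set E} {x : E} (h : PLAt f S x)
    (hS : 𝓝[S] x = 𝓝[S'] x) : PLAt f S' x := by
  obtain ⟨𝒞, hfin, h𝒞, hx⟩ := h.exists_subset (N := S') (hS ▸ self_mem_nhdsWithin)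
  refine ⟨𝒞, hfin, fun P hP => ?_, hS ▸ hx⟩
  obtain ⟨h1, h2, A, hA⟩ := h𝒞 P hP
  exact ⟨h1, fun y hy => (h2 hy).2, A, hA⟩

theorem PLAt.inter_open {f : E → F} {S O : Set E} {x : E} (h : PLAt f S x) (hO : O ∈ 𝓝[S] x) :
    PLAt f (S ∩ O) x := by
  refine h.congr_set ?_
  refine le_antisymm ?_ (nhdsWithin_mono _ Set.inter_subset_left)
  exact nhdsWithin_le_of_mem (Filter.inter_mem self_mem_nhdsWithin hO)

/-- The pieces are `P ∩ f⁻¹(Q)`. They are polytopes because `f` is affine on `P`, and they cover a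
neighbourhood because `f` is continuous. -/
theorem PLAt.comp {g : F → H} {f : E → F} {S : Set E} {T : Set F} {x : E} (hg : PLAt g T (f x))
    (hf : PLAt f S x) (hT : ∀ᶠ y in 𝓝[S] x, f y ∈ T) : PLAt (fun y => g (f y)) S x := by
  have hc := hf.continuousWithinAt
  obtain ⟨𝒞, hfin, h𝒞, hx⟩ := hf
  obtain ⟨𝒬, hfin', h𝒬, hx'⟩ := hg
  refine ⟨(fun p : Set E × Set F => p.1 ∩ f ⁻¹' p.2) '' (𝒞 ×ˢ 𝒬), (hfin.prod hfin').image _,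
    ?_, ?_⟩
  · rintro _ ⟨⟨P, Q⟩, ⟨hP, hQ⟩, rfl⟩
    obtain ⟨h1, h2, A, hA⟩ := h𝒞 P hP
    obtain ⟨h1', h2', A', hA'⟩ := h𝒬 Q hQ
    have he : P ∩ f ⁻¹' Q = P ∩ A ⁻¹' Q := by
      ext y
      simp only [Set.mem_inter_iff, Set.mem_preimage]
      exact and_congr_right fun hy => by rw [hA hy]
    refine ⟨?_, fun y hy => h2 hy.1, A'.comp A, fun y hy => ?_⟩
    · change IsPolytope (P ∩ f ⁻¹' Q)
      rw [he]
      exact h1.inter_preimage h1' A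
    · have : g (f y) = A' (f y) := hA' hy.2
      simp only [AffineMap.comp_apply]
      rw [this, hA hy.1]
  · have ht : Filter.Tendsto f (𝓝[S] x) (𝓝[T] (f x)) :=
      tendsto_nhdsWithin_of_tendsto_nhds_of_eventually_within _ hc hT
    filter_upwards [hx, ht hx']
    rintro y ⟨P, hP, hy⟩ ⟨Q, hQ, hy'⟩
    exact ⟨_, ⟨(P, Q), ⟨hP, hQ⟩, rfl⟩, hy, hy'⟩

/-- Restriction is composition with the inclusion, so `S'` must itself be a polyhedron near `x`. -/
theorem PLAt.mono {f : E → F} {S S' : Set E} {x : E} (h : PLAt f S x) (hS' : PolyAt S' x)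
    (hss : ∀ᶠ y in 𝓝[S'] x, y ∈ S) : PLAt f S' x := PLAt.comp h hS' hss

theorem PLAt.prodMk {f : E → F} {g : E → H} {S : Set E} {x : E} (hf : PLAt f S x)
    (hg : PLAt g S x) : PLAt (fun y => (f y, g y)) S x := by
  obtain ⟨𝒞, hfin, h𝒞, hx⟩ := hf
  obtain ⟨𝒬, hfin', h𝒬, hx'⟩ := hg
  refine ⟨(fun p : Set E × Set E => p.1 ∩ p.2) '' (𝒞 ×ˢ 𝒬), (hfin.prod hfin').image _, ?_, ?_⟩
  · rintro _ ⟨⟨P, Q⟩, ⟨hP, hQ⟩, rfl⟩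
    obtain ⟨h1, h2, A, hA⟩ := h𝒞 P hP
    obtain ⟨h1', h2', A', hA'⟩ := h𝒬 Q hQ
    exact ⟨h1.inter h1', fun y hy => h2 hy.1, A.prod A', fun y hy =>
      Prod.ext (hA hy.1) (hA' hy.2)⟩
  · filter_upwards [hx, hx']
    rintro y ⟨P, hP, hy⟩ ⟨Q, hQ, hy'⟩
    exact ⟨_, ⟨(P, Q), ⟨hP, hQ⟩, rfl⟩, hy, hy'⟩

theorem PLAt.union {f : E → F} {S S' : Set E} {x : E} (h : PLAt f S x) (h' : PLAt f S' x) :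
    PLAt f (S ∪ S') x := by
  obtain ⟨𝒞, hfin, h𝒞, hx⟩ := h
  obtain ⟨𝒬, hfin', h𝒬, hx'⟩ := h'
  refine ⟨𝒞 ∪ 𝒬, hfin.union hfin', ?_, ?_⟩
  · rintro P (hP | hP)
    · obtain ⟨h1, h2, h3⟩ := h𝒞 P hP
      exact ⟨h1, h2.trans Set.subset_union_left, h3⟩
    · obtain ⟨h1, h2, h3⟩ := h𝒬 P hP
      exact ⟨h1, h2.trans Set.subset_union_right, h3⟩
  · rw [Set.sUnion_union, nhdsWithin_union]
    exact Filter.mem_sup.2 ⟨Filter.mem_of_superset hx Set.subset_union_left,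
      Filter.mem_of_superset hx' Set.subset_union_right⟩

theorem PolyAt.preimage {f : E → F} {S : Set E} {T : Set F} {x : E} (hf : PLAt f S x)
    (hT : PolyAt T (f x)) : PolyAt (S ∩ f ⁻¹' T) x := by
  have hc := hf.continuousWithinAt
  obtain ⟨𝒞, hfin, h𝒞, hx⟩ := hf
  obtain ⟨𝒬, hfin', h𝒬, hx'⟩ := hT
  refine ⟨(fun p : Set E × Set F => p.1 ∩ f ⁻¹' p.2) '' (𝒞 ×ˢ 𝒬), (hfin.prod hfin').image _,
    ?_, ?_⟩
  · rintro _ ⟨⟨P, Q⟩, ⟨hP, hQ⟩, rfl⟩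
    obtain ⟨h1, h2, A, hA⟩ := h𝒞 P hP
    obtain ⟨h1', h2', -⟩ := h𝒬 Q hQ
    have he : P ∩ f ⁻¹' Q = P ∩ A ⁻¹' Q := by
      ext y
      simp only [Set.mem_inter_iff, Set.mem_preimage]
      exact and_congr_right fun hy => by rw [hA hy]
    refine ⟨?_, fun y hy => ⟨h2 hy.1, h2' hy.2⟩, AffineMap.id ℝ E, fun y hy => rfl⟩
    change IsPolytope (P ∩ f ⁻¹' Q)
    rw [he]
    exact h1.inter_preimage h1' A
  · have ht : Filter.Tendsto f (𝓝[S ∩ f ⁻¹' T] x) (𝓝[T] (f x)) :=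
      tendsto_nhdsWithin_of_tendsto_nhds_of_eventually_within _
        (hc.mono Set.inter_subset_left)
        (Filter.mem_of_superset self_mem_nhdsWithin fun y hy => hy.2)
    filter_upwards [nhdsWithin_mono _ Set.inter_subset_left hx, ht hx']
    rintro y ⟨P, hP, hy⟩ ⟨Q, hQ, hy'⟩
    exact ⟨_, ⟨(P, Q), ⟨hP, hQ⟩, rfl⟩, hy, hy'⟩

theorem PLAt.affine (A : E →ᵃ[ℝ] F) (x : E) : PLAt A Set.univ x := by
  obtain ⟨B, hB, -, hBp⟩ := exists_isPolytope_subset (Filter.univ_mem : Set.univ ∈ 𝓝 x)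
  exact ⟨{B}, Set.finite_singleton _, by
    rintro P rfl
    exact ⟨hBp, Set.subset_univ _, A, fun _ _ => rfl⟩, by simpa using hB⟩

theorem PolyAt.univ (x : E) : PolyAt Set.univ x := PLAt.affine (AffineMap.id ℝ E) x

theorem PLAt.linear (A : E →ₗ[ℝ] F) {S : Set E} {x : E} (hS : PolyAt S x) : PLAt A S x :=
  PLAt.mono (PLAt.affine A.toAffineMap x) hS (by simp)

theorem PLAt.const (c : F) {S : Set E} {x : E} (hS : PolyAt S x) : PLAt (fun _ => c) S x :=
  PLAt.mono (PLAt.affine (AffineMap.const ℝ E c) x) hS (by simp)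

theorem IsPolytope.polyAt {P : Set E} (hP : IsPolytope P) (x : E) : PolyAt P x :=
  ⟨{P}, Set.finite_singleton _, by
    rintro Q rfl
    exact ⟨hP, subset_rfl, AffineMap.id ℝ E, fun _ _ => rfl⟩, by
    simpa using self_mem_nhdsWithin⟩

theorem PolyAt.prod {S : Set E} {T : Set F} {x : E} {y : F} (hS : PolyAt S x) (hT : PolyAt T y) :
    PolyAt (S ×ˢ T) (x, y) := by
  obtain ⟨𝒞, hfin, h𝒞, hx⟩ := hS
  obtain ⟨𝒬, hfin', h𝒬, hy⟩ := hT
  refine ⟨(fun p : Set E × Set F => p.1 ×ˢ p.2) '' (𝒞 ×ˢ 𝒬), (hfin.prod hfin').image _, ?_, ?_⟩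
  · rintro _ ⟨⟨P, Q⟩, ⟨hP, hQ⟩, rfl⟩
    exact ⟨(h𝒞 P hP).1.prod (h𝒬 Q hQ).1, Set.prod_mono (h𝒞 P hP).2.1 (h𝒬 Q hQ).2.1,
      AffineMap.id ℝ _, fun _ _ => rfl⟩
  · rw [nhdsWithin_prod_eq]
    refine Filter.mem_of_superset (Filter.prod_mem_prod hx hy) ?_
    rintro ⟨a, b⟩ ⟨⟨P, hP, ha⟩, ⟨Q, hQ, hb⟩⟩
    exact ⟨_, ⟨(P, Q), ⟨hP, hQ⟩, rfl⟩, ha, hb⟩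

/-- Near `y` the ray agrees with a compact interval, which is a polytope. -/
theorem PolyAt.Ici (a y : ℝ) : PolyAt (Set.Ici a) y := by
  refine PLAt.congr_set ((isPolytope_Icc a (y + 1)).polyAt y) ?_
  rw [← Set.Ici_inter_Iic]
  exact (nhdsWithin_inter_of_mem' (mem_nhdsWithin_of_mem_nhds (Iic_mem_nhds (lt_add_one y))))

theorem PolyAt.Iic (a y : ℝ) : PolyAt (Set.Iic a) y := by
  refine PLAt.congr_set ((isPolytope_Icc (y - 1) a).polyAt y) ?_
  rw [← Set.Ici_inter_Iic, Set.inter_comm]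
  exact (nhdsWithin_inter_of_mem' (mem_nhdsWithin_of_mem_nhds (Ici_mem_nhds (sub_one_lt y))))

theorem PolyAt.Icc (a b y : ℝ) : PolyAt (Set.Icc a b) y := (isPolytope_Icc a b).polyAt y

theorem PolyAt.singleton (a y : E) : PolyAt {a} y := by
  refine IsPolytope.polyAt ?_ y
  rw [← convexHull_singleton (𝕜 := ℝ) a]
  exact isPolytope_convexHull (Set.finite_singleton _)

theorem PLAt.affine_comp {f : E → F} {S : Set E} {x : E} (A : F →ᵃ[ℝ] H) (hf : PLAt f S x) :
    PLAt (fun y => A (f y)) S x := by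
  obtain ⟨𝒞, hfin, h𝒞, hx⟩ := hf
  refine ⟨𝒞, hfin, fun P hP => ?_, hx⟩
  obtain ⟨h1, h2, A', hA⟩ := h𝒞 P hP
  exact ⟨h1, h2, A.comp A', fun y hy => congrArg A (hA hy)⟩

theorem PLAt.linear_comp {f : E → F} {S : Set E} {x : E} (A : F →ₗ[ℝ] H) (hf : PLAt f S x) :
    PLAt (fun y => A (f y)) S x := hf.affine_comp A.toAffineMap

theorem PLAt.fst {f : E → F × H} {S : Set E} {x : E} (hf : PLAt f S x) :
    PLAt (fun y => (f y).1) S x := hf.linear_comp (LinearMap.fst ℝ F H)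

theorem PLAt.snd {f : E → F × H} {S : Set E} {x : E} (hf : PLAt f S x) :
    PLAt (fun y => (f y).2) S x := hf.linear_comp (LinearMap.snd ℝ F H)

theorem PLAt.add {f g : E → F} {S : Set E} {x : E} (hf : PLAt f S x) (hg : PLAt g S x) :
    PLAt (fun y => f y + g y) S x :=
  (hf.prodMk hg).linear_comp (LinearMap.fst ℝ F F + LinearMap.snd ℝ F F)

theorem PLAt.sub {f g : E → F} {S : Set E} {x : E} (hf : PLAt f S x) (hg : PLAt g S x) :
    PLAt (fun y => f y - g y) S x :=
  (hf.prodMk hg).linear_comp (LinearMap.fst ℝ F F - LinearMap.snd ℝ F F)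

theorem PLAt.neg {f : E → F} {S : Set E} {x : E} (hf : PLAt f S x) :
    PLAt (fun y => -f y) S x := hf.linear_comp (-LinearMap.id)

theorem PLAt.smul_const {f : E → ℝ} {S : Set E} {x : E} (hf : PLAt f S x) (v : F) :
    PLAt (fun y => f y • v) S x := hf.linear_comp (LinearMap.id.smulRight v)

theorem PLAt.const_smul {f : E → F} {S : Set E} {x : E} (hf : PLAt f S x) (c : ℝ) :
    PLAt (fun y => c • f y) S x := hf.linear_comp (c • LinearMap.id)

theorem PLAt.sum {ι : Type*} {f : ι → E → F} {S : Set E} {x : E} (hS : PolyAt S x) (s : Finset ι)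
    (hf : ∀ i ∈ s, PLAt (f i) S x) : PLAt (fun y => ∑ i ∈ s, f i y) S x := by
  classical
  induction s using Finset.induction_on with
  | empty => simpa using PLAt.const 0 hS
  | insert a s ha ih =>
    simp only [Finset.sum_insert ha]
    exact (hf a (Finset.mem_insert_self _ _)).add
      (ih fun i hi => hf i (Finset.mem_insert_of_mem hi))

/-- The two regions where `f - g` has a fixed sign are polyhedra covering `S`, and the maximum is
one of the two functions on each. -/
theorem PLAt.max {f g : E → ℝ} {S : Set E} {x : E} (hf : PLAt f S x) (hg : PLAt g S x) :
    PLAt (fun y => max (f y) (g y)) S x := by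
  have h1 : PolyAt (S ∩ (fun y => f y - g y) ⁻¹' Set.Ici 0) x :=
    PolyAt.preimage (hf.sub hg) (PolyAt.Ici _ _)
  have h2 : PolyAt (S ∩ (fun y => f y - g y) ⁻¹' Set.Iic 0) x :=
    PolyAt.preimage (hf.sub hg) (PolyAt.Iic _ _)
  have hm : ∀ {T : Set ℝ} {h : E → ℝ}, ∀ᶠ y in 𝓝[S ∩ h ⁻¹' T] x, y ∈ S ∩ h ⁻¹' T :=
    self_mem_nhdsWithin
  have h3 := ((hf.mono h1 (hm.mono fun y hy => hy.1)).congr (g := fun y => Max.max (f y) (g y))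
    (hm.mono fun y hy => max_eq_left (sub_nonneg.1 hy.2)))
  have h4 := ((hg.mono h2 (hm.mono fun y hy => hy.1)).congr (g := fun y => Max.max (f y) (g y))
    (hm.mono fun y hy => max_eq_right (sub_nonpos.1 hy.2)))
  have h5 := h3.union h4
  rwa [← Set.inter_union_distrib_left, ← Set.preimage_union, Set.union_comm, Set.Iic_union_Ici,
    Set.preimage_univ, Set.inter_univ] at h5

theorem PLAt.min {f g : E → ℝ} {S : Set E} {x : E} (hf : PLAt f S x) (hg : PLAt g S x) :
    PLAt (fun y => min (f y) (g y)) S x := by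
  refine ((hf.neg.max hg.neg).neg).congr (Filter.Eventually.of_forall fun y => ?_)
  rw [max_neg_neg, neg_neg]

theorem PLAt.sup' {ι : Type*} {f : ι → E → ℝ} {S : Set E} {x : E} (s : Finset ι)
    (hs : s.Nonempty) (hf : ∀ i ∈ s, PLAt (f i) S x) : PLAt (fun y => s.sup' hs (f · y)) S x := by
  classical
  induction hs using Finset.Nonempty.cons_induction with
  | singleton a => simpa using hf a (by simp)
  | cons a s ha hs ih =>
    simp only [Finset.sup'_cons hs]
    exact (hf a (Finset.mem_cons_self _ _)).max
      (ih fun i hi => hf i (Finset.mem_cons.2 (Or.inr hi)))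

theorem PLAt.pi {ι : Type*} [Fintype ι] {f : E → ι → ℝ} {S : Set E} {x : E} (hS : PolyAt S x)
    (hf : ∀ i, PLAt (fun y => f y i) S x) : PLAt f S x := by
  classical
  refine (PLAt.sum (f := fun i y => f y i • (Pi.single i (1 : ℝ) : ι → ℝ)) hS Finset.univ
    fun i _ => (hf i).smul_const _).congr (Filter.Eventually.of_forall fun y => ?_)
  ext j
  simp [Finset.sum_apply, Pi.single_apply]

/-- A continuous local inverse of a piecewise linear map is piecewise linear. -/
theorem PLAt.inverse {f : E → F} {g : F → E} {S : Set E} {T : Set F} {x : E} (hf : PLAt f S x)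
    (hg : ContinuousWithinAt g T (f x)) (hgx : g (f x) = x)
    (hgf : ∀ᶠ y in 𝓝[S] x, f y ∈ T ∧ g (f y) = y)
    (hfg : ∀ᶠ z in 𝓝[T] (f x), g z ∈ S ∧ f (g z) = z) : PLAt g T (f x) := by
  classical
  obtain ⟨𝒞, hfin, h𝒞, hx⟩ := hf.exists_subset hgf
  refine ⟨(fun P => f '' P) '' 𝒞, hfin.image _, ?_, ?_⟩
  · rintro _ ⟨P, hP, rfl⟩
    obtain ⟨h1, h2, A, hA⟩ := h𝒞 P hP
    have himg : f '' P = A '' P := Set.image_congr hA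
    refine ⟨by simpa only [himg] using h1.image A, ?_, ?_⟩
    · rintro _ ⟨y, hy, rfl⟩
      exact (h2 hy).2.1
    -- The affine map `A` is injective on `P` but perhaps not on `E`, so it cannot simply be
    -- inverted. Instead `g` is shown to preserve convex combinations of the images of the vertices
    -- of `P`.
    · obtain ⟨t, rfl⟩ := h1
      obtain ⟨u, hu⟩ : ∃ u : Finset F, (u : Set F) = A '' (t : Set E) :=
        ⟨t.image A, by simp⟩
      have hut : f '' convexHull ℝ (t : Set E) = convexHull ℝ (u : Set F) := by
        rw [himg, AffineMap.image_convexHull, hu]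
      simp only [hut]
      refine exists_affineMap_of_convexCombination u g fun w hw0 hw1 => ?_
      have hgu : ∀ z ∈ u, g z ∈ convexHull ℝ (t : Set E) ∧ A (g z) = z := by
        intro z hz
        have : z ∈ A '' (t : Set E) := hu ▸ Finset.mem_coe.2 hz
        obtain ⟨y, hy, rfl⟩ := this
        have hy' := subset_convexHull ℝ _ hy
        rw [← hA hy', (h2 hy').2.2, hA hy']
        exact ⟨hy', rfl⟩
      have hmem : ∑ z ∈ u, w z • g z ∈ convexHull ℝ (t : Set E) :=
        (convex_convexHull ℝ _).sum_mem hw0 hw1 fun z hz => (hgu z hz).1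
      have h3 := (h2 hmem).2.2
      have h4 : A (∑ z ∈ u, w z • g z) = ∑ z ∈ u, w z • z := by
        have h := u.map_affineCombination g w hw1 A
        rw [Finset.affineCombination_eq_linear_combination _ _ _ hw1,
          Finset.affineCombination_eq_linear_combination _ _ _ hw1] at h
        rw [h]
        exact Finset.sum_congr rfl fun z hz => by rw [Function.comp_apply, (hgu z hz).2]
      rw [hA hmem, h4] at h3
      exact h3
  · have ht : Filter.Tendsto g (𝓝[T] (f x)) (𝓝[S] x) := by
      refine tendsto_nhdsWithin_of_tendsto_nhds_of_eventually_within _ ?_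
        (hfg.mono fun z hz => hz.1)
      have := hg.tendsto
      rwa [hgx] at this
    filter_upwards [ht hx, hfg]
    rintro z ⟨P, hP, hz⟩ hz'
    exact ⟨f '' P, ⟨P, hP, rfl⟩, g z, hz, hz'.2⟩

/-- An injective piecewise linear map on a compact polyhedron is a PL homeomorphism onto its
image. -/
theorem isPLHomeoOn_of_injOn [Nonempty E] {f : E → F} {S : Set E} (hf : IsPLOn f S)
    (hS : IsCompact S) (hinj : Set.InjOn f S) : IsPLHomeoOn f S (f '' S) := by
  classical
  have hl : Set.LeftInvOn (Function.invFunOn f S) f S := hinj.leftInvOn_invFunOn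
  have hr : Set.RightInvOn (Function.invFunOn f S) f (f '' S) := fun y hy =>
    Function.invFunOn_eq hy
  have hm : Set.MapsTo (Function.invFunOn f S) (f '' S) S := fun y hy =>
    Function.invFunOn_mem hy
  -- By compactness `f` maps relatively closed sets to closed sets, so its inverse is continuous.
  have hc : ContinuousOn (Function.invFunOn f S) (f '' S) := by
    rw [continuousOn_iff_isClosed]
    intro C hC
    refine ⟨f '' (S ∩ C), ((hS.inter_right hC).image_of_continuousOn
      (hf.continuousOn.mono Set.inter_subset_left)).isClosed, ?_⟩
    ext y
    constructor
    · rintro ⟨hy, hyS⟩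
      exact ⟨⟨_, ⟨hm hyS, hy⟩, hr hyS⟩, hyS⟩
    · rintro ⟨⟨x, hx, rfl⟩, hyS⟩
      refine ⟨?_, hyS⟩
      rw [Set.mem_preimage, hl hx.1]
      exact hx.2
  refine ⟨Function.invFunOn f S, hf, isPLOn_iff.2 ?_, Set.mapsTo_image f S, hm, hl, hr⟩
  rintro _ ⟨x, hx, rfl⟩
  refine (isPLOn_iff.1 hf x hx).inverse (hc _ ⟨x, hx, rfl⟩) (hl hx)
    (Filter.mem_of_superset self_mem_nhdsWithin fun y hy => ⟨⟨y, hy, rfl⟩, hl hy⟩)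
    (Filter.mem_of_superset self_mem_nhdsWithin fun y hy => ⟨hm hy, hr hy⟩)

end Germ

/-! ### Germs of piecewise linear homeomorphisms. -/

section LocalHomeo

set_option linter.unusedSectionVars false

variable {E F H : Type*} [NormedAddCommGroup E] [NormedSpace ℝ E] [FiniteDimensional ℝ E]
  [NormedAddCommGroup F] [NormedSpace ℝ F] [FiniteDimensional ℝ F]
  [NormedAddCommGroup H] [NormedSpace ℝ H] [FiniteDimensional ℝ H]

theorem isPLOn_congr {f g : E → F} {S : Set E} (hf : IsPLOn f S) (h : Set.EqOn g f S) :
    IsPLOn g S := isPLOn_iff.2 fun x hx => (isPLOn_iff.1 hf x hx).congr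
  (Filter.mem_of_superset self_mem_nhdsWithin h)

/-- Closedness makes each germ piecewise linear at every point of the space, including those outside
the piece, so the two germs can be united at any point of the union. -/
theorem isPLOn_union {f : E → F} {S T : Set E} (hS : IsPLOn f S) (hT : IsPLOn f T)
    (hSc : IsClosed S) (hTc : IsClosed T) : IsPLOn f (S ∪ T) := by
  have key : ∀ {U : Set E}, IsPLOn f U → IsClosed U → ∀ x, PLAt f U x := by
    intro U hU hUc x
    by_cases hx : x ∈ U
    · exact isPLOn_iff.1 hU x hx
    · exact PLAt.of_bot (by
        rwa [← Filter.not_neBot, ← mem_closure_iff_nhdsWithin_neBot, hUc.closure_eq])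
  exact isPLOn_iff.2 fun x _ => (key hS hSc x).union (key hT hTc x)

theorem IsPLHomeoOn.injOn {f : E → F} {S : Set E} {T : Set F} (h : IsPLHomeoOn f S T) :
    Set.InjOn f S := by
  obtain ⟨g, -, -, -, -, hl, -⟩ := h
  exact hl.injOn

theorem IsPLHomeoOn.image_mem_nhdsWithin {f : E → F} {S : Set E} {T : Set F}
    (h : IsPLHomeoOn f S T) {x : E} (hx : x ∈ S) {N : Set E} (hN : N ∈ 𝓝[S] x) :
    f '' (S ∩ N) ∈ 𝓝[T] (f x) := by
  obtain ⟨g, hf, hg, hfm, hgm, hl, hr⟩ := h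
  have hc : Filter.Tendsto g (𝓝[T] (f x)) (𝓝[S] x) := by
    have := (hg.continuousOn (f x) (hfm hx)).tendsto_nhdsWithin hgm
    rwa [hl hx] at this
  filter_upwards [hc hN, self_mem_nhdsWithin] with y hy hyT
  exact ⟨g y, ⟨hgm hyT, hy⟩, hr hyT⟩

/-- `f` and `g` restrict to mutually inverse germs of PL homeomorphisms between `S` at `x` and
`T` at `f x`. -/
structure GermHomeo (f : E → F) (g : F → E) (S : Set E) (T : Set F) (x : E) : Prop where
  mem : x ∈ S
  map_mem : f x ∈ T
  plAt : PLAt f S x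
  plAt_inv : PLAt g T (f x)
  left_inv : ∀ᶠ y in 𝓝[S] x, f y ∈ T ∧ g (f y) = y
  right_inv : ∀ᶠ z in 𝓝[T] (f x), g z ∈ S ∧ f (g z) = z

namespace GermHomeo

variable {f : E → F} {g : F → E} {S : Set E} {T : Set F} {x : E}

theorem apply_inv (h : GermHomeo f g S T x) : g (f x) = x :=
  (h.left_inv.self_of_nhdsWithin h.mem).2

theorem symm (h : GermHomeo f g S T x) : GermHomeo g f T S (f x) where
  mem := h.map_mem
  map_mem := h.apply_inv.symm ▸ h.mem
  plAt := h.plAt_inv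
  plAt_inv := h.apply_inv.symm ▸ h.plAt
  left_inv := h.right_inv
  right_inv := h.apply_inv.symm ▸ h.left_inv

theorem tendsto (h : GermHomeo f g S T x) : Filter.Tendsto f (𝓝[S] x) (𝓝[T] (f x)) :=
  tendsto_nhdsWithin_of_tendsto_nhds_of_eventually_within _ h.plAt.continuousWithinAt
    (h.left_inv.mono fun _ hy => hy.1)

theorem tendsto_inv (h : GermHomeo f g S T x) : Filter.Tendsto g (𝓝[T] (f x)) (𝓝[S] x) := by
  have := h.symm.tendsto
  rwa [h.apply_inv] at this

theorem trans {f' : F → H} {g' : H → F} {U : Set H} (h : GermHomeo f g S T x)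
    (h' : GermHomeo f' g' T U (f x)) :
    GermHomeo (fun y => f' (f y)) (fun z => g (g' z)) S U x where
  mem := h.mem
  map_mem := h'.map_mem
  plAt := h'.plAt.comp h.plAt (h.left_inv.mono fun _ hy => hy.1)
  plAt_inv := by
    have h1 := h.plAt_inv
    rw [← h'.apply_inv] at h1
    exact h1.comp h'.plAt_inv (h'.right_inv.mono fun _ hy => hy.1)
  left_inv := by
    filter_upwards [h.left_inv, h.tendsto.eventually h'.left_inv] with y hy hy'
    exact ⟨hy'.1, by rw [hy'.2, hy.2]⟩
  right_inv := by
    filter_upwards [h'.right_inv, h'.tendsto_inv.eventually h.right_inv] with z hz hz'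
    exact ⟨hz'.1, by rw [hz'.2, hz.2]⟩

/-- Passes from germs to actual mutually inverse maps. Shrinking `O₁` to the points sent into `O₂`,
and vice versa, suffices: because the maps are inverse to each other there, each shrunken set is
carried into the other. -/
theorem exists_isOpen (h : GermHomeo f g S T x) {N : Set E} (hN : N ∈ 𝓝[S] x) {N' : Set F}
    (hN' : N' ∈ 𝓝[T] (f x)) : ∃ O O', IsOpen O ∧ IsOpen O' ∧ x ∈ O ∧ f x ∈ O' ∧ S ∩ O ⊆ N ∧
      T ∩ O' ⊆ N' ∧ IsPLOn f (S ∩ O) ∧ IsPLOn g (T ∩ O') ∧ Set.MapsTo f (S ∩ O) (T ∩ O') ∧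
      Set.MapsTo g (T ∩ O') (S ∩ O) ∧ Set.InvOn g f (S ∩ O) (T ∩ O') := by
  have h1 := hN
  have h2 := hN'
  obtain ⟨O₁, hO₁, hxO₁, h1⟩ := mem_nhdsWithin.1
    ((h.plAt.isPLOn_inter.and h.left_inv).and (Filter.eventually_mem_set.2 hN))
  obtain ⟨O₂, hO₂, hxO₂, h2⟩ := mem_nhdsWithin.1
    ((h.plAt_inv.isPLOn_inter.and h.right_inv).and (Filter.eventually_mem_set.2 hN'))
  have hs : ∀ {y}, y ∈ S ∩ O₁ → PLAt f (S ∩ O₁) y := fun {y} hy =>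
    (h1 ⟨hy.2, hy.1⟩).1.1.inter_open (mem_nhdsWithin_of_mem_nhds (hO₁.mem_nhds hy.2))
  have ht : ∀ {z}, z ∈ T ∩ O₂ → PLAt g (T ∩ O₂) z := fun {z} hz =>
    (h2 ⟨hz.2, hz.1⟩).1.1.inter_open (mem_nhdsWithin_of_mem_nhds (hO₂.mem_nhds hz.2))
  have hfc : ContinuousOn f (S ∩ O₁) := fun y hy => (hs hy).continuousWithinAt
  have hgc : ContinuousOn g (T ∩ O₂) := fun y hy => (ht hy).continuousWithinAt
  obtain ⟨U₁, hU₁, hf⟩ := continuousOn_iff'.1 hfc O₂ hO₂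
  obtain ⟨U₂, hU₂, hg⟩ := continuousOn_iff'.1 hgc O₁ hO₁
  have hf' : ∀ y ∈ S ∩ O₁, f y ∈ O₂ ↔ y ∈ U₁ := fun y hy => by
    have := Set.ext_iff.1 hf y
    simp only [Set.mem_inter_iff, Set.mem_preimage] at this
    exact ⟨fun h => (this.1 ⟨h, hy⟩).1, fun h => (this.2 ⟨h, hy⟩).1⟩
  have hg' : ∀ y ∈ T ∩ O₂, g y ∈ O₁ ↔ y ∈ U₂ := fun y hy => by
    have := Set.ext_iff.1 hg y
    simp only [Set.mem_inter_iff, Set.mem_preimage] at this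
    exact ⟨fun h => (this.1 ⟨h, hy⟩).1, fun h => (this.2 ⟨h, hy⟩).1⟩
  refine ⟨O₁ ∩ U₁, O₂ ∩ U₂, hO₁.inter hU₁, hO₂.inter hU₂,
    ⟨hxO₁, (hf' x ⟨h.mem, hxO₁⟩).1 hxO₂⟩,
    ⟨hxO₂, (hg' _ ⟨h.map_mem, hxO₂⟩).1 (by rw [h.apply_inv]; exact hxO₁)⟩,
    fun y hy => (h1 ⟨hy.2.1, hy.1⟩).2, fun y hy => (h2 ⟨hy.2.1, hy.1⟩).2, ?_, ?_, ?_, ?_, ?_, ?_⟩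
  · refine isPLOn_iff.2 fun y hy => ?_
    rw [← Set.inter_assoc]
    exact (hs ⟨hy.1, hy.2.1⟩).inter_open (mem_nhdsWithin_of_mem_nhds (hU₁.mem_nhds hy.2.2))
  · refine isPLOn_iff.2 fun y hy => ?_
    rw [← Set.inter_assoc]
    exact (ht ⟨hy.1, hy.2.1⟩).inter_open (mem_nhdsWithin_of_mem_nhds (hU₂.mem_nhds hy.2.2))
  · intro y hy
    have h3 := (h1 ⟨hy.2.1, hy.1⟩).1.2
    have h4 : f y ∈ O₂ := (hf' y ⟨hy.1, hy.2.1⟩).2 hy.2.2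
    exact ⟨h3.1, h4, (hg' _ ⟨h3.1, h4⟩).1 (by rw [h3.2]; exact hy.2.1)⟩
  · intro y hy
    have h3 := (h2 ⟨hy.2.1, hy.1⟩).1.2
    have h4 : g y ∈ O₁ := (hg' y ⟨hy.1, hy.2.1⟩).2 hy.2.2
    exact ⟨h3.1, h4, (hf' _ ⟨h3.1, h4⟩).1 (by rw [h3.2]; exact hy.2.1)⟩
  · exact fun y hy => (h1 ⟨hy.2.1, hy.1⟩).1.2.2
  · exact fun y hy => (h2 ⟨hy.2.1, hy.1⟩).1.2.2

end GermHomeo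

end LocalHomeo

/-! ### Piecewise linear bump functions. -/

section Bump

variable {E : Type*} [NormedAddCommGroup E] [NormedSpace ℝ E] [FiniteDimensional ℝ E]

/-- Piecewise linear bump functions. -/
theorem exists_plBump {S O : Set E} (hS : IsCompact S) (hO : IsOpen O) (hSO : S ⊆ O) :
    ∃ g : E → ℝ, (∀ x, PLAt g Set.univ x) ∧ (∀ x, 0 ≤ g x) ∧ (∀ x, g x ≤ 1) ∧
      (∀ x ∈ S, ∀ᶠ y in 𝓝 x, g y = 1) ∧ ∃ K, IsCompact K ∧ K ⊆ O ∧ ∀ y ∉ K, g y = 0 := by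
  refine hS.induction_on (p := fun S => ∃ g : E → ℝ, (∀ x, PLAt g Set.univ x) ∧ (∀ x, 0 ≤ g x) ∧
      (∀ x, g x ≤ 1) ∧ (∀ x ∈ S, ∀ᶠ y in 𝓝 x, g y = 1) ∧
      ∃ K, IsCompact K ∧ K ⊆ O ∧ ∀ y ∉ K, g y = 0) ?_ ?_ ?_ ?_
  · exact ⟨fun _ => 0, fun x => PLAt.const 0 (PolyAt.univ x), fun _ => le_rfl,
      fun _ => zero_le_one, by simp, ∅, isCompact_empty, Set.empty_subset _, fun _ _ => rfl⟩
  · rintro S T hST ⟨g, h1, h2, h3, h4, h5⟩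
    exact ⟨g, h1, h2, h3, fun x hx => h4 x (hST hx), h5⟩
  · rintro S T ⟨g, h1, h2, h3, h4, K, hK, hKO, h5⟩ ⟨g', h1', h2', h3', h4', K', hK', hKO', h5'⟩
    refine ⟨fun x => max (g x) (g' x), fun x => (h1 x).max (h1' x),
      fun x => (h2 x).trans (le_max_left _ _), fun x => max_le (h3 x) (h3' x), ?_, K ∪ K',
      hK.union hK', Set.union_subset hKO hKO', fun y hy => ?_⟩
    · rintro x (hx | hx)
      · filter_upwards [h4 x hx] with y hy
        rw [hy, max_eq_left (h3' y)]
      · filter_upwards [h4' x hx] with y hy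
        rw [hy, max_eq_right (h3 y)]
    · rw [Set.mem_union, not_or] at hy
      simp only [h5 y hy.1, h5' y hy.2, max_self]
  · intro x hx
    obtain ⟨r, hr, hrO⟩ := Metric.nhds_basis_closedBall.mem_iff.1 (hO.mem_nhds (hSO hx))
    let b := Module.finBasis ℝ E
    -- The given norm need not be piecewise linear; the sum of absolute coordinates in a basis is,
    -- and it controls the norm up to the constant `c`.
    let e := b.equivFunL
    set N : E → ℝ := fun y => ∑ i, |e (y - x) i| with hN
    have hNpl : ∀ y, PLAt N Set.univ y := fun y => by
      refine PLAt.sum (PolyAt.univ y) _ fun i _ => ?_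
      have h1 : PLAt (fun y => e (y - x) i) Set.univ y :=
        PLAt.linear_comp ((LinearMap.proj i).comp e.toLinearEquiv.toLinearMap)
          (PLAt.sub (PolyAt.univ y) (PLAt.const x (PolyAt.univ y)))
      exact h1.max h1.neg
    have hNc : Continuous N := continuous_iff_continuousAt.2 fun y => by
      have := (hNpl y).continuousWithinAt
      rwa [continuousWithinAt_univ] at this
    have hNx : N x = 0 := by simp [hN]
    set c : ℝ := ‖(e.symm : (Fin (Module.finrank ℝ E) → ℝ) →L[ℝ] E)‖ + 1 with hc
    have hc0 : 0 < c := by positivity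
    have hle : ∀ y, ‖y - x‖ ≤ c * N y := by
      intro y
      have h1 : ‖y - x‖ ≤ (c - 1) * ‖e (y - x)‖ := by
        have := (e.symm : (Fin (Module.finrank ℝ E) → ℝ) →L[ℝ] E).le_opNorm (e (y - x))
        simpa [hc] using this
      have hn0 : 0 ≤ N y := Finset.sum_nonneg fun _ _ => abs_nonneg _
      have h2 : ‖e (y - x)‖ ≤ N y := by
        refine (pi_norm_le_iff_of_nonneg hn0).2 fun i => ?_
        exact Finset.single_le_sum (f := fun i => |e (y - x) i|) (fun _ _ => abs_nonneg _)
          (Finset.mem_univ i)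
      have h3 : 0 ≤ c - 1 := by simp [hc]
      nlinarith [mul_le_mul_of_nonneg_left h2 h3]
    -- The bump is `1` where `N < ρ` and `0` where `N ≥ 2ρ`. With this `ρ`, a point outside the
    -- closed ball of radius `r` has `N > r / c = 2ρ`.
    set ρ : ℝ := r / (2 * c) with hρ
    have hρ0 : 0 < ρ := by positivity
    refine ⟨{y | N y < ρ}, mem_nhdsWithin_of_mem_nhds
      ((isOpen_lt hNc continuous_const).mem_nhds (by simpa [hNx] using hρ0)),
      fun y => max 0 (min 1 (2 - ρ⁻¹ • N y)), fun y => ?_, fun y => le_max_left _ _,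
      fun y => max_le zero_le_one (min_le_left _ _), fun y hy => ?_,
      Metric.closedBall x r, isCompact_closedBall x r, hrO, fun y hy => ?_⟩
    · exact (PLAt.const _ (PolyAt.univ y)).max ((PLAt.const _ (PolyAt.univ y)).min
        ((PLAt.const _ (PolyAt.univ y)).sub ((hNpl y).const_smul _)))
    · filter_upwards [(isOpen_lt hNc continuous_const).mem_nhds hy] with z hz
      have : ρ⁻¹ * N z ≤ 1 := by
        rw [inv_mul_le_iff₀ hρ0, mul_one]
        exact le_of_lt hz
      rw [smul_eq_mul, min_eq_left (by linarith), max_eq_right zero_le_one]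
    · rw [mem_closedBall_iff_norm, not_le] at hy
      have h1 := hy.trans_le (hle y)
      have h2 : 2 ≤ ρ⁻¹ * N y := by
        rw [hρ, inv_div, div_mul_eq_mul_div, le_div_iff₀ hr]
        nlinarith
      simp only [smul_eq_mul]
      exact max_eq_left ((min_le_right _ _).trans (by linarith))

end Bump

/-! ### Collars of a locally collared boundary. -/

section Collar

set_option linter.unusedSectionVars false

variable {E : Type*} [NormedAddCommGroup E] [NormedSpace ℝ E] [FiniteDimensional ℝ E]

/-- `κ` is a collar in `M` over the compact part `C` of the boundary `B`. -/
structure IsCollar (M B : Set E) (κ : E × ℝ → E) (C : Set E) (ε : ℝ) : Prop where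
  pos : 0 < ε
  subset : C ⊆ B
  isCompact : IsCompact C
  poly : ∀ z, PolyAt C z
  isPLOn : IsPLOn κ (C ×ˢ Set.Icc 0 ε)
  injOn : Set.InjOn κ (C ×ˢ Set.Icc 0 ε)
  mapsTo : Set.MapsTo κ (C ×ˢ Set.Icc 0 ε) M
  zero : ∀ z ∈ C, κ (z, 0) = z
  eq_zero : ∀ z ∈ C, ∀ t ∈ Set.Icc 0 ε, κ (z, t) ∈ B → t = 0

/-- The boundary `B` of `M` has a collar near the points of `S`. -/
def CollaredNear (M B S : Set E) : Prop := ∃ (C : Set E) (κ : E × ℝ → E) (ε : ℝ),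
  IsCollar M B κ C ε ∧ ∀ z ∈ S, C ∈ 𝓝[B] z ∧ κ '' (C ×ˢ Set.Icc 0 ε) ∈ 𝓝[M] z

theorem polyAt_of_isCompact {C : Set E} (hC : IsCompact C) (h : ∀ x ∈ C, PolyAt C x) (x : E) :
    PolyAt C x := by
  by_cases hx : x ∈ C
  · exact h x hx
  · exact PLAt.of_bot (by
      rwa [← Filter.not_neBot, ← mem_closure_iff_nhdsWithin_neBot, hC.isClosed.closure_eq])

theorem IsCollar.isPLHomeoOn {M B C : Set E} {κ : E × ℝ → E} {ε : ℝ} (h : IsCollar M B κ C ε) :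
    IsPLHomeoOn κ (C ×ˢ Set.Icc 0 ε) (κ '' (C ×ˢ Set.Icc 0 ε)) :=
  isPLHomeoOn_of_injOn h.isPLOn (h.isCompact.prod isCompact_Icc) h.injOn

/-- A collar is a homeomorphism onto its image, so once the whole image is a neighbourhood of `z`,
small parts of the collar around `(z, 0)` have the same property. -/
theorem IsCollar.image_mem {M B C : Set E} {κ : E × ℝ → E} {ε : ℝ} (h : IsCollar M B κ C ε) {z : E}
    (hz : z ∈ C) (hM : κ '' (C ×ˢ Set.Icc 0 ε) ∈ 𝓝[M] z) {N : Set (E × ℝ)}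
    (hN : N ∈ 𝓝[C ×ˢ Set.Icc 0 ε] (z, 0)) : κ '' (C ×ˢ Set.Icc 0 ε ∩ N) ∈ 𝓝[M] z := by
  have h1 := h.isPLHomeoOn.image_mem_nhdsWithin (x := (z, 0)) ⟨hz, le_rfl, h.pos.le⟩ hN
  rw [h.zero z hz] at h1
  exact nhdsWithin_le_of_mem hM h1

/-- Exhibits the condition as open in `z`, also at points `z` outside `B`. -/
theorem mem_nhdsWithin_iff_mem_interior {B C : Set E} {z : E} :
    C ∈ 𝓝[B] z ↔ z ∈ interior (C ∪ Bᶜ) := by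
  rw [mem_interior_iff_mem_nhds, mem_nhdsWithin_iff_eventually, ← Filter.eventually_mem_set]
  refine Filter.eventually_congr (Filter.Eventually.of_forall fun x => ?_)
  simp only [Set.mem_union, Set.mem_compl_iff]
  tauto

/-- The part of the boundary over which a collar is a neighbourhood is relatively open. -/
theorem exists_isOpen_of_collar {M B S C : Set E} {T : Set E}
    (h : ∀ z ∈ S, C ∈ 𝓝[B] z ∧ T ∈ 𝓝[M] z) :
    ∃ O, IsOpen O ∧ S ⊆ O ∧ ∀ z ∈ O, C ∈ 𝓝[B] z ∧ T ∈ 𝓝[M] z := by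
  refine ⟨interior (C ∪ Bᶜ) ∩ interior (T ∪ Mᶜ), isOpen_interior.inter isOpen_interior,
    fun z hz => ?_, fun z hz => ?_⟩
  · simpa only [Set.mem_inter_iff, ← mem_nhdsWithin_iff_mem_interior] using h z hz
  · simpa only [Set.mem_inter_iff, ← mem_nhdsWithin_iff_mem_interior] using hz

/-- The tube lemma, for maps that are continuous only on a product set. It keeps thin collars over
compact bases inside prescribed open sets. -/
theorem eventually_forall_mem_of_isCompact {X Y Z : Type*} [TopologicalSpace X]
    [TopologicalSpace Y] [TopologicalSpace Z] {K : Set X} (hK : IsCompact K) {Q : Set Y} {y : Y}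
    (hy : y ∈ Q) {h : X × Y → Z} (hc : ContinuousOn h (K ×ˢ Q)) {O : Set Z} (hO : IsOpen O)
    (hm : ∀ x ∈ K, h (x, y) ∈ O) : ∀ᶠ t in 𝓝 y, ∀ x ∈ K, t ∈ Q → h (x, t) ∈ O := by
  have key : ∀ᶠ t in 𝓝 y, ∀ x ∈ K, (x ∈ K → t ∈ Q → h (x, t) ∈ O) := by
    refine hK.eventually_forall_of_forall_eventually (P := fun t x => x ∈ K → t ∈ Q →
      h (x, t) ∈ O) fun x hx => ?_
    have h1 := hc (x, y) ⟨hx, hy⟩ (hO.mem_nhds (hm x hx))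
    rw [Filter.mem_map, mem_nhdsWithin_iff_eventually] at h1
    have h2 : Filter.Tendsto Prod.swap (𝓝 (y, x)) (𝓝 (x, y)) := continuous_swap.tendsto (y, x)
    filter_upwards [h2.eventually h1] with p hp h3 h4
    exact hp ⟨h3, h4⟩
  exact key.mono fun t ht x hx => ht x hx hx

theorem PLAt.restrict_open {F : Type*} [NormedAddCommGroup F] [NormedSpace ℝ F] {f : E → F}
    {S : Set E} {x : E} (h : PLAt f Set.univ x) (hS : PolyAt S x) : PLAt f S x :=
  h.mono hS (by simp)

/-- Push a collar inwards by the height `γ` over its base. -/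
theorem exists_push {M B : Set E} (hM : IsPLOn (fun x => x) M) {C : Set E}
    {κ : E × ℝ → E} {ε : ℝ} (h : IsCollar M B κ C ε) {O : Set E} (hO : IsOpen O)
    (hOC : ∀ z ∈ O, C ∈ 𝓝[B] z ∧ κ '' (C ×ˢ Set.Icc 0 ε) ∈ 𝓝[M] z) {g : E → ℝ}
    (hg : ∀ x, PLAt g Set.univ x) (hg1 : ∀ x, g x ≤ 1) {K : Set E}
    (hK : IsCompact K) (hKO : K ⊆ O) (hgK : ∀ y ∉ K, g y = 0) {ε' : ℝ} (hε' : 0 < ε') :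
    ∃ (δ : ℝ) (Θ : E → E), 0 < δ ∧ 2 * δ ≤ ε ∧ δ ≤ ε' ∧ IsPLOn Θ M ∧ Set.MapsTo Θ M M ∧
      Set.InjOn Θ M ∧
      (∀ z ∈ C, ∀ t ∈ Set.Icc 0 ε, Θ (κ (z, t)) = κ (z, max t (δ * g z + t / 2))) ∧
      ∀ x ∉ κ '' (C ×ˢ Set.Icc 0 ε), Θ x = x := by
  classical
  obtain ⟨ι, -, hιpl, -, hιm, hl, hr⟩ := h.isPLHomeoOn
  set T := κ '' (C ×ˢ Set.Icc 0 ε) with hT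
  have hTM : T ⊆ M := h.mapsTo.image_subset
  -- the amount of pushing
  have hcont : ContinuousOn κ ((K ∩ C) ×ˢ Set.Icc 0 ε) :=
    h.isPLOn.continuousOn.mono (Set.prod_mono Set.inter_subset_right subset_rfl)
  have hev := eventually_forall_mem_of_isCompact (hK.inter h.isCompact)
    (Set.left_mem_Icc.2 h.pos.le) hcont hO fun x hx => by
      rw [h.zero x hx.2]; exact hKO hx.1
  obtain ⟨ρ, hρ, hρ'⟩ := Metric.eventually_nhds_iff.1 hev
  -- Points are moved only below height `2δ`. This strip over `K` must stay in `O`, where the collar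
  -- image is a neighbourhood in `M`, and must fit into the collar.
  obtain ⟨δ, hδ, hδ1, hδ2, hδ3⟩ : ∃ δ : ℝ, 0 < δ ∧ 2 * δ < ρ ∧ 2 * δ ≤ ε ∧ δ ≤ ε' := by
    refine ⟨min (ρ / 4) (min (ε / 2) ε'), by have := h.pos; positivity, ?_, ?_, ?_⟩
    · linarith [min_le_left (ρ / 4) (min (ε / 2) ε')]
    · linarith [min_le_right (ρ / 4) (min (ε / 2) ε'), min_le_left (ε / 2) ε']
    · exact (min_le_right _ _).trans (min_le_right _ _)
  have hin : ∀ z ∈ K ∩ C, ∀ t ∈ Set.Icc 0 (2 * δ), κ (z, t) ∈ O := fun z hz t ht =>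
    hρ' (by rw [Real.dist_0_eq_abs, abs_of_nonneg ht.1]; linarith [ht.2]) z hz
      ⟨ht.1, ht.2.trans hδ2⟩
  -- Strictly increasing in the height: `0` is raised to `δ g`, and heights at least `2 δ g` are
  -- fixed. The image of the push omits the strip below `δ g`, which makes room for another collar.
  set s : E × ℝ → ℝ := fun p => max p.2 (δ * g p.1 + p.2 / 2) with hs
  have hsm : ∀ p ∈ C ×ˢ Set.Icc 0 ε, (p.1, s p) ∈ C ×ˢ Set.Icc (0 : ℝ) ε := by
    rintro ⟨z, t⟩ ⟨hz, ht0, ht1⟩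
    refine ⟨hz, le_max_of_le_left ht0, max_le ht1 ?_⟩
    have := mul_le_mul_of_nonneg_left (hg1 z) hδ.le
    simp only at ht1
    simp only
    linarith
  have hsinj : ∀ z t t', s (z, t) = s (z, t') → t = t' := by
    have : ∀ z, StrictMono fun t => s (z, t) := fun z t t' htt => by
      exact max_lt_max htt (by simp only; linarith)
    exact fun z t t' htt => (this z).injective htt
  have hspl : ∀ p, PLAt s Set.univ p := fun p => by
    have hid := PolyAt.univ p
    have h1 : PLAt (fun p : E × ℝ => g p.1) Set.univ p :=
      PLAt.comp (hg p.1) hid.fst (by simp)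
    exact hid.snd.max ((h1.const_smul δ).add ((hid.snd.const_smul (1 / 2)).congr
      (Filter.Eventually.of_forall fun y => by simp only [smul_eq_mul]; ring)))
  set Θ : E → E := fun x => if x ∈ T then κ ((ι x).1, s (ι x)) else x with hΘ
  have hΘκ : ∀ p ∈ C ×ˢ Set.Icc 0 ε, Θ (κ p) = κ (p.1, s p) := fun p hp => by
    simp only [hΘ]
    rw [if_pos ⟨p, hp, rfl⟩, hl hp]
  have hΘT : ∀ x ∉ T, Θ x = x := fun x hx => if_neg hx
  refine ⟨δ, Θ, hδ, hδ2, hδ3, isPLOn_iff.2 fun x hx => ?_, fun x hx => ?_, fun x hx y hy hxy => ?_,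
    fun z hz t ht => hΘκ (z, t) ⟨hz, ht⟩, hΘT⟩
  -- Near the compact set `Q` the formula in collar coordinates is valid on a neighbourhood in `M`.
  -- Away from `Q` the push is locally the identity.
  · set Q := κ '' ((K ∩ C) ×ˢ Set.Icc 0 (2 * δ)) with hQ
    have hQc : IsCompact Q := ((hK.inter h.isCompact).prod isCompact_Icc).image_of_continuousOn
      (hcont.mono (Set.prod_mono subset_rfl (Set.Icc_subset_Icc_right hδ2)))
    by_cases hxQ : x ∈ Q
    · obtain ⟨⟨z, t⟩, hzt, rfl⟩ := hxQ
      have hnT := (hOC _ (hin z hzt.1 t hzt.2)).2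
      have hzt' : (z, t) ∈ C ×ˢ Set.Icc 0 ε := ⟨hzt.1.2, hzt.2.1, hzt.2.2.trans hδ2⟩
      have hxT : κ (z, t) ∈ T := ⟨_, hzt', rfl⟩
      have hι := isPLOn_iff.1 hιpl _ hxT
      have h1 : PLAt (fun x => κ ((ι x).1, s (ι x))) T (κ (z, t)) := by
        refine PLAt.comp (f := fun x => ((ι x).1, s (ι x))) (isPLOn_iff.1 h.isPLOn _ ?_)
          (hι.fst.prodMk (PLAt.comp (hspl _) hι (by simp))) ?_
        · exact hsm _ (hιm hxT)
        · filter_upwards [self_mem_nhdsWithin] with y hy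
          exact hsm _ (hιm hy)
      refine PLAt.congr_set (S := T) (h1.congr ?_) ?_
      · filter_upwards [self_mem_nhdsWithin] with y hy
        exact if_pos hy
      · exact le_antisymm (nhdsWithin_mono _ hTM) (nhdsWithin_le_of_mem hnT)
    · refine (isPLOn_iff.1 hM x hx).congr ?_
      filter_upwards [mem_nhdsWithin_of_mem_nhds (hQc.isClosed.isOpen_compl.mem_nhds hxQ)]
        with y hy
      by_cases hyT : y ∈ T
      · obtain ⟨⟨z, t⟩, hzt, rfl⟩ := hyT
        rw [hΘκ _ hzt]
        congr 2
        refine max_eq_left ?_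
        simp only
        by_cases hzK : z ∈ K
        · have ht : 2 * δ < t := by
            by_contra hcon
            exact hy ⟨(z, t), ⟨⟨hzK, hzt.1⟩, hzt.2.1, not_lt.1 hcon⟩, rfl⟩
          have := mul_le_mul_of_nonneg_left (hg1 z) hδ.le
          linarith
        · rw [hgK z hzK]
          have : 0 ≤ t := hzt.2.1
          linarith
      · exact hΘT y hyT
  · by_cases hxT : x ∈ T
    · obtain ⟨p, hp, rfl⟩ := hxT
      rw [hΘκ p hp]
      exact h.mapsTo (hsm p hp)
    · rwa [hΘT x hxT]
  · by_cases hxT : x ∈ T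
    · obtain ⟨p, hp, rfl⟩ := hxT
      by_cases hyT : y ∈ T
      · obtain ⟨q, hq, rfl⟩ := hyT
        rw [hΘκ p hp, hΘκ q hq] at hxy
        have := h.injOn (hsm p hp) (hsm q hq) hxy
        rw [Prod.mk.injEq] at this
        obtain ⟨z, t⟩ := p
        obtain ⟨z', t'⟩ := q
        simp only at this
        obtain ⟨rfl, h2⟩ := this
        rw [hsinj z t t' h2]
      · rw [hΘκ p hp, hΘT y hyT] at hxy
        exact (hyT (hxy ▸ ⟨_, hsm p hp, rfl⟩)).elim
    · by_cases hyT : y ∈ T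
      · obtain ⟨q, hq, rfl⟩ := hyT
        rw [hΘκ q hq, hΘT x hxT] at hxy
        exact (hxT (hxy ▸ ⟨_, hsm q hq, rfl⟩)).elim
      · rwa [hΘT x hxT, hΘT y hyT] at hxy

/-- Two collars can be merged. -/
theorem CollaredNear.union {M B : Set E} (hM : IsPLOn (fun x => x) M)
    {S₁ S₂ : Set E} (h₁ : CollaredNear M B S₁) (h₂ : CollaredNear M B S₂) (hS₁ : IsCompact S₁)
    (hS₁B : S₁ ⊆ B) (hS₂B : S₂ ⊆ B) : CollaredNear M B (S₁ ∪ S₂) := by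
  classical
  obtain ⟨C₁, κ₁, ε₁, h₁, hn₁⟩ := h₁
  obtain ⟨C₂, κ₂, ε₂, h₂, hn₂⟩ := h₂
  obtain ⟨O, hO, hSO, hOn⟩ := exists_isOpen_of_collar hn₁
  obtain ⟨g, hg, hg0, hg1, hgS, K, hK, hKO, hgK⟩ := exists_plBump hS₁ hO hSO
  obtain ⟨δ, Θ, hδ, hδε₁, hδε₂, hΘ, hΘM, hΘi, hΘκ, hΘT⟩ :=
    exists_push hM h₁ hO hOn hg hg1 hK hKO hgK h₂.pos
  set T₁ := κ₁ '' (C₁ ×ˢ Set.Icc 0 ε₁) with hT₁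
  set γ : E → ℝ := fun z => δ * g z with hγ
  have hγ0 : ∀ z, 0 ≤ γ z := fun z => mul_nonneg hδ.le (hg0 z)
  have hγ1 : ∀ z, γ z ≤ δ := fun z => mul_le_of_le_one_right hδ.le (hg1 z)
  have hγpl : ∀ z, PLAt γ Set.univ z := fun z => (hg z).const_smul δ
  have hγc : Continuous γ := continuous_iff_continuousAt.2 fun y => by
    have := (hγpl y).continuousWithinAt
    rwa [continuousWithinAt_univ] at this
  have hBC : ∀ z ∈ B, 0 < γ z → z ∈ C₁ := fun z hzB hz => by
    have hzK : z ∈ K := by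
      by_contra hcon
      simp only [hγ, hgK z hcon, mul_zero, lt_irrefl] at hz
    exact mem_of_mem_nhdsWithin hzB (hOn z (hKO hzK)).1
  have hBT : ∀ z ∈ B, z ∈ T₁ → z ∈ C₁ := by
    rintro _ hz ⟨⟨z, t⟩, hzt, rfl⟩
    have := h₁.eq_zero z hzt.1 t hzt.2 hz
    subst this
    rw [h₁.zero z hzt.1]
    exact hzt.1
  have hTC : ∀ z ∈ C₁, z ∈ T₁ := fun z hz => ⟨(z, 0), ⟨hz, le_rfl, h₁.pos.le⟩, h₁.zero z hz⟩
  have hΘκ' : ∀ z ∈ C₁, ∀ t ∈ Set.Icc 0 ε₁, Θ (κ₁ (z, t)) = κ₁ (z, max t (γ z + t / 2)) := hΘκ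
  have hΘz : ∀ z ∈ C₁, Θ z = κ₁ (z, γ z) := fun z hz => by
    have := hΘκ' z hz 0 ⟨le_rfl, h₁.pos.le⟩
    rw [h₁.zero z hz] at this
    rw [this, zero_div, add_zero, max_eq_right (hγ0 z)]
  set C := (C₁ ∩ (fun z => γ z - δ) ⁻¹' Set.Ici 0) ∪ C₂ with hC
  set ψ : E × ℝ → E := fun p => if p.1 ∈ C₁ ∧ p.2 ≤ γ p.1 then κ₁ p
    else Θ (κ₂ (p.1, p.2 - γ p.1)) with hψ
  have hψ₁ : ∀ z ∈ C₁, ∀ t ≤ γ z, ψ (z, t) = κ₁ (z, t) := fun z hz t ht => if_pos ⟨hz, ht⟩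
  have hψ₂ : ∀ z ∈ C₂, ∀ t, γ z ≤ t → ψ (z, t) = Θ (κ₂ (z, t - γ z)) := fun z hz t ht => by
    by_cases hcase : z ∈ C₁ ∧ t ≤ γ z
    · have : t = γ z := le_antisymm hcase.2 ht
      rw [hψ₁ z hcase.1 t hcase.2, this, sub_self, h₂.zero z hz, hΘz z hcase.1]
    · exact if_neg hcase
  have hCB : C ⊆ B := Set.union_subset (Set.inter_subset_left.trans h₁.subset) h₂.subset
  have hcase : ∀ z ∈ C, ∀ t ∈ Set.Icc 0 δ, (z ∈ C₁ ∧ t ≤ γ z) ∨ (z ∈ C₂ ∧ γ z ≤ t) := by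
    rintro z (⟨hz, hzδ⟩ | hz) t ht
    · exact Or.inl ⟨hz, ht.2.trans (sub_nonneg.1 hzδ)⟩
    · rcases le_or_gt (γ z) t with h | h
      · exact Or.inr ⟨hz, h⟩
      · exact Or.inl ⟨hBC z (h₂.subset hz) (ht.1.trans_lt h), h.le⟩
  have hm₁ : ∀ z ∈ C₁, ∀ t ∈ Set.Icc 0 δ, (z, t) ∈ C₁ ×ˢ Set.Icc 0 ε₁ := fun z hz t ht =>
    ⟨hz, ht.1, ht.2.trans (by linarith)⟩
  have hm₂ : ∀ z ∈ C₂, ∀ t ∈ Set.Icc 0 δ, γ z ≤ t → (z, t - γ z) ∈ C₂ ×ˢ Set.Icc 0 ε₂ :=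
    fun z hz t ht h => ⟨hz, sub_nonneg.2 h, by
      have := hγ0 z
      have := ht.2
      simp only
      linarith⟩
  -- a point in both regions lies on the common boundary
  have hmix : ∀ z ∈ C₁, ∀ t ∈ Set.Icc 0 δ, t ≤ γ z → ∀ z' ∈ C₂, ∀ t' ∈ Set.Icc 0 δ, γ z' ≤ t' →
      κ₁ (z, t) = Θ (κ₂ (z', t' - γ z')) → z = z' ∧ t = t' := by
    intro z hz t ht htγ z' hz' t' ht' htγ' heq
    have hxT : κ₂ (z', t' - γ z') ∈ T₁ := by
      by_contra hcon
      rw [hΘT _ hcon] at heq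
      exact hcon (heq ▸ ⟨_, hm₁ z hz t ht, rfl⟩)
    obtain ⟨⟨z₁, t₁⟩, hzt₁, hx⟩ := hxT
    rw [← hx, hΘκ' z₁ hzt₁.1 t₁ hzt₁.2] at heq
    have h3 : (z₁, max t₁ (γ z₁ + t₁ / 2)) ∈ C₁ ×ˢ Set.Icc (0 : ℝ) ε₁ := by
      refine ⟨hzt₁.1, hzt₁.2.1.trans (le_max_left _ _), max_le hzt₁.2.2 ?_⟩
      have h5 := hγ1 z₁
      have : t₁ ≤ ε₁ := hzt₁.2.2
      linarith
    have h4 := h₁.injOn (hm₁ z hz t ht) h3 heq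
    rw [Prod.mk.injEq] at h4
    obtain ⟨rfl, h4⟩ := h4
    have ht₁ : t₁ = 0 := by
      have h5 : 0 ≤ t₁ := hzt₁.2.1
      have h6 := le_max_right t₁ (γ z + t₁ / 2)
      linarith
    subst ht₁
    rw [h₁.zero z hz] at hx
    have h7 : t' - γ z' = 0 := h₂.eq_zero z' hz' _ (hm₂ z' hz' t' ht' htγ').2 (hx ▸ h₁.subset hz)
    rw [h7, h₂.zero z' hz'] at hx
    subst hx
    refine ⟨rfl, ?_⟩
    rw [h4, zero_div, add_zero, max_eq_right (hγ0 z)]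
    linarith
  have hCcomp : IsCompact C := by
    refine IsCompact.union (h₁.isCompact.inter_right ?_) h₂.isCompact
    exact isClosed_Ici.preimage (hγc.sub continuous_const)
  have hCpoly : ∀ z, PolyAt C z := fun z => PLAt.union
    (PolyAt.preimage (((hγpl z).restrict_open (h₁.poly z)).sub (PLAt.const δ (h₁.poly z)))
      (PolyAt.Ici _ _)) (h₂.poly z)
  have hdpl : ∀ {S : Set (E × ℝ)} {p}, PolyAt S p →
      PLAt (fun p : E × ℝ => p.2 - γ p.1) S p := fun hp =>
    hp.snd.sub (PLAt.comp (hγpl _) hp.fst (by simp))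
  have hcol : IsCollar M B ψ C δ := by
    refine ⟨hδ, hCB, hCcomp, hCpoly, ?_, ?_, ?_, ?_, ?_⟩
    · set A₁ := ((C₁ ∩ C) ×ˢ Set.Icc 0 δ) ∩ (fun p : E × ℝ => p.2 - γ p.1) ⁻¹' Set.Iic 0 with hA₁
      set A₂ := (C₂ ×ˢ Set.Icc 0 δ) ∩ (fun p : E × ℝ => p.2 - γ p.1) ⁻¹' Set.Ici 0 with hA₂
      have hdc : Continuous fun p : E × ℝ => p.2 - γ p.1 :=
        continuous_snd.sub (hγc.comp continuous_fst)
      have e : C ×ˢ Set.Icc 0 δ = A₁ ∪ A₂ := by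
        ext ⟨z, t⟩
        constructor
        · rintro ⟨hz, ht⟩
          rcases hcase z hz t ht with h | h
          · exact Or.inl ⟨⟨⟨h.1, hz⟩, ht⟩, sub_nonpos.2 h.2⟩
          · exact Or.inr ⟨⟨h.1, ht⟩, sub_nonneg.2 h.2⟩
        · rintro (h | h)
          · exact ⟨h.1.1.2, h.1.2⟩
          · exact ⟨Or.inr h.1.1, h.1.2⟩
      rw [e]
      refine isPLOn_union ?_ ?_
        (((h₁.isCompact.inter hCcomp).prod isCompact_Icc).isClosed.inter
          (isClosed_Iic.preimage hdc))
        ((h₂.isCompact.prod isCompact_Icc).isClosed.inter (isClosed_Ici.preimage hdc))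
      · refine isPLOn_congr (f := κ₁) (isPLOn_iff.2 fun p hp => ?_) fun p hp =>
          hψ₁ p.1 hp.1.1.1 p.2 (sub_nonpos.1 hp.2)
        refine (isPLOn_iff.1 h₁.isPLOn p (hm₁ _ hp.1.1.1 _ hp.1.2)).mono ?_
          (Filter.mem_of_superset self_mem_nhdsWithin fun q hq => hm₁ _ hq.1.1.1 _ hq.1.2)
        refine PolyAt.preimage (hdpl (PolyAt.prod ?_ (PolyAt.Icc _ _ _))) (PolyAt.Iic _ _)
        exact PolyAt.preimage (h₁.poly _) (hCpoly _)
      · refine isPLOn_congr (f := fun p => Θ (κ₂ (p.1, p.2 - γ p.1)))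
          (isPLOn_iff.2 fun p hp => ?_) fun p hp => hψ₂ p.1 hp.1.1 p.2 (sub_nonneg.1 hp.2)
        have hpoly : PolyAt A₂ p :=
          PolyAt.preimage (hdpl (PolyAt.prod (h₂.poly _) (PolyAt.Icc _ _ _))) (PolyAt.Ici _ _)
        have hmem : ∀ q ∈ A₂, (q.1, q.2 - γ q.1) ∈ C₂ ×ˢ Set.Icc 0 ε₂ := fun q hq =>
          hm₂ _ hq.1.1 _ hq.1.2 (sub_nonneg.1 hq.2)
        refine PLAt.comp (f := fun p : E × ℝ => κ₂ (p.1, p.2 - γ p.1))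
          (isPLOn_iff.1 hΘ _ (h₂.mapsTo (hmem p hp)))
          (PLAt.comp (f := fun p : E × ℝ => (p.1, p.2 - γ p.1))
            (isPLOn_iff.1 h₂.isPLOn _ (hmem p hp)) (hpoly.fst.prodMk (hdpl hpoly)) ?_) ?_
        · exact Filter.mem_of_superset self_mem_nhdsWithin hmem
        · exact Filter.mem_of_superset self_mem_nhdsWithin fun q hq => h₂.mapsTo (hmem q hq)
    · rintro ⟨z, t⟩ ⟨hz, ht⟩ ⟨z', t'⟩ ⟨hz', ht'⟩ heq
      rcases hcase z hz t ht with h | h <;> rcases hcase z' hz' t' ht' with h' | h'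
      · rw [hψ₁ z h.1 t h.2, hψ₁ z' h'.1 t' h'.2] at heq
        exact h₁.injOn (hm₁ z h.1 t ht) (hm₁ z' h'.1 t' ht') heq
      · rw [hψ₁ z h.1 t h.2, hψ₂ z' h'.1 t' h'.2] at heq
        exact Prod.ext_iff.2 (hmix z h.1 t ht h.2 z' h'.1 t' ht' h'.2 heq)
      · rw [hψ₂ z h.1 t h.2, hψ₁ z' h'.1 t' h'.2] at heq
        exact Prod.ext_iff.2 ((hmix z' h'.1 t' ht' h'.2 z h.1 t ht h.2 heq.symm).imp
          Eq.symm Eq.symm)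
      · rw [hψ₂ z h.1 t h.2, hψ₂ z' h'.1 t' h'.2] at heq
        have h3 := h₂.injOn (hm₂ z h.1 t ht h.2) (hm₂ z' h'.1 t' ht' h'.2)
          (hΘi (h₂.mapsTo (hm₂ z h.1 t ht h.2)) (h₂.mapsTo (hm₂ z' h'.1 t' ht' h'.2)) heq)
        rw [Prod.mk.injEq] at h3
        obtain ⟨rfl, h4⟩ := h3
        rw [sub_left_inj] at h4
        rw [h4]
    · rintro ⟨z, t⟩ ⟨hz, ht⟩
      rcases hcase z hz t ht with h | h
      · rw [hψ₁ z h.1 t h.2]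
        exact h₁.mapsTo (hm₁ z h.1 t ht)
      · rw [hψ₂ z h.1 t h.2]
        exact hΘM (h₂.mapsTo (hm₂ z h.1 t ht h.2))
    · intro z hz
      rcases hcase z hz 0 ⟨le_rfl, hδ.le⟩ with h | h
      · rw [hψ₁ z h.1 0 h.2, h₁.zero z h.1]
      · have h0 : γ z = 0 := le_antisymm h.2 (hγ0 z)
        rw [hψ₂ z h.1 0 h.2, h0, sub_zero, h₂.zero z h.1]
        by_cases hzC : z ∈ C₁
        · rw [hΘz z hzC, h0, h₁.zero z hzC]
        · exact hΘT z fun hcon => hzC (hBT z (h₂.subset h.1) hcon)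
    · intro z hz t ht hB
      rcases hcase z hz t ht with h | h
      · rw [hψ₁ z h.1 t h.2] at hB
        exact h₁.eq_zero z h.1 t (hm₁ z h.1 t ht).2 hB
      · rw [hψ₂ z h.1 t h.2] at hB
        have hx := hm₂ z h.1 t ht h.2
        by_cases hxT : κ₂ (z, t - γ z) ∈ T₁
        · -- the image of `Θ` meets the boundary only where nothing is pushed
          obtain ⟨⟨z₁, t₁⟩, hzt₁, hx₁⟩ := hxT
          rw [← hx₁, hΘκ' z₁ hzt₁.1 t₁ hzt₁.2] at hB
          have h5 : t₁ ≤ ε₁ := hzt₁.2.2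
          have h6 : 0 ≤ t₁ := hzt₁.2.1
          have h7 := hγ1 z₁
          have h8 := hγ0 z₁
          have h9 := h₁.eq_zero z₁ hzt₁.1 _
            ⟨h6.trans (le_max_left _ _), max_le h5 (by linarith)⟩ hB
          have h10 := le_max_right t₁ (γ z₁ + t₁ / 2)
          have h11 : t₁ = 0 := by linarith
          subst h11
          rw [h₁.zero z₁ hzt₁.1] at hx₁
          have h12 : t - γ z = 0 := h₂.eq_zero z h.1 _ hx.2 (hx₁ ▸ h₁.subset hzt₁.1)
          rw [h12, h₂.zero z h.1] at hx₁
          subst hx₁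
          linarith
        · rw [hΘT _ hxT] at hB
          have h12 : t - γ z = 0 := h₂.eq_zero z h.1 _ hx.2 hB
          rw [h12, h₂.zero z h.1] at hxT
          have h13 : γ z = 0 := by
            by_contra hcon
            exact hxT (hTC z (hBC z (h₂.subset h.1) (lt_of_le_of_ne (hγ0 z) (Ne.symm hcon))))
          linarith
  refine ⟨C, ψ, δ, hcol, ?_⟩
  have hfst : ∀ {z : E} {C' : Set E}, C' ⊆ B → Filter.Tendsto Prod.fst
      (𝓝[C' ×ˢ Set.Icc (0 : ℝ) ε₁] (z, 0)) (𝓝[B] z) := fun hC' =>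
    tendsto_nhdsWithin_of_tendsto_nhds_of_eventually_within _
      (continuous_fst.continuousWithinAt) (Filter.mem_of_superset self_mem_nhdsWithin
        fun p hp => hC' hp.1)
  have hdc : Continuous fun p : E × ℝ => p.2 - γ p.1 :=
    continuous_snd.sub (hγc.comp continuous_fst)
  rintro z (hz | hz)
  · have hzC : z ∈ C₁ := mem_of_mem_nhdsWithin (hS₁B hz) (hn₁ z hz).1
    have hev : ∀ᶠ y in 𝓝 z, γ y = δ := (hgS z hz).mono fun y hy => by
      simp only [hγ, hy, mul_one]
    constructor
    · filter_upwards [(hn₁ z hz).1, mem_nhdsWithin_of_mem_nhds hev] with y hy hy'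
      exact Or.inl ⟨hy, sub_nonneg.2 (ge_of_eq hy')⟩
    · have hN : {p : E × ℝ | γ p.1 = δ ∧ p.2 < δ} ∈ 𝓝[C₁ ×ˢ Set.Icc 0 ε₁] (z, (0 : ℝ)) := by
        refine mem_nhdsWithin_of_mem_nhds (Filter.inter_mem ?_ ?_)
        · exact (continuous_fst.tendsto (z, (0 : ℝ))).eventually hev
        · exact (isOpen_lt continuous_snd continuous_const).mem_nhds hδ
      refine Filter.mem_of_superset (h₁.image_mem hzC (hn₁ z hz).2 hN) ?_
      rintro _ ⟨⟨y, t⟩, ⟨hy, hyN⟩, rfl⟩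
      refine ⟨(y, t), ⟨Or.inl ⟨hy.1, sub_nonneg.2 hyN.1.ge⟩, hy.2.1, hyN.2.le⟩, ?_⟩
      exact hψ₁ y hy.1 t (hyN.2.le.trans hyN.1.ge)
  · have hzB := hS₂B hz
    have hzC₂ : z ∈ C₂ := mem_of_mem_nhdsWithin hzB (hn₂ z hz).1
    refine ⟨Filter.mem_of_superset (hn₂ z hz).1 Set.subset_union_right, ?_⟩
    -- Where `γ z > 0`, nearby points of `M` already lie in the strip of the first collar below `γ`.
    -- The case `γ z = 0` is delicate: there both collars contribute near `z`.
    rcases (hγ0 z).eq_or_lt with h0 | h0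
    · have hN₂ : {p : E × ℝ | p.2 + γ p.1 < δ} ∈ 𝓝[C₂ ×ˢ Set.Icc 0 ε₂] (z, (0 : ℝ)) := by
        refine mem_nhdsWithin_of_mem_nhds ((isOpen_lt (continuous_snd.add
          (hγc.comp continuous_fst)) continuous_const).mem_nhds ?_)
        simpa [← h0] using hδ
      have hI := h₂.image_mem hzC₂ (hn₂ z hz).2 hN₂
      have hI' : ∀ x ∈ κ₂ '' (C₂ ×ˢ Set.Icc 0 ε₂ ∩ {p : E × ℝ | p.2 + γ p.1 < δ}),
          Θ x ∈ ψ '' (C ×ˢ Set.Icc 0 δ) := by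
        rintro _ ⟨⟨y, t⟩, ⟨hy, hyN⟩, rfl⟩
        have h1 : 0 ≤ t := hy.2.1
        have h2 := hγ0 y
        refine ⟨(y, t + γ y), ⟨Or.inr hy.1, by simp only; linarith, le_of_lt hyN⟩, ?_⟩
        rw [hψ₂ y hy.1 _ (by linarith), add_sub_cancel_right]
      have hout : ∀ᶠ x in 𝓝[M] z, x ∉ T₁ → x ∈ ψ '' (C ×ˢ Set.Icc 0 δ) := by
        filter_upwards [hI] with x hx hxT
        rw [← hΘT x hxT]
        exact hI' x hx
      -- A point `κ₁(y, t)` with `t ≤ γ y` is a value of `ψ` directly. If `t > γ y`, it is `Θ` of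
      -- `κ₁(y, min t (2(t - γ y)))`, since `min t (2(t - γ))` inverts `max x (γ + x/2)`; by
      -- continuity this preimage lies in the second collar.
      have hin : ∀ᶠ x in 𝓝[M] z, x ∈ T₁ → x ∈ ψ '' (C ×ˢ Set.Icc 0 δ) := by
        by_cases hzC : z ∈ C₁
        · have hcl : ContinuousWithinAt (fun p : E × ℝ => κ₁ (p.1, max 0 (min p.2
              (2 * (p.2 - γ p.1))))) (C₁ ×ˢ Set.Icc 0 ε₁) (z, 0) := by
            have hc' : Continuous fun p : E × ℝ => (p.1, max 0 (min p.2 (2 * (p.2 - γ p.1)))) := by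
              fun_prop
            refine ContinuousWithinAt.comp (t := C₁ ×ˢ Set.Icc 0 ε₁)
              (f := fun p : E × ℝ => (p.1, max 0 (min p.2 (2 * (p.2 - γ p.1))))) ?_
              hc'.continuousWithinAt ?_
            · refine h₁.isPLOn.continuousOn _ ⟨hzC, le_max_left _ _, max_le h₁.pos.le ?_⟩
              exact (min_le_left _ _).trans h₁.pos.le
            · exact fun p hp => ⟨hp.1, le_max_left _ _,
                max_le h₁.pos.le ((min_le_left _ _).trans hp.2.2)⟩
          have hval : κ₁ (z, max 0 (min 0 (2 * (0 - γ z)))) = z := by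
            rw [← h0, sub_zero, mul_zero, min_self, max_self, h₁.zero z hzC]
          have hcl' : Filter.Tendsto (fun p : E × ℝ => κ₁ (p.1, max 0 (min p.2
              (2 * (p.2 - γ p.1))))) (𝓝[C₁ ×ˢ Set.Icc 0 ε₁] (z, 0)) (𝓝[M] z) := by
            refine tendsto_nhdsWithin_of_tendsto_nhds_of_eventually_within _ ?_ ?_
            · have := hcl.tendsto
              simp only [hval] at this
              exact this
            · filter_upwards [self_mem_nhdsWithin] with p hp
              exact h₁.mapsTo ⟨hp.1, le_max_left _ _,
                max_le h₁.pos.le ((min_le_left _ _).trans hp.2.2)⟩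
          have hN₁ : {p : E × ℝ | p.1 ∈ C₂ ∧ p.2 < δ ∧ κ₁ (p.1, max 0 (min p.2
              (2 * (p.2 - γ p.1)))) ∈ κ₂ '' (C₂ ×ˢ Set.Icc 0 ε₂ ∩
                {p : E × ℝ | p.2 + γ p.1 < δ})} ∈ 𝓝[C₁ ×ˢ Set.Icc 0 ε₁] (z, (0 : ℝ)) := by
            refine Filter.inter_mem (hfst h₁.subset (hn₂ z hz).1)
              (Filter.inter_mem ?_ (hcl' hI))
            exact mem_nhdsWithin_of_mem_nhds
              ((isOpen_lt continuous_snd continuous_const).mem_nhds hδ)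
          have h3 := h₁.isPLHomeoOn.image_mem_nhdsWithin (x := (z, 0))
            ⟨hzC, le_rfl, h₁.pos.le⟩ hN₁
          rw [h₁.zero z hzC, mem_nhdsWithin_iff_eventually] at h3
          filter_upwards [mem_nhdsWithin_of_mem_nhds h3] with x hx hxT
          obtain ⟨⟨y, t⟩, ⟨hy, hy2, hyδ, hyN⟩, rfl⟩ := hx hxT
          have ht0 : 0 ≤ t := hy.2.1
          simp only at hy2 hyδ hyN
          rcases le_or_gt t (γ y) with h | h
          · exact ⟨(y, t), ⟨Or.inr hy2, ht0, hyδ.le⟩, hψ₁ y hy.1 t h⟩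
          · have h4 := hI' _ hyN
            have h5 : 0 ≤ min t (2 * (t - γ y)) := le_min ht0 (by linarith)
            rw [max_eq_right h5, hΘκ' y hy.1 _ ⟨h5, (min_le_left _ _).trans hy.2.2⟩] at h4
            convert h4 using 3
            rcases min_cases t (2 * (t - γ y)) with h6 | h6
            · rw [h6.1, max_eq_left (by linarith)]
            · rw [h6.1, max_eq_right (by linarith)]
              ring
        · have hzT : z ∉ T₁ := fun hcon => hzC (hBT z hzB hcon)
          have hcl : IsClosed T₁ := ((h₁.isCompact.prod isCompact_Icc).image_of_continuousOn
            h₁.isPLOn.continuousOn).isClosed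
          filter_upwards [mem_nhdsWithin_of_mem_nhds (hcl.isOpen_compl.mem_nhds hzT)]
            with x hx hxT
          exact (hx hxT).elim
      filter_upwards [hin, hout] with x h1 h2
      exact (em (x ∈ T₁)).elim h1 h2
    · have hzC : z ∈ C₁ := hBC z hzB h0
      have hzK : z ∈ K := by
        by_contra hcon
        simp only [hγ, hgK z hcon, mul_zero, lt_irrefl] at h0
      have hN : {p : E × ℝ | p.1 ∈ C₂ ∧ p.2 - γ p.1 < 0} ∈ 𝓝[C₁ ×ˢ Set.Icc 0 ε₁] (z, (0 : ℝ)) := by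
        refine Filter.inter_mem (hfst h₁.subset (hn₂ z hz).1) (mem_nhdsWithin_of_mem_nhds
          ((isOpen_lt hdc continuous_const).mem_nhds ?_))
        simpa using h0
      refine Filter.mem_of_superset (h₁.image_mem hzC (hOn z (hKO hzK)).2 hN) ?_
      rintro _ ⟨⟨y, t⟩, ⟨hy, hyN⟩, rfl⟩
      have h1 := sub_neg.1 hyN.2
      exact ⟨(y, t), ⟨Or.inr hyN.1, hy.2.1, h1.le.trans (hγ1 y)⟩, hψ₁ y hy.1 t h1.le⟩

/-- A boundary that is locally collared is collared near every compact set. -/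
theorem collaredNear_of_isCompact {M B Z : Set E} (hM : IsPLOn (fun x => x) M)
    (hZ : IsCompact Z) (hZB : Z ⊆ B) (h : ∀ z ∈ Z, CollaredNear M B {z}) :
    CollaredNear M B Z := by
  -- The induction over pieces of `Z` uses closures because merging requires a compact piece.
  have key : CollaredNear M B (closure Z ∩ Z) := by
    refine hZ.induction_on (p := fun S => CollaredNear M B (closure S ∩ Z)) ?_ ?_ ?_ ?_
    · refine ⟨∅, Prod.fst, 1, ⟨one_pos, Set.empty_subset _, isCompact_empty,
        fun z => PLAt.of_bot (by simp), ?_, ?_, ?_, ?_, ?_⟩, by simp⟩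
      · rw [Set.empty_prod]
        exact fun x hx => hx.elim
      all_goals simp [Set.MapsTo]
    · rintro S T hST ⟨C, κ, ε, h, hn⟩
      exact ⟨C, κ, ε, h, fun z hz => hn z ⟨closure_mono hST hz.1, hz.2⟩⟩
    · intro S T hS hT
      rw [closure_union, Set.union_inter_distrib_right]
      exact hS.union hM hT (hZ.inter_left isClosed_closure)
        (Set.inter_subset_right.trans hZB) (Set.inter_subset_right.trans hZB)
    · intro z hz
      obtain ⟨C, κ, ε, h, hn⟩ := h z hz
      obtain ⟨O, hO, hzO, hOn⟩ := exists_isOpen_of_collar hn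
      obtain ⟨N, hN, hNc, hNO⟩ := exists_mem_nhds_isClosed_subset
        (hO.mem_nhds (hzO (Set.mem_singleton z)))
      refine ⟨N, mem_nhdsWithin_of_mem_nhds hN, C, κ, ε, h, fun y hy => hOn y (hNO ?_)⟩
      rw [hNc.closure_eq] at hy
      exact hy.1
  rwa [Set.inter_eq_right.2 subset_closure] at key

end Collar

/-! ### Trivial normal bundles of zero sets with local product structure. -/

section NormalBundle

set_option linter.unusedSectionVars false

variable {E F : Type*} [NormedAddCommGroup E] [NormedSpace ℝ E] [FiniteDimensional ℝ E]
  [NormedAddCommGroup F] [NormedSpace ℝ F] [FiniteDimensional ℝ F]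

theorem isPolytope_Icc_pi {ι : Type*} [Fintype ι] {a b : ι → ℝ} (h : a ≤ b) :
    IsPolytope (Set.Icc a b) := by
  have e : Set.Icc a b = convexHull ℝ (Set.univ.pi fun i => ({a i, b i} : Set ℝ)) := by
    rw [convexHull_pi, ← Set.pi_univ_Icc]
    refine Set.pi_congr rfl fun i _ => ?_
    rw [convexHull_pair, segment_eq_Icc (h i)]
  rw [e]
  exact isPolytope_convexHull (Set.Finite.pi fun i => Set.toFinite _)

/-- Supplies compact polyhedral neighbourhoods, which serve as bases of local collars. -/
theorem PolyAt.exists_isCompact {S : Set E} {x : E} (h : PolyAt S x) {N : Set E}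
    (hN : N ∈ 𝓝[S] x) : ∃ Q ⊆ S ∩ N, IsCompact Q ∧ (∀ y, PolyAt Q y) ∧ Q ∈ 𝓝[S] x := by
  obtain ⟨𝒞, hfin, h𝒞, hx⟩ := h.exists_subset hN
  refine ⟨⋃₀ 𝒞, Set.sUnion_subset fun P hP => (h𝒞 P hP).2.1,
    hfin.isCompact_sUnion fun P hP => (h𝒞 P hP).1.isCompact, fun y => ?_, hx⟩
  exact ⟨𝒞, hfin, fun P hP => ⟨(h𝒞 P hP).1, Set.subset_sUnion_of_mem hP, AffineMap.id ℝ E,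
    fun _ _ => rfl⟩, self_mem_nhdsWithin⟩

theorem Icc_mem_nhds_zero {k : ℕ} {ε : ℝ} (hε : 0 < ε) :
    Set.Icc (fun _ => -ε) (fun _ => ε) ∈ 𝓝 (0 : Fin k → ℝ) := by
  rw [← Set.pi_univ_Icc]
  exact set_pi_mem_nhds Set.finite_univ fun i _ => Icc_mem_nhds (by simpa using hε) hε

theorem exists_Icc_subset {k : ℕ} {N : Set (Fin k → ℝ)} (hN : N ∈ 𝓝 0) :
    ∃ ε > 0, Set.Icc (fun _ => -ε) (fun _ => ε) ⊆ N := by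
  obtain ⟨r, hr, hrN⟩ := Metric.nhds_basis_closedBall.mem_iff.1 hN
  refine ⟨r, hr, fun x hx => hrN ?_⟩
  rw [mem_closedBall_zero_iff, pi_norm_le_iff_of_nonneg hr.le]
  exact fun i => abs_le.2 ⟨hx.1 i, hx.2 i⟩

/-- A product structure of `W` at `z`, in which `D` is the second projection. -/
def HasProductGerm {k : ℕ} (Y : Set F) (W : Set E) (D : E → Fin k → ℝ) (z : E) : Prop :=
  ∃ (f : E → F × (Fin k → ℝ)) (g : F × (Fin k → ℝ) → E),
    GermHomeo f g W (Y ×ˢ Set.univ) z ∧ ∀ᶠ y in 𝓝[W] z, (f y).2 = D y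

theorem plAt_cons {k : ℕ} {S : Set E} {x : E} {a : E → ℝ} {d : E → Fin k → ℝ} (ha : PLAt a S x)
    (hd : PLAt d S x) : PLAt (fun y => (Fin.cons (a y) (d y) : Fin (k + 1) → ℝ)) S x := by
  refine PLAt.pi ha.polyAt fun i => ?_
  refine Fin.cases ?_ (fun j => ?_) i
  · simpa using ha
  · simpa using hd.linear_comp (LinearMap.proj j)

theorem plAt_tail {k : ℕ} {S : Set E} {x : E} {d : E → Fin (k + 1) → ℝ}
    (hd : PLAt d S x) : PLAt (fun y => Fin.tail (d y)) S x :=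
  hd.linear_comp (LinearMap.funLeft ℝ ℝ Fin.succ)

/-- In the local product the first component of `D` is a linear coordinate, and moving it away from
`0` is the collar. The sign `σ = ±1` selects the side of the hypersurface. -/
theorem collaredNear_of_hasProductGerm {k : ℕ} {Y : Set F} (hY : IsPLOn (fun y => y) Y) {W : Set E}
    {D : E → Fin (k + 1) → ℝ} {z : E} (hz : D z = 0) (h : HasProductGerm Y W D z) {σ : ℝ}
    (hσ : σ * σ = 1) :
    CollaredNear {w ∈ W | 0 ≤ σ * D w 0} {w ∈ W | D w 0 = 0} {z} := by
  obtain ⟨f, g, h, hD⟩ := h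
  obtain ⟨O, O', hO, hO', hzO, hzO', hON, -, hf, hg, hfm, hgm, hl, hr⟩ :=
    h.exists_isOpen hD Filter.univ_mem
  have hfz : (f z).2 = 0 := by rw [hON ⟨h.mem, hzO⟩, hz]
  set y₀ := (f z).1 with hy₀
  have hfz' : f z = (y₀, 0) := Prod.ext rfl hfz
  have hy₀Y : y₀ ∈ Y := h.map_mem.1
  rw [hfz'] at hzO'
  obtain ⟨N₁, hN₁, N₂, hN₂, hN⟩ := mem_nhds_prod_iff.1 (hO'.mem_nhds hzO')
  obtain ⟨Q, hQ, hQc, hQp, hQn⟩ := (isPLOn_iff.1 hY y₀ hy₀Y).polyAt.exists_isCompact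
    (mem_nhdsWithin_of_mem_nhds hN₁)
  obtain ⟨ε, hε, hεN⟩ := exists_Icc_subset hN₂
  have hσ1 : |σ| = 1 := by
    rw [← pow_eq_one_iff_of_nonneg (abs_nonneg σ) two_ne_zero, sq_abs, sq, hσ]
  have hσt : ∀ t ∈ Set.Icc 0 ε, -ε ≤ σ * t ∧ σ * t ≤ ε := fun t ht => by
    rw [← abs_le, abs_mul, hσ1, one_mul, abs_of_nonneg ht.1]
    exact ht.2
  set R : Set (Fin k → ℝ) := Set.Icc (fun _ => -ε) (fun _ => ε) with hR
  have hRle : (fun _ => -ε : Fin k → ℝ) ≤ fun _ => ε := fun _ => by simp only; linarith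
  have hmem : ∀ q ∈ Q, ∀ d ∈ R, ∀ s, -ε ≤ s → s ≤ ε →
      ((q, Fin.cons s d) : F × (Fin (k + 1) → ℝ)) ∈ (Y ×ˢ Set.univ) ∩ O' := by
    intro q hq d hd s hs hs'
    refine ⟨⟨(hQ hq).1, trivial⟩, hN ⟨(hQ hq).2, hεN ⟨fun i => ?_, fun i => ?_⟩⟩⟩
    · refine Fin.cases ?_ (fun j => ?_) i
      · simpa using hs
      · simpa using hd.1 j
    · refine Fin.cases ?_ (fun j => ?_) i
      · simpa using hs'
      · simpa using hd.2 j
  have hfg : ∀ q ∈ Q, ∀ d ∈ R, ∀ s, -ε ≤ s → s ≤ ε → f (g (q, Fin.cons s d)) = (q, Fin.cons s d) :=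
    fun q hq d hd s hs hs' => hr (hmem q hq d hd s hs hs')
  have hDg : ∀ q ∈ Q, ∀ d ∈ R, ∀ s, -ε ≤ s → s ≤ ε → D (g (q, Fin.cons s d)) = Fin.cons s d := by
    intro q hq d hd s hs hs'
    have h1 := hON (hgm (hmem q hq d hd s hs hs'))
    rw [Set.mem_ofPred_eq, hfg q hq d hd s hs hs'] at h1
    exact h1.symm
  have hgW : ∀ q ∈ Q, ∀ d ∈ R, ∀ s, -ε ≤ s → s ≤ ε → g (q, Fin.cons s d) ∈ W :=
    fun q hq d hd s hs hs' => (hgm (hmem q hq d hd s hs hs')).1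
  -- The base of the collar is the image under `g` of a compact box in the slice where the first
  -- coordinate is `0`.
  set g₀ : F × (Fin k → ℝ) → E := fun p => g (p.1, Fin.cons 0 p.2) with hg₀
  have h0 : -ε ≤ (0 : ℝ) ∧ (0 : ℝ) ≤ ε := ⟨by linarith, hε.le⟩
  have hQR : ∀ p, PolyAt (Q ×ˢ R) p := fun p =>
    PolyAt.prod (hQp _) ((isPolytope_Icc_pi hRle).polyAt _)
  have hg₀pl : IsPLOn g₀ (Q ×ˢ R) := isPLOn_iff.2 fun p hp => by
    have h1 : PLAt (fun p : F × (Fin k → ℝ) => (p.1, (Fin.cons (0 : ℝ) p.2 : Fin (k + 1) → ℝ)))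
        (Q ×ˢ R) p :=
      (hQR p).fst.prodMk (plAt_cons (PLAt.const 0 (hQR p)) (hQR p).snd)
    exact PLAt.comp (f := fun p : F × (Fin k → ℝ) => (p.1, (Fin.cons (0 : ℝ) p.2 :
      Fin (k + 1) → ℝ))) (isPLOn_iff.1 hg _ (hmem _ hp.1 _ hp.2 0 h0.1 h0.2)) h1
      (Filter.mem_of_superset self_mem_nhdsWithin fun q hq => hmem _ hq.1 _ hq.2 0 h0.1 h0.2)
  have hRc : IsCompact R := isCompact_Icc
  have hg₀i : Set.InjOn g₀ (Q ×ˢ R) := fun p hp q hq hpq => by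
    have h1 := congrArg f hpq
    simp only [hg₀] at h1
    rw [hfg _ hp.1 _ hp.2 0 h0.1 h0.2, hfg _ hq.1 _ hq.2 0 h0.1 h0.2, Prod.mk.injEq] at h1
    exact Prod.ext h1.1 (Fin.cons_injective2 h1.2).2
  have hCc : IsCompact (g₀ '' (Q ×ˢ R)) := (hQc.prod hRc).image_of_continuousOn hg₀pl.continuousOn
  set κ : E × ℝ → E := fun p => g ((f p.1).1, Fin.cons (σ * p.2) (Fin.tail (f p.1).2)) with hκ
  have hκg : ∀ q ∈ Q, ∀ d ∈ R, ∀ t, κ (g₀ (q, d), t) = g (q, Fin.cons (σ * t) d) := by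
    intro q hq d hd t
    simp only [hκ, hg₀]
    rw [hfg q hq d hd 0 h0.1 h0.2]
    simp
  have hz0 : (0 : Fin k → ℝ) ∈ R := ⟨fun _ => by simpa using hε.le, fun _ => hε.le⟩
  have hev : ∀ᶠ w in 𝓝[W] z, w = g (f w) ∧ (f w).2 = D w ∧ (f w).1 ∈ Q ∧ Fin.tail (D w) ∈ R ∧
      |D w 0| ≤ ε := by
    have ht := h.tendsto
    rw [hfz', nhdsWithin_prod_eq, nhdsWithin_univ] at ht
    have h1 : ∀ᶠ p in 𝓝[Y] y₀ ×ˢ 𝓝 (0 : Fin (k + 1) → ℝ),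
        p.1 ∈ Q ∧ p.2 ∈ Set.Icc (fun _ => -ε) fun _ => ε :=
      (Filter.eventually_mem_set.2 hQn).prod_mk
        (Filter.eventually_mem_set.2 (Icc_mem_nhds_zero hε))
    filter_upwards [ht.eventually h1, h.left_inv, hD] with w h2 h3 h4
    rw [h4] at h2
    refine ⟨h3.2.symm, h4, h2.1, ⟨fun i => h2.2.1 i.succ, fun i => h2.2.2 i.succ⟩,
      abs_le.2 ⟨h2.2.1 0, h2.2.2 0⟩⟩
  refine ⟨g₀ '' (Q ×ˢ R), κ, ε, ⟨hε, ?_, hCc, ?_, ?_, ?_, ?_, ?_, ?_⟩, ?_⟩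
  · rintro _ ⟨⟨q, d⟩, ⟨hq, hd⟩, rfl⟩
    refine ⟨hgW q hq d hd 0 h0.1 h0.2, ?_⟩
    simp only [hg₀]
    rw [hDg q hq d hd 0 h0.1 h0.2, Fin.cons_zero]
  · obtain ⟨g', -, hg', -⟩ := isPLHomeoOn_of_injOn hg₀pl (hQc.prod hRc) hg₀i
    exact polyAt_of_isCompact hCc fun x hx => (isPLOn_iff.1 hg' x hx).polyAt
  · refine isPLOn_iff.2 ?_
    rintro ⟨_, t⟩ ⟨⟨⟨q, d⟩, ⟨hq, hd⟩, rfl⟩, ht⟩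
    obtain ⟨g', -, hg', -⟩ := isPLHomeoOn_of_injOn hg₀pl (hQc.prod hRc) hg₀i
    have hCp := polyAt_of_isCompact hCc fun x hx => (isPLOn_iff.1 hg' x hx).polyAt
    have hS : PolyAt ((g₀ '' (Q ×ˢ R)) ×ˢ Set.Icc 0 ε) (g₀ (q, d), t) :=
      PolyAt.prod (hCp _) (PolyAt.Icc _ _ _)
    have h1 : PLAt (fun p : E × ℝ => f p.1) ((g₀ '' (Q ×ˢ R)) ×ˢ Set.Icc 0 ε) (g₀ (q, d), t) := by
      refine PLAt.comp (T := W ∩ O) (isPLOn_iff.1 hf _ ?_) hS.fst ?_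
      · exact hgm (hmem q hq d hd 0 h0.1 h0.2)
      · filter_upwards [self_mem_nhdsWithin]
        rintro ⟨_, s⟩ ⟨⟨⟨q, d⟩, ⟨hq, hd⟩, rfl⟩, -⟩
        exact hgm (hmem q hq d hd 0 h0.1 h0.2)
    have hm : ∀ p ∈ (g₀ '' (Q ×ˢ R)) ×ˢ Set.Icc 0 ε,
        (((f p.1).1, Fin.cons (σ * p.2) (Fin.tail (f p.1).2)) : F × (Fin (k + 1) → ℝ)) ∈
          (Y ×ˢ Set.univ) ∩ O' := by
      rintro ⟨_, s⟩ ⟨⟨⟨q, d⟩, ⟨hq, hd⟩, rfl⟩, hs⟩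
      simp only [hg₀]
      rw [hfg q hq d hd 0 h0.1 h0.2]
      exact hmem q hq d hd _ (hσt s hs).1 (hσt s hs).2
    refine PLAt.comp (f := fun p : E × ℝ =>
      (((f p.1).1, Fin.cons (σ * p.2) (Fin.tail (f p.1).2)) : F × (Fin (k + 1) → ℝ)))
      (isPLOn_iff.1 hg _ (hm _ ⟨⟨_, ⟨hq, hd⟩, rfl⟩, ht⟩))
      (h1.fst.prodMk (plAt_cons (hS.snd.const_smul σ) (plAt_tail h1.snd))) ?_
    exact Filter.mem_of_superset self_mem_nhdsWithin hm
  · rintro ⟨_, t⟩ ⟨⟨⟨q, d⟩, ⟨hq, hd⟩, rfl⟩, ht⟩ ⟨_, t'⟩ ⟨⟨⟨q', d'⟩, ⟨hq', hd'⟩, rfl⟩, ht'⟩ heq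
    rw [hκg q hq d hd, hκg q' hq' d' hd'] at heq
    have h1 := congrArg f heq
    rw [hfg q hq d hd _ (hσt t ht).1 (hσt t ht).2,
      hfg q' hq' d' hd' _ (hσt t' ht').1 (hσt t' ht').2, Prod.mk.injEq] at h1
    obtain ⟨h2, h3⟩ := Fin.cons_injective2 h1.2
    have h4 : t = t' := by
      have := congrArg (σ * ·) h2
      simpa only [← mul_assoc, hσ, one_mul] using this
    rw [h1.1, h3, h4]
  · rintro ⟨_, t⟩ ⟨⟨⟨q, d⟩, ⟨hq, hd⟩, rfl⟩, ht⟩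
    rw [hκg q hq d hd]
    refine ⟨hgW q hq d hd _ (hσt t ht).1 (hσt t ht).2, ?_⟩
    rw [hDg q hq d hd _ (hσt t ht).1 (hσt t ht).2, Fin.cons_zero, ← mul_assoc, hσ, one_mul]
    exact ht.1
  · rintro _ ⟨⟨q, d⟩, ⟨hq, hd⟩, rfl⟩
    rw [hκg q hq d hd, mul_zero]
  · rintro _ ⟨⟨q, d⟩, ⟨hq, hd⟩, rfl⟩ t ht hB
    rw [hκg q hq d hd] at hB
    have h1 := hB.2
    rw [hDg q hq d hd _ (hσt t ht).1 (hσt t ht).2, Fin.cons_zero] at h1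
    have := congrArg (σ * ·) h1
    simpa only [← mul_assoc, hσ, one_mul, mul_zero] using this
  · rintro _ rfl
    constructor
    · filter_upwards [nhdsWithin_mono _ (Set.sep_subset W _) hev, self_mem_nhdsWithin]
        with w hw' hw
      obtain ⟨h1, h2, h3, h4, -⟩ := hw'
      refine ⟨((f w).1, Fin.tail (D w)), ⟨h3, h4⟩, ?_⟩
      simp only [hg₀]
      rw [← hw.2, Fin.cons_self_tail, ← h2]
      exact h1.symm
    · filter_upwards [nhdsWithin_mono _ (Set.sep_subset W _) hev, self_mem_nhdsWithin]
        with w hw' hw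
      obtain ⟨h1, h2, h3, h4, h5⟩ := hw'
      have h6 : σ * D w 0 ≤ ε := by
        refine (le_abs_self _).trans ?_
        rwa [abs_mul, hσ1, one_mul]
      refine ⟨(g₀ ((f w).1, Fin.tail (D w)), σ * D w 0), ⟨⟨_, ⟨h3, h4⟩, rfl⟩, hw.2, h6⟩, ?_⟩
      rw [hκg _ h3 _ h4, ← mul_assoc, hσ, one_mul, Fin.cons_self_tail, ← h2]
      exact h1.symm

/-- The local product structure survives on the hypersurface where the first component vanishes,
with that component dropped. This is what allows induction on the number of components. -/
theorem HasProductGerm.tail {k : ℕ} {Y : Set F} {W : Set E} {D : E → Fin (k + 1) → ℝ}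
    (hD : IsPLOn D W) {z : E} (hz : D z = 0) (h : HasProductGerm Y W D z) :
    HasProductGerm Y {w ∈ W | D w 0 = 0} (fun w => Fin.tail (D w)) z := by
  obtain ⟨f, g, h, hfD⟩ := h
  have hW₁ : PolyAt {w ∈ W | D w 0 = 0} z :=
    PolyAt.preimage (T := {0}) ((isPLOn_iff.1 hD z h.mem).linear_comp (LinearMap.proj 0))
      (PolyAt.singleton _ _)
  have hfz : f z = ((f z).1, 0) := Prod.ext rfl (by rw [hfD.self_of_nhdsWithin h.mem, hz])
  have hc : Filter.Tendsto (fun p : F × (Fin k → ℝ) =>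
      ((p.1, Fin.cons 0 p.2) : F × (Fin (k + 1) → ℝ)))
      (𝓝[Y ×ˢ Set.univ] ((f z).1, 0)) (𝓝[Y ×ˢ Set.univ] (f z)) := by
    refine tendsto_nhdsWithin_of_tendsto_nhds_of_eventually_within _ ?_
      (Filter.mem_of_superset self_mem_nhdsWithin fun p hp => ⟨hp.1, trivial⟩)
    have : Continuous fun p : F × (Fin k → ℝ) =>
        ((p.1, Fin.cons 0 p.2) : F × (Fin (k + 1) → ℝ)) :=
      continuous_fst.prodMk (continuous_const.finCons continuous_snd)
    have h2 := (this.tendsto ((f z).1, 0)).mono_left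
      (nhdsWithin_le_nhds (s := Y ×ˢ (Set.univ : Set (Fin k → ℝ))))
    convert h2 using 2
    rw [hfz]
    exact Prod.ext rfl (Fin.cons_self_tail (0 : Fin (k + 1) → ℝ)).symm
  have hfz' : Fin.tail (f z).2 = 0 := by rw [hfz]; rfl
  have hpoly : PolyAt (Y ×ˢ (Set.univ : Set (Fin k → ℝ))) ((f z).1, 0) := by
    have h1 := h.plAt_inv.polyAt
    refine PolyAt.preimage (E := F × (Fin k → ℝ)) (S := Set.univ) (f := fun p => (p.1,
      (Fin.cons 0 p.2 : Fin (k + 1) → ℝ))) (T := Y ×ˢ Set.univ) (x := ((f z).1, 0)) ?_ ?_ |>.congr_set ?_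
    · exact (PolyAt.univ _).fst.prodMk (plAt_cons (PLAt.const 0 (PolyAt.univ _))
        (PolyAt.univ _).snd)
    · convert h1 using 1
      rw [hfz]
      exact Prod.ext rfl (Fin.cons_self_tail (0 : Fin (k + 1) → ℝ))
    · congr 1
      ext p
      simp
  refine ⟨fun w => ((f w).1, Fin.tail (f w).2), fun p => g (p.1, Fin.cons 0 p.2),
    ⟨⟨h.mem, by rw [hz]; rfl⟩, ⟨h.map_mem.1, trivial⟩, ?_, ?_, ?_, ?_⟩, ?_⟩
  · have h1 : PLAt f {w ∈ W | D w 0 = 0} z :=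
      h.plAt.mono hW₁ (Filter.mem_of_superset self_mem_nhdsWithin fun w hw => hw.1)
    exact h1.fst.prodMk (plAt_tail h1.snd)
  · rw [hfz']
    refine PLAt.comp (f := fun p : F × (Fin k → ℝ) => (p.1, (Fin.cons 0 p.2 :
      Fin (k + 1) → ℝ))) (T := Y ×ˢ Set.univ) ?_
      (hpoly.fst.prodMk (plAt_cons (PLAt.const 0 hpoly) hpoly.snd))
      (Filter.mem_of_superset self_mem_nhdsWithin fun p hp => ⟨hp.1, trivial⟩)
    convert h.plAt_inv using 1
    rw [hfz]
    exact Prod.ext rfl (Fin.cons_self_tail (0 : Fin (k + 1) → ℝ))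
  · filter_upwards [nhdsWithin_mono _ (Set.sep_subset W _) h.left_inv,
      nhdsWithin_mono _ (Set.sep_subset W _) hfD, self_mem_nhdsWithin] with w h1 h2 h3
    refine ⟨⟨h1.1.1, trivial⟩, ?_⟩
    have h4 : (f w).2 0 = 0 := by rw [h2]; exact h3.2
    rw [← h4, Fin.cons_self_tail]
    exact h1.2
  · simp only [hfz']
    filter_upwards [hc.eventually h.right_inv, (h.tendsto_inv.comp hc).eventually hfD]
      with p h1 h2
    refine ⟨⟨h1.1, ?_⟩, ?_⟩
    · rw [Function.comp_apply, h1.2] at h2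
      rw [← h2]
      rfl
    · simp only [h1.2, Fin.tail_cons]
  · filter_upwards [nhdsWithin_mono _ (Set.sep_subset W _) hfD] with w hw
    simp only [hw]

/-- The zero set has by induction a trivial bundle in the hypersurface `B` where the first component
vanishes, and `B` has collars on both sides near the compact zero set. Composing the two gives one
more normal direction. Only existence of local products is used; they need not be compatible with
each other. -/
theorem hasTrivialNormalBundle_of_hasProductGerm {Y : Set F} (hY : IsPLOn (fun y => y) Y) :
    ∀ {k : ℕ} {W : Set E} {D : E → Fin k → ℝ}, IsPLOn D W → IsCompact {w ∈ W | D w = 0} →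
      (∀ z ∈ W, D z = 0 → HasProductGerm Y W D z) →
      HasTrivialNormalBundle k {w ∈ W | D w = 0} W := by
  intro k
  induction k with
  | zero =>
    intro W D hD hZ h
    have e : {w ∈ W | D w = 0} = W := Set.sep_eq_self_iff_mem_true.2 fun w _ =>
      Subsingleton.elim _ _
    rw [e] at hZ ⊢
    have hW : ∀ x ∈ W, PolyAt W x := fun x hx => (isPLOn_iff.1 hD x hx).polyAt
    have hI : ∀ x : Fin 0 → ℝ, x ∈ Set.Icc (-1 : Fin 0 → ℝ) 1 := fun x =>
      ⟨fun i => i.elim0, fun i => i.elim0⟩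
    refine ⟨W, Prod.fst, subset_rfl, fun x _ => self_mem_nhdsWithin, ⟨fun x => (x, 0), ?_, ?_,
      fun p hp => hp.1, fun x hx => ⟨hx, hI _⟩, fun p hp => ?_, fun x hx => rfl⟩, fun x hx => rfl⟩
    · exact isPLOn_iff.2 fun p hp => (PolyAt.prod (hW _ hp.1)
        ((isPolytope_Icc_pi (by intro i; exact i.elim0)).polyAt _)).fst
    · exact isPLOn_iff.2 fun x hx => (hW x hx).prodMk (PLAt.const 0 (hW x hx))
    · exact Prod.ext rfl (Subsingleton.elim _ _)
  | succ k ih =>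
    intro W D hD hZ h
    have hWp : ∀ x ∈ W, PolyAt W x := fun x hx => (isPLOn_iff.1 hD x hx).polyAt
    have hDc : ∀ x ∈ W, PLAt (fun w => D w 0) W x := fun x hx =>
      (isPLOn_iff.1 hD x hx).linear_comp (LinearMap.proj 0)
    set B := {w ∈ W | D w 0 = 0} with hB
    have hBp : ∀ x ∈ B, PolyAt B x := fun x hx =>
      PolyAt.preimage (T := {0}) (hDc x hx.1) (PolyAt.singleton _ _)
    have hZe : {w ∈ W | D w = 0} = {w ∈ B | Fin.tail (D w) = 0} := by
      ext w
      simp only [hB, Set.mem_ofPred_eq, and_assoc]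
      refine and_congr_right fun _ => ⟨fun h => by rw [h]; exact ⟨rfl, rfl⟩, fun h => ?_⟩
      rw [← Fin.cons_self_tail (D w), h.1, h.2]
      exact Fin.cons_self_tail (0 : Fin (k + 1) → ℝ)
    have hDB : IsPLOn (fun w => Fin.tail (D w)) B := isPLOn_iff.2 fun x hx =>
      plAt_tail ((isPLOn_iff.1 hD x hx.1).mono (hBp x hx)
        (Filter.mem_of_superset self_mem_nhdsWithin fun w hw => hw.1))
    have hZ0 : ∀ z ∈ B, Fin.tail (D z) = 0 → z ∈ W ∧ D z = 0 := fun z hz hz' => by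
      have : z ∈ {w ∈ W | D w = 0} := hZe ▸ ⟨hz, hz'⟩
      exact this
    obtain ⟨T', Φ', hT'B, hT'n, hΦ', hΦ'0⟩ := ih hDB (hZe ▸ hZ) fun z hz hz' =>
      (h z (hZ0 z hz hz').1 (hZ0 z hz hz').2).tail hD (hZ0 z hz hz').2
    rw [← hZe] at hT'n hΦ' hΦ'0
    set Z := {w ∈ W | D w = 0} with hZdef
    have hZB : Z ⊆ B := fun z hz => ⟨hz.1, by rw [hz.2]; rfl⟩
    have hcol : ∀ σ : ℝ, σ * σ = 1 → CollaredNear {w ∈ W | 0 ≤ σ * D w 0} B Z := by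
      intro σ hσ
      refine collaredNear_of_isCompact (isPLOn_iff.2 fun x hx => ?_) hZ hZB fun z hz =>
        collaredNear_of_hasProductGerm hY hz.2 (h z hz.1 hz.2) hσ
      exact PolyAt.preimage (T := Set.Ici 0) ((hDc x hx.1).const_smul σ) (PolyAt.Ici _ _)
    obtain ⟨C₁, κ₁, ε₁, h₁, hn₁⟩ := hcol 1 (by norm_num)
    obtain ⟨C₂, κ₂, ε₂, h₂, hn₂⟩ := hcol (-1) (by norm_num)
    obtain ⟨O₁, hO₁, hZO₁, hOn₁⟩ := exists_isOpen_of_collar hn₁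
    obtain ⟨O₂, hO₂, hZO₂, hOn₂⟩ := exists_isOpen_of_collar hn₂
    have hΦ'pl : IsPLOn Φ' (Z ×ˢ Set.Icc (-1) 1) := by
      obtain ⟨g, hg, -⟩ := hΦ'
      exact hg
    have hΦ'm : Set.MapsTo Φ' (Z ×ˢ Set.Icc (-1) 1) B := by
      obtain ⟨g, -, -, hg, -⟩ := hΦ'
      exact fun p hp => hT'B (hg hp)
    have h0I : (0 : Fin k → ℝ) ∈ Set.Icc (-1 : Fin k → ℝ) 1 :=
      ⟨fun i => by simp, fun i => by simp⟩
    -- The inductive bundle may leave the bases of the collars, so its fibers are first shrunk by a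
    -- factor `δ`.
    have hev := eventually_forall_mem_of_isCompact hZ h0I hΦ'pl.continuousOn (hO₁.inter hO₂)
      fun x hx => by rw [hΦ'0 x hx]; exact ⟨hZO₁ hx, hZO₂ hx⟩
    obtain ⟨δ₀, hδ₀, hδ₀'⟩ := exists_Icc_subset hev
    set δ := min δ₀ 1 with hδ
    have hδ0 : 0 < δ := lt_min hδ₀ one_pos
    set ε := min ε₁ ε₂ with hε
    have hε0 : 0 < ε := lt_min h₁.pos h₂.pos
    have hεε₁ : ε ≤ ε₁ := min_le_left _ _
    have hεε₂ : ε ≤ ε₂ := min_le_right _ _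
    -- the rescaled trivialization lands in the bases of both collars
    have hsc : ∀ d ∈ Set.Icc (-1 : Fin k → ℝ) 1, ∀ i, -δ ≤ (δ • d) i ∧ (δ • d) i ≤ δ := by
      intro d hd i
      have h1 : -1 ≤ d i := hd.1 i
      have h2 : d i ≤ 1 := hd.2 i
      rw [Pi.smul_apply, smul_eq_mul]
      constructor <;> nlinarith
    have hsI : ∀ d ∈ Set.Icc (-1 : Fin k → ℝ) 1, δ • d ∈ Set.Icc (-1 : Fin k → ℝ) 1 := by
      intro d hd
      have h1 : δ ≤ 1 := min_le_right _ _
      refine ⟨fun i => ?_, fun i => (hsc d hd i).2.trans h1⟩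
      have := (hsc d hd i).1
      simp only [Pi.neg_apply, Pi.one_apply]
      linarith
    have hsO : ∀ z ∈ Z, ∀ d ∈ Set.Icc (-1 : Fin k → ℝ) 1, Φ' (z, δ • d) ∈ C₁ ∧
        Φ' (z, δ • d) ∈ C₂ := by
      intro z hz d hd
      have h1 : δ ≤ δ₀ := min_le_left _ _
      have h2 : δ • d ∈ Set.Icc (fun _ => -δ₀) (fun _ => δ₀) :=
        ⟨fun i => by have := (hsc d hd i).1; simp only; linarith,
          fun i => (hsc d hd i).2.trans h1⟩
      have h3 := hδ₀' h2 z hz (hsI d hd)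
      have h4 := hΦ'm (show (z, δ • d) ∈ Z ×ˢ Set.Icc (-1) 1 from ⟨hz, hsI d hd⟩)
      exact ⟨mem_of_mem_nhdsWithin h4 (hOn₁ _ h3.1).1, mem_of_mem_nhdsWithin h4 (hOn₂ _ h3.2).1⟩
    have htl : ∀ d ∈ Set.Icc (-1 : Fin (k + 1) → ℝ) 1, Fin.tail d ∈ Set.Icc (-1 : Fin k → ℝ) 1 :=
      fun d hd => ⟨fun i => hd.1 i.succ, fun i => hd.2 i.succ⟩
    -- The first fiber coordinate is the height in one of the two collars, according to its sign,
    -- scaled by the common width `ε`; the others move inside `B`.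
    set Φ : E × (Fin (k + 1) → ℝ) → E := fun p => if 0 ≤ p.2 0
      then κ₁ (Φ' (p.1, δ • Fin.tail p.2), ε * p.2 0)
      else κ₂ (Φ' (p.1, δ • Fin.tail p.2), ε * -p.2 0) with hΦ
    have hΦ₁ : ∀ p, 0 ≤ p.2 0 → Φ p = κ₁ (Φ' (p.1, δ • Fin.tail p.2), ε * p.2 0) := fun p hp =>
      if_pos hp
    set S := Z ×ˢ Set.Icc (-1 : Fin (k + 1) → ℝ) 1 with hS
    have hΦ₂ : ∀ p ∈ S, p.2 0 ≤ 0 →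
        Φ p = κ₂ (Φ' (p.1, δ • Fin.tail p.2), ε * -p.2 0) := fun p hpS hp => by
      rcases hp.eq_or_lt with h0 | h0
      · have := hsO p.1 hpS.1 _ (htl _ hpS.2)
        rw [hΦ₁ p h0.ge, h0, neg_zero, mul_zero, h₁.zero _ this.1, h₂.zero _ this.2]
      · exact if_neg (not_le.2 h0)
    have hm₁ : ∀ p ∈ S, 0 ≤ p.2 0 →
        (Φ' (p.1, δ • Fin.tail p.2), ε * p.2 0) ∈ C₁ ×ˢ Set.Icc 0 ε₁ := fun p hp h0 => by
      have h1 : p.2 0 ≤ 1 := hp.2.2 0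
      exact ⟨(hsO p.1 hp.1 _ (htl _ hp.2)).1, mul_nonneg hε0.le h0, by simp only; nlinarith⟩
    have hm₂ : ∀ p ∈ S, p.2 0 ≤ 0 →
        (Φ' (p.1, δ • Fin.tail p.2), ε * -p.2 0) ∈ C₂ ×ˢ Set.Icc 0 ε₂ := fun p hp h0 => by
      have h1 : -1 ≤ p.2 0 := hp.2.1 0
      exact ⟨(hsO p.1 hp.1 _ (htl _ hp.2)).2, mul_nonneg hε0.le (neg_nonneg.2 h0), by
        simp only; nlinarith⟩
    have hIp : ∀ {n : ℕ} (x : Fin n → ℝ), PolyAt (Set.Icc (-1 : Fin n → ℝ) 1) x := fun x =>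
      (isPolytope_Icc_pi (by intro i; norm_num)).polyAt x
    have hZp : ∀ z ∈ Z, PolyAt Z z := fun z hz => PolyAt.preimage (T := {0})
      (isPLOn_iff.1 hD z hz.1) (PolyAt.singleton _ _)
    have hSp : ∀ p ∈ S, PolyAt S p := fun p hp => PolyAt.prod (hZp _ hp.1) (hIp _)
    have hSc : IsCompact S := hZ.prod isCompact_Icc
    have hΦ's : ∀ p ∈ S, PLAt (fun p : E × (Fin (k + 1) → ℝ) => Φ' (p.1, δ • Fin.tail p.2)) S p :=
      fun p hp => PLAt.comp (f := fun p : E × (Fin (k + 1) → ℝ) => (p.1, δ • Fin.tail p.2))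
        (isPLOn_iff.1 hΦ'pl _ ⟨hp.1, hsI _ (htl _ hp.2)⟩)
        ((hSp p hp).fst.prodMk ((plAt_tail (hSp p hp).snd).const_smul δ))
        (Filter.mem_of_superset self_mem_nhdsWithin fun q hq => ⟨hq.1, hsI _ (htl _ hq.2)⟩)
    have hproj : ∀ p ∈ S, PLAt (fun p : E × (Fin (k + 1) → ℝ) => p.2 0) S p := fun p hp =>
      (hSp p hp).snd.linear_comp (LinearMap.proj 0)
    have hprojc : Continuous fun p : E × (Fin (k + 1) → ℝ) => p.2 0 :=
      (continuous_apply 0).comp continuous_snd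
    have hΦpl : IsPLOn Φ S := by
      set S₁ := S ∩ (fun p : E × (Fin (k + 1) → ℝ) => p.2 0) ⁻¹' Set.Ici 0 with hS₁
      set S₂ := S ∩ (fun p : E × (Fin (k + 1) → ℝ) => p.2 0) ⁻¹' Set.Iic 0 with hS₂
      have e : S = S₁ ∪ S₂ := by
        rw [hS₁, hS₂, ← Set.inter_union_distrib_left, ← Set.preimage_union, Set.union_comm,
          Set.Iic_union_Ici, Set.preimage_univ, Set.inter_univ]
      rw [e]
      refine isPLOn_union ?_ ?_ (hSc.isClosed.inter (isClosed_Ici.preimage hprojc))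
        (hSc.isClosed.inter (isClosed_Iic.preimage hprojc))
      · refine isPLOn_congr (isPLOn_iff.2 fun p hp => ?_) fun p hp => hΦ₁ p hp.2
        have hp' : PolyAt S₁ p := PolyAt.preimage (hproj p hp.1) (PolyAt.Ici _ _)
        refine PLAt.comp (f := fun p : E × (Fin (k + 1) → ℝ) =>
          (Φ' (p.1, δ • Fin.tail p.2), ε * p.2 0)) (isPLOn_iff.1 h₁.isPLOn _ (hm₁ p hp.1 hp.2))
          (PLAt.mono (S := S) ((hΦ's p hp.1).prodMk ((hproj p hp.1).const_smul ε)) hp' ?_) ?_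
        · exact Filter.mem_of_superset self_mem_nhdsWithin fun q hq => hq.1
        · exact Filter.mem_of_superset self_mem_nhdsWithin fun q hq => hm₁ q hq.1 hq.2
      · refine isPLOn_congr (isPLOn_iff.2 fun p hp => ?_) fun p hp => hΦ₂ p hp.1 hp.2
        have hp' : PolyAt S₂ p := PolyAt.preimage (hproj p hp.1) (PolyAt.Iic _ _)
        refine PLAt.comp (f := fun p : E × (Fin (k + 1) → ℝ) =>
          (Φ' (p.1, δ • Fin.tail p.2), ε * -p.2 0)) (isPLOn_iff.1 h₂.isPLOn _ (hm₂ p hp.1 hp.2))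
          (PLAt.mono (S := S) ((hΦ's p hp.1).prodMk ((hproj p hp.1).neg.const_smul ε)) hp' ?_) ?_
        · exact Filter.mem_of_superset self_mem_nhdsWithin fun q hq => hq.1
        · exact Filter.mem_of_superset self_mem_nhdsWithin fun q hq => hm₂ q hq.1 hq.2
    -- the first coordinate is recovered from the side of the image
    have hside : ∀ p ∈ S, ∀ q ∈ S, 0 ≤ p.2 0 → q.2 0 ≤ 0 → Φ p = Φ q → p.2 0 = 0 ∧ q.2 0 = 0 := by
      intro p hp q hq hp0 hq0 heq
      rw [hΦ₁ p hp0, hΦ₂ q hq hq0] at heq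
      have h3 := h₁.mapsTo (hm₁ p hp hp0)
      have h4 := h₂.mapsTo (hm₂ q hq hq0)
      have h5 : D (κ₁ (Φ' (p.1, δ • Fin.tail p.2), ε * p.2 0)) 0 = 0 := by
        have h6 := h3.2
        have h7 := h4.2
        rw [← heq] at h7
        linarith
      have h8 := h₁.eq_zero _ (hm₁ p hp hp0).1 _ (hm₁ p hp hp0).2 ⟨h3.1, h5⟩
      have h9 := h₂.eq_zero _ (hm₂ q hq hq0).1 _ (hm₂ q hq hq0).2 (heq ▸ ⟨h3.1, h5⟩)
      refine ⟨(mul_eq_zero.1 h8).resolve_left hε0.ne', ?_⟩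
      have := (mul_eq_zero.1 h9).resolve_left hε0.ne'
      simpa using this
    have hbase : ∀ p ∈ S, ∀ q ∈ S, Φ' (p.1, δ • Fin.tail p.2) = Φ' (q.1, δ • Fin.tail q.2) →
        p.2 0 = q.2 0 → p = q := by
      intro p hp q hq h3 h4
      have h5 := hΦ'.injOn (show (p.1, δ • Fin.tail p.2) ∈ Z ×ˢ Set.Icc (-1) 1 from
        ⟨hp.1, hsI _ (htl _ hp.2)⟩) (show (q.1, δ • Fin.tail q.2) ∈ Z ×ˢ Set.Icc (-1) 1 from
        ⟨hq.1, hsI _ (htl _ hq.2)⟩) h3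
      rw [Prod.mk.injEq] at h5
      have h6 := smul_right_injective _ hδ0.ne' h5.2
      refine Prod.ext h5.1 ?_
      rw [← Fin.cons_self_tail p.2, ← Fin.cons_self_tail q.2, h4]
      exact congrArg _ h6
    have hmixed : ∀ p ∈ S, ∀ q ∈ S, 0 ≤ p.2 0 → q.2 0 ≤ 0 → Φ p = Φ q → p = q := by
      intro p hp q hq hp0 hq0 heq
      obtain ⟨h3, h4⟩ := hside p hp q hq hp0 hq0 heq
      rw [hΦ₁ p hp0, hΦ₁ q h4.ge, h3, h4, mul_zero, h₁.zero _ (hm₁ p hp hp0).1,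
        h₁.zero _ (hm₁ q hq h4.ge).1] at heq
      exact hbase p hp q hq heq (h3.trans h4.symm)
    have hinj : Set.InjOn Φ S := by
      intro p hp q hq heq
      rcases le_total 0 (p.2 0) with hp0 | hp0 <;> rcases le_total 0 (q.2 0) with hq0 | hq0
      · rw [hΦ₁ p hp0, hΦ₁ q hq0] at heq
        have h3 := h₁.injOn (hm₁ p hp hp0) (hm₁ q hq hq0) heq
        rw [Prod.mk.injEq] at h3
        exact hbase p hp q hq h3.1 (mul_left_cancel₀ hε0.ne' h3.2)
      · exact hmixed p hp q hq hp0 hq0 heq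
      · exact (hmixed q hq p hp hq0 hp0 heq.symm).symm
      · rw [hΦ₂ p hp hp0, hΦ₂ q hq hq0] at heq
        have h3 := h₂.injOn (hm₂ p hp hp0) (hm₂ q hq hq0) heq
        rw [Prod.mk.injEq] at h3
        exact hbase p hp q hq h3.1 (neg_injective (mul_left_cancel₀ hε0.ne' h3.2))
    refine ⟨Φ '' S, Φ, ?_, ?_, isPLHomeoOn_of_injOn hΦpl hSc hinj, ?_⟩
    · rintro _ ⟨p, hp, rfl⟩
      rcases le_total 0 (p.2 0) with hp0 | hp0
      · rw [hΦ₁ p hp0]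
        exact (h₁.mapsTo (hm₁ p hp hp0)).1
      · rw [hΦ₂ p hp hp0]
        exact (h₂.mapsTo (hm₂ p hp hp0)).1
    · intro z hz
      -- The shrunken bundle is still a neighbourhood of `Z` in `B`, so each collar restricted to it
      -- gives a neighbourhood in its half of `W`.
      set T'' := Φ' '' ((Z ×ˢ Set.Icc (-1) 1) ∩ {p | p.2 ∈ Set.Icc (fun _ => -δ) fun _ => δ})
        with hT''
      have hT''n : T'' ∈ 𝓝[B] z := by
        have h3 := hΦ'.image_mem_nhdsWithin (x := (z, 0)) ⟨hz, h0I⟩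
          (N := {p | p.2 ∈ Set.Icc (fun _ => -δ) fun _ => δ})
          (mem_nhdsWithin_of_mem_nhds (continuous_snd.continuousAt.preimage_mem_nhds
            (Icc_mem_nhds_zero hδ0)))
        rw [hΦ'0 z hz] at h3
        exact nhdsWithin_le_of_mem (hT'n z hz) h3
      have hT''e : ∀ x ∈ T'', ∃ y ∈ Z, ∃ d ∈ Set.Icc (-1 : Fin k → ℝ) 1, Φ' (y, δ • d) = x := by
        rintro _ ⟨⟨y, d⟩, ⟨hy, hd⟩, rfl⟩
        refine ⟨y, hy.1, δ⁻¹ • d, ⟨fun i => ?_, fun i => ?_⟩, ?_⟩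
        · have h3 : -δ ≤ d i := hd.1 i
          simp only [Pi.neg_apply, Pi.one_apply, Pi.smul_apply, smul_eq_mul]
          rw [← div_eq_inv_mul, le_div_iff₀ hδ0]
          linarith
        · have h3 : d i ≤ δ := hd.2 i
          simp only [Pi.one_apply, Pi.smul_apply, smul_eq_mul]
          rw [← div_eq_inv_mul, div_le_iff₀ hδ0]
          linarith
        · rw [smul_inv_smul₀ hδ0.ne']
      have hN : ∀ {C' : Set E} {ε' : ℝ}, C' ⊆ B → {p : E × ℝ | p.1 ∈ T'' ∧ p.2 < ε} ∈
          𝓝[C' ×ˢ Set.Icc 0 ε'] (z, (0 : ℝ)) := by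
        intro C' ε' hC'
        refine Filter.inter_mem ?_ (mem_nhdsWithin_of_mem_nhds
          ((isOpen_lt continuous_snd continuous_const).mem_nhds hε0))
        have ht : Filter.Tendsto Prod.fst (𝓝[C' ×ˢ Set.Icc 0 ε'] (z, (0 : ℝ))) (𝓝[B] z) :=
          tendsto_nhdsWithin_of_tendsto_nhds_of_eventually_within _
            continuous_fst.continuousWithinAt (Filter.mem_of_superset self_mem_nhdsWithin
              fun p hp => hC' hp.1)
        exact ht hT''n
      have hI₁ := h₁.image_mem (mem_of_mem_nhdsWithin (hZB hz) (hn₁ z hz).1) (hn₁ z hz).2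
        (hN h₁.subset)
      have hI₂ := h₂.image_mem (mem_of_mem_nhdsWithin (hZB hz) (hn₂ z hz).1) (hn₂ z hz).2
        (hN h₂.subset)
      have hWe : W = {w ∈ W | 0 ≤ 1 * D w 0} ∪ {w ∈ W | 0 ≤ -1 * D w 0} := by
        ext w
        simp only [Set.mem_union, Set.mem_ofPred_eq, ← and_or_left]
        refine (and_iff_left ?_).symm
        rcases le_total 0 (D w 0) with h | h
        · exact Or.inl (by linarith)
        · exact Or.inr (by linarith)
      have key : ∀ t : ℝ, -ε < t → t < ε → ∀ d ∈ Set.Icc (-1 : Fin k → ℝ) 1,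
          (Fin.cons (ε⁻¹ * t) d : Fin (k + 1) → ℝ) ∈ Set.Icc (-1 : Fin (k + 1) → ℝ) 1 := by
        intro t ht ht' d hd
        refine ⟨fun i => ?_, fun i => ?_⟩
        · refine Fin.cases ?_ (fun j => ?_) i
          · simp only [Pi.neg_apply, Pi.one_apply, Fin.cons_zero]
            rw [← div_eq_inv_mul, le_div_iff₀ hε0]
            linarith
          · simpa using hd.1 j
        · refine Fin.cases ?_ (fun j => ?_) i
          · simp only [Pi.one_apply, Fin.cons_zero]
            rw [← div_eq_inv_mul, div_le_iff₀ hε0]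
            linarith
          · simpa using hd.2 j
      have hinv : ∀ t : ℝ, ε * (ε⁻¹ * t) = t := fun t => mul_inv_cancel_left₀ hε0.ne' t
      rw [hWe, nhdsWithin_union]
      refine Filter.mem_sup.2 ⟨Filter.mem_of_superset hI₁ ?_, Filter.mem_of_superset hI₂ ?_⟩
      · rintro _ ⟨⟨x, t⟩, ⟨hxt, hx, ht⟩, rfl⟩
        obtain ⟨y, hy, d, hd, rfl⟩ := hT''e x hx
        have ht0 : 0 ≤ t := hxt.2.1
        refine ⟨(y, Fin.cons (ε⁻¹ * t) d), ⟨hy, key t (by linarith) ht d hd⟩, ?_⟩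
        rw [hΦ₁ _ (by simpa using mul_nonneg (inv_nonneg.2 hε0.le) ht0)]
        simp only [Fin.cons_zero, Fin.tail_cons, hinv]
      · rintro _ ⟨⟨x, t⟩, ⟨hxt, hx, ht⟩, rfl⟩
        obtain ⟨y, hy, d, hd, rfl⟩ := hT''e x hx
        have ht0 : 0 ≤ t := hxt.2.1
        have ht' : t < ε := ht
        have hp : (y, Fin.cons (ε⁻¹ * -t) d) ∈ S := ⟨hy, key (-t) (by linarith) (by linarith) d hd⟩
        refine ⟨_, hp, ?_⟩
        have hneg : ε⁻¹ * -t ≤ 0 := by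
          have := mul_nonneg (inv_nonneg.2 hε0.le) ht0
          linarith
        rw [hΦ₂ _ hp (by simpa using hneg)]
        simp only [Fin.cons_zero, Fin.tail_cons, mul_neg, hinv, neg_neg]
    · intro z hz
      have h3 : Fin.tail (0 : Fin (k + 1) → ℝ) = 0 := rfl
      rw [hΦ₁ _ le_rfl]
      simp only [h3, smul_zero, Pi.zero_apply, mul_zero]
      have h4 := hsO z hz 0 h0I
      rw [smul_zero] at h4
      rw [h₁.zero _ h4.1, hΦ'0 z hz]

end NormalBundle

/-! ### Barycentric coordinates and their linear parts. -/

section Coordinates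

variable {k : ℕ} (b : AffineBasis (Fin (k + 1)) ℝ (EuclideanSpace ℝ (Fin k)))

/-- The linear part of a barycentric coordinate. -/
noncomputable def dcoord (i : Fin (k + 1)) : EuclideanSpace ℝ (Fin k) →ₗ[ℝ] ℝ := (b.coord i).linear

theorem coord_add (i : Fin (k + 1)) (u a : EuclideanSpace ℝ (Fin k)) :
    b.coord i (u + a) = b.coord i u + dcoord b i a := by
  have := (b.coord i).map_vadd u a
  rw [vadd_eq_add, vadd_eq_add] at this
  rw [add_comm u a, this, add_comm]
  rfl

theorem dcoord_sub (i : Fin (k + 1)) (u v : EuclideanSpace ℝ (Fin k)) :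
    dcoord b i (u - v) = b.coord i u - b.coord i v := by
  have := coord_add b i v (u - v)
  rw [add_sub_cancel] at this
  linarith

theorem sum_dcoord (a : EuclideanSpace ℝ (Fin k)) : ∑ i, dcoord b i a = 0 := by
  have h := b.sum_coord_apply_eq_one (0 + a)
  simp only [coord_add, Finset.sum_add_distrib, b.sum_coord_apply_eq_one] at h
  linarith

theorem sum_coord_smul (u : EuclideanSpace ℝ (Fin k)) : ∑ i, b.coord i u • b i = u :=
  b.linear_combination_coord_eq_self u

theorem sum_dcoord_smul (a : EuclideanSpace ℝ (Fin k)) : ∑ i, dcoord b i a • b i = a := by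
  have h := sum_coord_smul b (0 + a)
  simp only [coord_add, add_smul, Finset.sum_add_distrib] at h
  rw [sum_coord_smul, zero_add, zero_add] at h
  exact h

theorem coord_sum_smul {w : Fin (k + 1) → ℝ} (hw : ∑ i, w i = 1) (i : Fin (k + 1)) :
    b.coord i (∑ j, w j • b j) = w i := by
  have := b.coord_apply_combination_of_mem (Finset.mem_univ i) hw
  rwa [Finset.univ.affineCombination_eq_linear_combination _ _ hw] at this

theorem dcoord_sum_smul {w : Fin (k + 1) → ℝ} (hw : ∑ i, w i = 0) (i : Fin (k + 1)) :
    dcoord b i (∑ j, w j • b j) = w i := by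
  have h1 : ∑ j, ((if j = i then 1 else 0) + w j) = 1 := by
    rw [Finset.sum_add_distrib, hw, Finset.sum_ite_eq' Finset.univ i]
    simp
  have h := coord_sum_smul b h1 i
  simp only [add_smul, Finset.sum_add_distrib, ite_smul, one_smul, zero_smul, Finset.sum_ite_eq',
    Finset.mem_univ, if_true] at h
  rw [coord_add, b.coord_apply_eq] at h
  linarith

theorem mem_face_iff {s : Finset (Fin (k + 1))} {u : EuclideanSpace ℝ (Fin k)} :
    u ∈ face b s ↔ (∀ i, 0 ≤ b.coord i u) ∧ ∀ i ∉ s, b.coord i u = 0 := by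
  constructor
  · intro h
    have hc : Convex ℝ {u : EuclideanSpace ℝ (Fin k) |
        (∀ i, 0 ≤ b.coord i u) ∧ ∀ i ∉ s, b.coord i u = 0} := by
      rw [Set.ofPred_and, Set.ofPred_forall, Set.ofPred_forall]
      refine (convex_iInter fun i => ?_).inter (convex_iInter fun i => ?_)
      · exact (convex_Ici (0 : ℝ)).affine_preimage (b.coord i)
      · by_cases hi : i ∈ s
        · simp [hi, convex_univ]
        · simp only [hi, not_false_eq_true, forall_true_left]
          exact (convex_singleton (0 : ℝ)).affine_preimage (b.coord i)
    refine convexHull_min ?_ hc h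
    rintro _ ⟨j, hj, rfl⟩
    refine ⟨fun i => ?_, fun i hi => ?_⟩
    · rcases eq_or_ne i j with h | h
      · rw [h, b.coord_apply_eq]; exact zero_le_one
      · rw [b.coord_apply_ne h]
    · exact b.coord_apply_ne fun h => hi (h ▸ hj)
  · rintro ⟨h0, h1⟩
    have hsum : ∀ {M : Type} [AddCommMonoid M] (g : Fin (k + 1) → M), (∀ i ∉ s, g i = 0) →
        ∑ i ∈ s, g i = ∑ i, g i := fun g hg =>
      Finset.sum_subset (Finset.subset_univ s) fun i _ hi => hg i hi
    rw [← sum_coord_smul b u, ← hsum _ fun i hi => by rw [h1 i hi, zero_smul]]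
    refine (convex_convexHull ℝ _).sum_mem (fun i _ => h0 i) ?_ fun i hi =>
      subset_convexHull ℝ _ ⟨i, hi, rfl⟩
    rw [hsum _ h1, b.sum_coord_apply_eq_one]

theorem mem_simplex_iff {u : EuclideanSpace ℝ (Fin k)} :
    u ∈ simplex b ↔ ∀ i, 0 ≤ b.coord i u := by
  rw [simplex, mem_face_iff]
  simp

/-- The direction of the affine span of a face. -/
noncomputable def faceDir (s : Finset (Fin (k + 1))) : Submodule ℝ (EuclideanSpace ℝ (Fin k)) :=
  ⨅ i ∈ sᶜ, LinearMap.ker (dcoord b i)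

theorem mem_faceDir {s : Finset (Fin (k + 1))} {a : EuclideanSpace ℝ (Fin k)} :
    a ∈ faceDir b s ↔ ∀ i ∉ s, dcoord b i a = 0 := by
  simp [faceDir]

end Coordinates

/-! ### Points of a complex as combinations along chains of simplices. -/

section Chains

set_option linter.unusedSectionVars false

variable {E : Type*} [NormedAddCommGroup E] [NormedSpace ℝ E]

/-- The barycenter of a simplex. -/
noncomputable def bary (σ : Finset E) : E := (σ.card : ℝ)⁻¹ • ∑ v ∈ σ, v

-- Peel off the smallest coordinate: subtracting it from all vertices of `σ` splits off a multiple
-- of the barycenter of `σ` and leaves a combination of fewer vertices. The simplices produced in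
-- this way form a chain.
open Classical in
theorem exists_chain_combination (σ : Finset E) : ∀ c : E → ℝ, (∀ v ∈ σ, 0 ≤ c v) →
    ∃ (C : Finset (Finset E)) (w : Finset E → ℝ), (∀ τ ∈ C, τ ⊆ σ ∧ τ.Nonempty) ∧
      IsChain (· ⊆ ·) (C : Set (Finset E)) ∧ (∀ τ ∈ C, 0 ≤ w τ) ∧
      ∑ τ ∈ C, w τ = ∑ v ∈ σ, c v ∧ ∑ τ ∈ C, w τ • bary τ = ∑ v ∈ σ, c v • v := by
  induction σ using Finset.strongInduction with
  | H σ ih =>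
    intro c hc
    rcases σ.eq_empty_or_nonempty with rfl | hne
    · exact ⟨∅, 0, by simp, by simp, by simp, by simp, by simp⟩
    obtain ⟨v₀, hv₀, hmin⟩ := Finset.exists_min_image σ c hne
    obtain ⟨C, w, hC, hch, hw, h1, h2⟩ := ih (σ.erase v₀) (Finset.erase_ssubset hv₀)
      (fun v => c v - c v₀) fun v hv => sub_nonneg.2 (hmin v (Finset.mem_of_mem_erase hv))
    have hσC : σ ∉ C := fun h => Finset.notMem_erase v₀ σ ((hC σ h).1 hv₀)
    have hcard : (σ.card : ℝ) ≠ 0 := Nat.cast_ne_zero.2 (Finset.card_ne_zero.2 hne)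
    -- The factor `σ.card` compensates the averaging in the barycenter.
    obtain ⟨u, huσ, hu⟩ : ∃ u : Finset E → ℝ, u σ = σ.card * c v₀ ∧ ∀ τ ∈ C, u τ = w τ :=
      ⟨fun τ => if τ = σ then σ.card * c v₀ else w τ, if_pos rfl, fun τ hτ =>
        if_neg (ne_of_mem_of_not_mem hτ hσC)⟩
    refine ⟨insert σ C, u, ?_, ?_, ?_, ?_, ?_⟩
    · intro τ hτ
      rcases Finset.mem_insert.1 hτ with rfl | h
      · exact ⟨subset_rfl, hne⟩
      · exact ⟨(hC τ h).1.trans (Finset.erase_subset _ _), (hC τ h).2⟩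
    · rw [Finset.coe_insert]
      exact hch.insert fun τ hτ _ => Or.inr ((hC τ hτ).1.trans (Finset.erase_subset _ _))
    · intro τ hτ
      rcases Finset.mem_insert.1 hτ with rfl | h
      · rw [huσ]
        exact mul_nonneg (Nat.cast_nonneg _) (hc v₀ hv₀)
      · rw [hu τ h]
        exact hw τ h
    · rw [Finset.sum_insert hσC, huσ, Finset.sum_congr rfl hu, h1,
        Finset.sum_erase σ (f := fun v => c v - c v₀) (sub_self _),
        Finset.sum_sub_distrib, Finset.sum_const, nsmul_eq_mul]
      ring
    · rw [Finset.sum_insert hσC, huσ, Finset.sum_congr rfl fun τ hτ => by rw [hu τ hτ], h2,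
        Finset.sum_erase σ (f := fun v => (c v - c v₀) • v) (by rw [sub_self, zero_smul])]
      simp only [sub_smul]
      rw [Finset.sum_sub_distrib, bary, smul_smul, mul_right_comm, mul_inv_cancel₀ hcard, one_mul,
        ← Finset.smul_sum]
      abel

theorem exists_isFlagCombination {K : Geometry.SimplicialComplex ℝ E} {s : E} (hs : s ∈ K.space) :
    ∃ C w, IsFlagCombination K s C w := by
  obtain ⟨σ, hσ, hsσ⟩ := K.mem_space_iff.1 hs
  obtain ⟨c, hc, hc1, hcs⟩ := Finset.mem_convexHull'.1 hsσ
  obtain ⟨C, w, hC, hch, hw, h1, h2⟩ := exists_chain_combination σ c hc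
  exact ⟨C, w, fun τ hτ => K.down_closed hσ (hC τ hτ).1 (hC τ hτ).2, hch, hw, h1.trans hc1,
    h2.trans hcs⟩

theorem IsFlagCombination.mem_space {K : Geometry.SimplicialComplex ℝ E} {s : E}
    {C : Finset (Finset E)} {w : Finset E → ℝ} (h : IsFlagCombination K s C w) : s ∈ K.space := by
  classical
  obtain ⟨T, hT, -, h1, h2⟩ := h.exists_top
  refine K.mem_space_iff.2 ⟨T, hT, Finset.mem_convexHull'.2 ⟨_, fun v _ => ?_, h1, h2⟩⟩
  exact Finset.sum_nonneg fun σ hσ => mul_nonneg (h.2.2.1 σ (Finset.mem_filter.1 hσ).1)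
    (by positivity)

open Classical in
/-- The simplices of positive weight in a flag combination are determined by the point. -/
theorem IsFlagCombination.mem_of_pos {K : Geometry.SimplicialComplex ℝ E} {s : E}
    {C D : Finset (Finset E)} {w u : Finset E → ℝ} (h : IsFlagCombination K s C w)
    (h' : IsFlagCombination K s D u) {σ : Finset E} (hσ : σ ∈ C) (hwσ : 0 < w σ) :
    σ ∈ D ∧ 0 < u σ := by
  have nn : ∀ {C : Finset (Finset E)} {w : Finset E → ℝ}, IsFlagCombination K s C w →
      ∀ τ ∈ C, 0 ≤ w τ * (τ.card : ℝ)⁻¹ := fun h τ hτ =>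
    mul_nonneg (h.2.2.1 τ hτ) (by positivity)
  have hcoord : ∀ v, ∑ τ ∈ C with v ∈ τ, w τ * (τ.card : ℝ)⁻¹ =
      ∑ τ ∈ D with v ∈ τ, u τ * (τ.card : ℝ)⁻¹ := by
    obtain ⟨S, hS, hS0, hS1, hSs⟩ := h.exists_top
    obtain ⟨T, hT, hT0, hT1, hTs⟩ := h'.exists_top
    have := barycentric_unique K hS hT
      (fun v => Finset.sum_nonneg fun τ hτ => nn h τ (Finset.mem_filter.1 hτ).1)
      (fun v => Finset.sum_nonneg fun τ hτ => nn h' τ (Finset.mem_filter.1 hτ).1)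
      hS0 hT0 hS1 hT1 (hSs.trans hTs.symm)
    exact fun v => congrFun this v
  have htail : ∀ j : ℕ, ∑ τ ∈ C with j < τ.card, w τ * (τ.card : ℝ)⁻¹ =
      ∑ τ ∈ D with j < τ.card, u τ * (τ.card : ℝ)⁻¹ := fun j =>
    le_antisymm (chain_tail_le h.2.1 h'.2.1 (nn h) (nn h') hcoord j)
      (chain_tail_le h'.2.1 h.2.1 (nn h') (nn h) (fun v => (hcoord v).symm) j)
  have hpos : ∀ {C : Finset (Finset E)} {w : Finset E → ℝ}, IsFlagCombination K s C w →
      ∀ τ ∈ C, 0 < (τ.card : ℝ) := fun h τ hτ =>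
    Nat.cast_pos.2 (Finset.card_pos.2 (K.nonempty_of_mem_faces (h.1 τ hτ)))
  -- membership in a simplex of positive weight, by the tails
  have hmem : ∀ {C : Finset (Finset E)} {w : Finset E → ℝ}, IsFlagCombination K s C w →
      ∀ τ ∈ C, 0 < w τ → ∀ v, v ∈ τ ↔
        ∑ ρ ∈ C with τ.card - 1 < ρ.card, w ρ * (ρ.card : ℝ)⁻¹ ≤
          ∑ ρ ∈ C with v ∈ ρ, w ρ * (ρ.card : ℝ)⁻¹ := by
    intro C w h τ hτ hwτ v
    have hc := Finset.card_pos.2 (K.nonempty_of_mem_faces (h.1 τ hτ))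
    constructor
    · intro hv
      refine Finset.sum_le_sum_of_subset_of_nonneg (fun ρ hρ => ?_)
        fun ρ hρ _ => nn h ρ (Finset.mem_filter.1 hρ).1
      rw [Finset.mem_filter] at hρ ⊢
      refine ⟨hρ.1, ?_⟩
      rcases h.2.1.total hτ hρ.1 with hs | hs
      · exact hs hv
      · exact (Finset.eq_of_subset_of_card_le hs (by omega)) ▸ hv
    · intro hle
      by_contra hv
      refine absurd hle (not_le.2 ?_)
      have hτm : τ ∈ C.filter fun ρ => τ.card - 1 < ρ.card :=
        Finset.mem_filter.2 ⟨hτ, by omega⟩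
      refine Finset.sum_lt_sum_of_subset (fun ρ hρ => ?_) hτm
        (fun hcon => hv (Finset.mem_filter.1 hcon).2)
        (mul_pos hwτ (inv_pos.2 (hpos h τ hτ)))
        fun ρ hρ _ => nn h ρ (Finset.mem_filter.1 hρ).1
      rw [Finset.mem_filter] at hρ ⊢
      refine ⟨hρ.1, ?_⟩
      rcases h.2.1.total hτ hρ.1 with hs | hs
      · have := Finset.card_le_card hs
        omega
      · exact absurd (hs hρ.2) hv
  have hc := Finset.card_pos.2 (K.nonempty_of_mem_faces (h.1 σ hσ))
  -- The tail sums drop at the cardinality of `σ`. They agree for both chains, so the second chain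
  -- has a member of that cardinality and of positive weight.
  obtain ⟨τ, hτD, hτc, hτu⟩ : ∃ τ ∈ D, τ.card = σ.card ∧ 0 < u τ := by
    have hlt : ∑ τ ∈ C with σ.card < τ.card, w τ * (τ.card : ℝ)⁻¹ <
        ∑ τ ∈ C with σ.card - 1 < τ.card, w τ * (τ.card : ℝ)⁻¹ := by
      refine Finset.sum_lt_sum_of_subset (i := σ) (fun ρ hρ => ?_)
        (Finset.mem_filter.2 ⟨hσ, by omega⟩) (fun hcon => ?_)
        (mul_pos hwσ (inv_pos.2 (hpos h σ hσ)))
        fun ρ hρ _ => nn h ρ (Finset.mem_filter.1 hρ).1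
      · rw [Finset.mem_filter] at hρ ⊢
        exact ⟨hρ.1, by omega⟩
      · exact lt_irrefl _ (Finset.mem_filter.1 hcon).2
    rw [htail, htail] at hlt
    by_contra! hcon
    refine absurd hlt (not_lt.2 ?_)
    have hsub : (D.filter fun τ => σ.card < τ.card) ⊆ D.filter fun τ => σ.card - 1 < τ.card := by
      intro ρ hρ
      rw [Finset.mem_filter] at hρ ⊢
      exact ⟨hρ.1, by omega⟩
    rw [← Finset.sum_sdiff hsub]
    have : ∑ τ ∈ (D.filter fun τ => σ.card - 1 < τ.card) \ D.filter fun τ => σ.card < τ.card,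
        u τ * (τ.card : ℝ)⁻¹ ≤ 0 := by
      refine Finset.sum_nonpos fun ρ hρ => ?_
      simp only [Finset.mem_sdiff, Finset.mem_filter, not_and] at hρ
      refine mul_nonpos_of_nonpos_of_nonneg (hcon ρ hρ.1.1 ?_) (by positivity)
      have := hρ.2 hρ.1.1
      omega
    linarith
  have hστ : σ = τ := by
    ext v
    rw [hmem h σ hσ hwσ v, hmem h' τ hτD hτu v, htail, hcoord, hτc]
  exact hστ ▸ ⟨hτD, hτu⟩

theorem isFlagCombination_bary {K : Geometry.SimplicialComplex ℝ E} {σ : Finset E}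
    (hσ : σ ∈ K.faces) : IsFlagCombination K (bary σ) {σ} 1 :=
  ⟨by simpa using hσ, by simp, by simp, by simp, by simp [bary]⟩

/-- A barycenter is a combination along a one-element chain, and simplices of positive weight are
determined by the point. -/
theorem bary_injOn (K : Geometry.SimplicialComplex ℝ E) : Set.InjOn bary K.faces := by
  intro σ hσ τ hτ h
  have h1 := isFlagCombination_bary hσ
  rw [h] at h1
  exact Finset.mem_singleton.1 (h1.mem_of_pos (isFlagCombination_bary hτ)
    (Finset.mem_singleton_self σ) one_pos).1

end Chains

/-! ### The folding map and its freedom along faces. -/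

section Fold

set_option linter.unusedSectionVars false

variable {k : ℕ} (b : AffineBasis (Fin (k + 1)) ℝ (EuclideanSpace ℝ (Fin k)))
  {E : Type*} [NormedAddCommGroup E] [NormedSpace ℝ E] {K : Geometry.SimplicialComplex ℝ E}

open Classical in
theorem mem_convexHull_bary_iff {C : Finset (Finset E)} (hC : ∀ σ ∈ C, σ ∈ K.faces)
    (hch : IsChain (· ⊆ ·) (C : Set (Finset E))) {s : E} :
    s ∈ convexHull ℝ ((C.image bary : Finset E) : Set E) ↔ ∃ w, IsFlagCombination K s C w := by
  have hinj : Set.InjOn bary (C : Set (Finset E)) := (bary_injOn K).mono hC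
  constructor
  · intro h
    obtain ⟨w, hw, h1, h2⟩ := Finset.mem_convexHull'.1 h
    rw [Finset.sum_image hinj] at h1 h2
    exact ⟨fun σ => w (bary σ), hC, hch, fun σ hσ => hw _ (Finset.mem_image_of_mem _ hσ), h1, h2⟩
  · rintro ⟨w, -, -, hw, h1, h2⟩
    rw [← h2]
    exact (convex_convexHull ℝ _).sum_mem hw h1 fun σ hσ =>
      subset_convexHull ℝ _ (Finset.mem_coe.2 (Finset.mem_image_of_mem bary hσ))

/-- The vertex of the model simplex to which the barycenter of a simplex is folded. -/
abbrev foldIndex (k : ℕ) (σ : Finset E) : Fin (k + 1) := Fin.ofNat (k + 1) (σ.card - 1)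

/-- Members of a chain are distinguished by their cardinality, and the dimension bound ensures that
reduction modulo `k + 1` in `Fin.ofNat` changes nothing. -/
theorem foldIndex_injOn (hdim : ∀ σ ∈ K.faces, σ.card ≤ k + 1) {C : Finset (Finset E)}
    (hC : ∀ σ ∈ C, σ ∈ K.faces) (hch : IsChain (· ⊆ ·) (C : Set (Finset E))) :
    Set.InjOn (foldIndex (E := E) k) (C : Set (Finset E)) := by
  intro σ hσ τ hτ h
  have h1 := hdim σ (hC σ hσ)
  have h2 := hdim τ (hC τ hτ)
  have h3 := Finset.card_pos.2 (K.nonempty_of_mem_faces (hC σ hσ))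
  have h4 := Finset.card_pos.2 (K.nonempty_of_mem_faces (hC τ hτ))
  have h5 : (σ.card - 1) % (k + 1) = (τ.card - 1) % (k + 1) := congrArg Fin.val h
  rw [Nat.mod_eq_of_lt (by omega), Nat.mod_eq_of_lt (by omega)] at h5
  rcases hch.total hσ hτ with hs | hs
  · exact Finset.eq_of_subset_of_card_le hs (by omega)
  · exact (Finset.eq_of_subset_of_card_le hs (by omega)).symm

-- The pieces are the simplices of the barycentric subdivision, that is, the hulls of the
-- barycenters of chains; there are finitely many, and the folding map is determined affinely by its
-- vertex values on each.
open Classical in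
theorem isPLOn_foldMap (hfin : K.faces.Finite) : IsPLOn (foldMap b K) K.space := by
  intro x hx
  refine ⟨((hfin.toFinset.powerset).filter
    (fun C : Finset (Finset E) => IsChain (· ⊆ ·) (C : Set (Finset E)))).image
      fun C : Finset (Finset E) => C.image bary, ?_, ?_⟩
  · intro t ht
    obtain ⟨C, hCm, rfl⟩ := Finset.mem_image.1 ht
    obtain ⟨hC', hch⟩ := Finset.mem_filter.1 hCm
    have hC : ∀ σ ∈ C, σ ∈ K.faces := fun σ hσ => by
      simpa using Finset.mem_powerset.1 hC' hσ
    have hinj : Set.InjOn bary (C : Set (Finset E)) := (bary_injOn K).mono hC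
    refine ⟨fun s hs => ?_, exists_affineMap_of_convexCombination _ _ fun w hw h1 => ?_⟩
    · obtain ⟨w, hw⟩ := (mem_convexHull_bary_iff hC hch).1 hs
      exact hw.mem_space
    · rw [Finset.sum_image hinj] at h1 ⊢
      have hs : IsFlagCombination K (∑ σ ∈ C, w (bary σ) • bary σ) C fun σ => w (bary σ) :=
        ⟨hC, hch, fun σ hσ => hw _ (Finset.mem_image_of_mem _ hσ), h1, rfl⟩
      rw [Finset.sum_image hinj, foldMap_eq b K hs]
      refine Finset.sum_congr rfl fun σ hσ => ?_
      rw [foldMap_eq b K (isFlagCombination_bary (hC σ hσ))]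
      simp
  · refine Filter.mem_of_superset self_mem_nhdsWithin fun s hs => ?_
    obtain ⟨C, w, h⟩ := exists_isFlagCombination hs
    refine Set.mem_iUnion₂.2 ⟨C.image bary, Finset.mem_image_of_mem _ (Finset.mem_filter.2
      ⟨Finset.mem_powerset.2 fun σ hσ => by simpa using h.1 σ hσ, h.2.1⟩), ?_⟩
    exact (mem_convexHull_bary_iff h.1 h.2.1).2 ⟨w, h⟩

theorem isPLOn_space (hfin : K.faces.Finite) : IsPLOn (fun s => s) K.space := by
  intro x hx
  refine ⟨hfin.toFinset, fun t ht => ⟨?_, AffineMap.id ℝ E, fun _ _ => rfl⟩, ?_⟩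
  · exact K.convexHull_subset_space (hfin.mem_toFinset.1 ht)
  · refine Filter.mem_of_superset self_mem_nhdsWithin fun s hs => ?_
    obtain ⟨σ, hσ, hsσ⟩ := K.mem_space_iff.1 hs
    exact Set.mem_iUnion₂.2 ⟨σ, hfin.mem_toFinset.2 hσ, hsσ⟩

theorem isCompact_space (hfin : K.faces.Finite) : IsCompact K.space :=
  hfin.isCompact_biUnion fun σ _ => σ.finite_toSet.isCompact_convexHull (𝕜 := ℝ)

open Classical in
theorem coord_foldMap {s : E} {C : Finset (Finset E)} {w : Finset E → ℝ}
    (h : IsFlagCombination K s C w) (i : Fin (k + 1)) :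
    b.coord i (foldMap b K s) = ∑ σ ∈ C with foldIndex k σ = i, w σ := by
  rw [foldMap_eq b K h, ← Finset.sum_fiberwise_of_maps_to (t := Finset.univ)
    (g := foldIndex k) fun _ _ => Finset.mem_univ _]
  have : ∀ j, ∑ σ ∈ C with foldIndex k σ = j, w σ • b (Fin.ofNat (k + 1) (σ.card - 1)) =
      (∑ σ ∈ C with foldIndex k σ = j, w σ) • b j := fun j => by
    rw [Finset.sum_smul]
    exact Finset.sum_congr rfl fun σ hσ => by rw [← (Finset.mem_filter.1 hσ).2]
  rw [Finset.sum_congr rfl fun j _ => this j, coord_sum_smul]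
  rw [Finset.sum_fiberwise_of_maps_to fun _ _ => Finset.mem_univ _, h.2.2.2.1]

theorem coord_foldMap_of_mem (hdim : ∀ σ ∈ K.faces, σ.card ≤ k + 1) {s : E}
    {C : Finset (Finset E)} {w : Finset E → ℝ}
    (h : IsFlagCombination K s C w) {σ : Finset E} (hσ : σ ∈ C) :
    b.coord (foldIndex k σ) (foldMap b K s) = w σ := by
  classical
  rw [coord_foldMap b h, Finset.sum_eq_single_of_mem (s := C.filter fun τ => foldIndex k τ = foldIndex k σ) σ
    (Finset.mem_filter.2 ⟨hσ, rfl⟩)]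
  intro τ hτ hne
  obtain ⟨hτ, he⟩ := Finset.mem_filter.1 hτ
  exact absurd (foldIndex_injOn hdim h.1 h.2.1 hτ hσ he) hne

theorem foldMap_mem_simplex {s : E} (hs : s ∈ K.space) : foldMap b K s ∈ simplex b := by
  classical
  obtain ⟨C, w, h⟩ := exists_isFlagCombination hs
  refine (mem_simplex_iff b).2 fun i => ?_
  rw [coord_foldMap b h]
  exact Finset.sum_nonneg fun σ hσ => h.2.2.1 σ (Finset.mem_filter.1 hσ).1

/-- The folding map can be moved freely in the directions of a face, near the points over the
interior of the face. -/
theorem exists_slide_of_nonneg [FiniteDimensional ℝ E] (hfin : K.faces.Finite)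
    (hdim : ∀ σ ∈ K.faces, σ.card ≤ k + 1)
    {s₀ : E} (hs₀ : s₀ ∈ K.space) {α : Finset (Fin (k + 1))}
    (hα : foldMap b K s₀ ∈ openFace b α) :
    ∃ Λ : EuclideanSpace ℝ (Fin k) →ₗ[ℝ] E, ∀ᶠ s in 𝓝[K.space] s₀, ∀ a ∈ faceDir b α,
      (∀ i ∈ α, 0 ≤ b.coord i (foldMap b K s + a)) →
        s + Λ a ∈ K.space ∧ foldMap b K (s + Λ a) = foldMap b K s + a := by
  classical
  obtain ⟨C₁, w₁, h₁⟩ := exists_isFlagCombination hs₀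
  -- The chain `C₀` of simplices with positive weight at `s₀` is the same for every representation,
  -- so one linear map `Λ` works for all nearby points.
  have hC₀ : ∀ {C w}, IsFlagCombination K s₀ C w → ∀ σ,
      σ ∈ C₁.filter (fun σ => 0 < w₁ σ) ↔ σ ∈ C ∧ 0 < w σ := fun h σ => by
    rw [Finset.mem_filter]
    exact ⟨fun hσ => h₁.mem_of_pos h hσ.1 hσ.2, fun hσ => h.mem_of_pos h₁ hσ.1 hσ.2⟩
  generalize C₁.filter (fun σ => 0 < w₁ σ) = C₀ at hC₀
  refine ⟨∑ σ ∈ C₀, (dcoord b (foldIndex k σ)).smulRight (bary σ), ?_⟩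
  -- Finitely many closed simplices miss `s₀`; near `s₀` they are avoided. Hence every chain
  -- representing a nearby point also represents `s₀` and contains `C₀`.
  have hev : ∀ᶠ s in 𝓝[K.space] s₀, ∀ C ∈ hfin.toFinset.powerset,
      s ∈ convexHull ℝ ((C.image bary : Finset E) : Set E) →
        s₀ ∈ convexHull ℝ ((C.image bary : Finset E) : Set E) := by
    rw [Filter.eventually_all_finset]
    intro C _
    by_cases h : s₀ ∈ convexHull ℝ ((C.image bary : Finset E) : Set E)
    · exact Filter.Eventually.of_forall fun _ _ => h
    · have hcl : IsClosed (convexHull ℝ ((C.image bary : Finset E) : Set E)) :=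
        ((C.image bary).finite_toSet.isCompact_convexHull (𝕜 := ℝ)).isClosed
      exact nhdsWithin_le_nhds (Filter.mem_of_superset (hcl.isOpen_compl.mem_nhds h)
        fun s hs hs' => absurd hs' hs)
  filter_upwards [hev, self_mem_nhdsWithin] with s hs hsK a ha hnn
  obtain ⟨C, w, h⟩ := exists_isFlagCombination hsK
  obtain ⟨w₀, h₀⟩ := (mem_convexHull_bary_iff h.1 h.2.1).1
    (hs C (Finset.mem_powerset.2 fun σ hσ => by simpa using h.1 σ hσ)
      ((mem_convexHull_bary_iff h.1 h.2.1).2 ⟨w, h⟩))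
  have hsub : C₀ ⊆ C := fun σ hσ => ((hC₀ h₀ σ).1 hσ).1
  -- The simplices in `C₀` correspond to the coordinates of `p(s₀)` that are positive, which are
  -- those in `α`.
  have himg : C₀.image (foldIndex k) = α := by
    ext i
    rw [Finset.mem_image]
    constructor
    · rintro ⟨σ, hσ, rfl⟩
      by_contra hcon
      have h2 := hα.2 _ hcon
      rw [coord_foldMap_of_mem b hdim h₀ (hsub hσ)] at h2
      exact ((hC₀ h₀ σ).1 hσ).2.ne' h2
    · intro hi
      have h2 := hα.1 i hi
      rw [coord_foldMap b h₀] at h2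
      obtain ⟨σ, hσ, hpos⟩ := Finset.exists_lt_of_sum_lt
        (s := C.filter fun σ => foldIndex k σ = i) (f := fun _ => (0 : ℝ)) (g := w₀) (by simpa using h2)
      obtain ⟨hσC, hσi⟩ := Finset.mem_filter.1 hσ
      exact ⟨σ, (hC₀ h₀ σ).2 ⟨hσC, hpos⟩, hσi⟩
  have hinj : Set.InjOn (foldIndex k) (C₀ : Set (Finset E)) :=
    (foldIndex_injOn hdim h.1 h.2.1).mono (Finset.coe_subset.2 hsub)
  have hzero := (mem_faceDir b).1 ha
  have hsum0 : ∑ σ ∈ C₀, dcoord b (foldIndex k σ) a = 0 := by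
    rw [← Finset.sum_image (f := fun i => dcoord b i a) hinj, himg, ← sum_dcoord b a]
    exact Finset.sum_subset (Finset.subset_univ α) fun i _ hi => hzero i hi
  have hsuma : ∑ σ ∈ C₀, dcoord b (foldIndex k σ) a • b (foldIndex k σ) = a := by
    rw [← Finset.sum_image (f := fun i => dcoord b i a • b i) hinj, himg]
    refine (Finset.sum_subset (Finset.subset_univ α) fun i _ hi => ?_).trans (sum_dcoord_smul b a)
    rw [hzero i hi, zero_smul]
  have hfil : C.filter (· ∈ C₀) = C₀ := by
    rw [Finset.filter_mem_eq_inter, Finset.inter_eq_right.2 hsub]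
  -- The displacement `a` is realized by changing only the weights on `C₀`. Their new values are
  -- barycentric coordinates of `p(s) + a`, nonnegative by assumption.
  have hflag : IsFlagCombination K (s + ∑ σ ∈ C₀, dcoord b (foldIndex k σ) a • bary σ) C
      fun σ => w σ + if σ ∈ C₀ then dcoord b (foldIndex k σ) a else 0 := by
    refine ⟨h.1, h.2.1, fun σ hσ => ?_, ?_, ?_⟩
    · beta_reduce
      split_ifs with hσ0
      · have h2 := hnn (foldIndex k σ) (himg ▸ Finset.mem_image_of_mem _ hσ0)
        rwa [coord_add, coord_foldMap_of_mem b hdim h hσ] at h2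
      · rw [add_zero]
        exact h.2.2.1 σ hσ
    · rw [Finset.sum_add_distrib, ← Finset.sum_filter, hfil, hsum0, add_zero, h.2.2.2.1]
    · simp only [add_smul, ite_smul, zero_smul, Finset.sum_add_distrib]
      rw [← Finset.sum_filter, hfil, h.2.2.2.2]
      rfl
  have hΛ : (∑ σ ∈ C₀, (dcoord b (foldIndex k σ)).smulRight (bary σ)) a =
      ∑ σ ∈ C₀, dcoord b (foldIndex k σ) a • bary σ := by
    simp [LinearMap.sum_apply]
  rw [hΛ]
  refine ⟨hflag.mem_space, ?_⟩
  rw [foldMap_eq b K hflag, foldMap_eq b K h]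
  simp only [add_smul, ite_smul, zero_smul, Finset.sum_add_distrib]
  rw [← Finset.sum_filter, hfil]
  exact congrArg _ hsuma

/-- The coordinates in `α` are positive at `p(s₀)`, so for `s` near `s₀` and small displacements the
sign condition holds by continuity. -/
theorem exists_slide [FiniteDimensional ℝ E] (hfin : K.faces.Finite)
    (hdim : ∀ σ ∈ K.faces, σ.card ≤ k + 1)
    {s₀ : E} (hs₀ : s₀ ∈ K.space) {α : Finset (Fin (k + 1))}
    (hα : foldMap b K s₀ ∈ openFace b α) :
    ∃ Λ : EuclideanSpace ℝ (Fin k) →ₗ[ℝ] E,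
      ∀ᶠ q : E × EuclideanSpace ℝ (Fin k) in 𝓝 (s₀, 0), q.1 ∈ K.space → q.2 ∈ faceDir b α →
        q.1 + Λ q.2 ∈ K.space ∧ foldMap b K (q.1 + Λ q.2) = foldMap b K q.1 + q.2 := by
  obtain ⟨Λ, hΛ⟩ := exists_slide_of_nonneg b hfin hdim hs₀ hα
  refine ⟨Λ, ?_⟩
  have hc : ∀ᶠ q : E × EuclideanSpace ℝ (Fin k) in 𝓝[K.space ×ˢ Set.univ] (s₀, 0),
      ∀ i ∈ α, 0 ≤ b.coord i (foldMap b K q.1 + q.2) := by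
    rw [Filter.eventually_all_finset]
    intro i hi
    have h1 : ContinuousWithinAt (fun q : E × EuclideanSpace ℝ (Fin k) => foldMap b K q.1)
        (K.space ×ˢ Set.univ) (s₀, 0) :=
      ContinuousWithinAt.comp (g := foldMap b K) (f := Prod.fst) (t := K.space)
        (x := (s₀, (0 : EuclideanSpace ℝ (Fin k)))) ((isPLOn_foldMap b hfin).continuousOn s₀ hs₀)
        continuous_fst.continuousWithinAt fun q hq => hq.1
    have h2 : ContinuousWithinAt (fun q : E × EuclideanSpace ℝ (Fin k) =>
        b.coord i (foldMap b K q.1 + q.2)) (K.space ×ˢ Set.univ) (s₀, 0) :=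
      (b.coord i).continuous_of_finiteDimensional.continuousAt.comp_continuousWithinAt
        (h1.add continuous_snd.continuousWithinAt)
    refine (h2.eventually (lt_mem_nhds (a := 0) ?_)).mono fun _ h => le_of_lt h
    simpa using hα.1 i hi
  have hΛ' : ∀ᶠ q : E × EuclideanSpace ℝ (Fin k) in 𝓝[K.space ×ˢ Set.univ] (s₀, 0),
      ∀ a ∈ faceDir b α, (∀ i ∈ α, 0 ≤ b.coord i (foldMap b K q.1 + a)) →
        q.1 + Λ a ∈ K.space ∧ foldMap b K (q.1 + Λ a) = foldMap b K q.1 + a := by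
    have : Filter.Tendsto Prod.fst (𝓝[K.space ×ˢ Set.univ] (s₀, (0 : EuclideanSpace ℝ (Fin k))))
        (𝓝[K.space] s₀) :=
      tendsto_nhdsWithin_of_tendsto_nhds_of_eventually_within _
        continuous_fst.continuousWithinAt (Filter.mem_of_superset self_mem_nhdsWithin
          fun q hq => hq.1)
    exact this.eventually hΛ
  have := eventually_nhdsWithin_iff.1 (hc.and hΛ')
  filter_upwards [this] with q hq h1 h2
  exact (hq ⟨h1, trivial⟩).2 _ h2 (hq ⟨h1, trivial⟩).1

end Fold

/-! ### Germs from PL homeomorphisms; linear subspaces and orthants as polyhedra. -/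

section GermConstructions

set_option linter.unusedSectionVars false

variable {E F : Type*} [NormedAddCommGroup E] [NormedSpace ℝ E] [FiniteDimensional ℝ E]
  [NormedAddCommGroup F] [NormedSpace ℝ F] [FiniteDimensional ℝ F]

theorem IsPLHomeoOn.exists_germHomeo {f : E → F} {S : Set E} {T : Set F} (h : IsPLHomeoOn f S T) :
    ∃ g, ∀ x ∈ S, GermHomeo f g S T x := by
  obtain ⟨g, hf, hg, hfm, hgm, hinv⟩ := h
  refine ⟨g, fun x hx => ⟨hx, hfm hx, isPLOn_iff.1 hf x hx, isPLOn_iff.1 hg _ (hfm hx), ?_, ?_⟩⟩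
  · exact Filter.mem_of_superset self_mem_nhdsWithin fun y hy => ⟨hfm hy, hinv.1 hy⟩
  · exact Filter.mem_of_superset self_mem_nhdsWithin fun y hy => ⟨hgm hy, hinv.2 hy⟩

/-- Only the germs of source and target matter, so global sets can be replaced by locally equal
ones. -/
theorem GermHomeo.congr_set {f : E → F} {g : F → E} {S S' : Set E} {T T' : Set F} {x : E}
    (h : GermHomeo f g S T x) (hS : 𝓝[S] x = 𝓝[S'] x) (hT : 𝓝[T] (f x) = 𝓝[T'] (f x)) :
    GermHomeo f g S' T' x := by
  have hmem : ∀ {G : Type _} [TopologicalSpace G] {A B : Set G} {p : G}, p ∈ A →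
      𝓝[A] p = 𝓝[B] p → p ∈ B := fun hp he =>
    mem_of_mem_nhdsWithin hp (he ▸ self_mem_nhdsWithin)
  refine ⟨hmem h.mem hS, mem_of_mem_nhdsWithin h.map_mem (hT ▸ self_mem_nhdsWithin),
    h.plAt.congr_set hS, h.plAt_inv.congr_set hT, ?_, ?_⟩
  · rw [← hS]
    have h1 : ∀ᶠ z in 𝓝[T] (f x), z ∈ T' := hT ▸ self_mem_nhdsWithin
    filter_upwards [h.left_inv, h.tendsto.eventually h1] with y h2 h3
    exact ⟨h3, h2.2⟩
  · rw [← hT]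
    have h1 : ∀ᶠ z in 𝓝[S] x, z ∈ S' := hS ▸ self_mem_nhdsWithin
    filter_upwards [h.right_inv, h.tendsto_inv.eventually h1] with y h2 h3
    exact ⟨h3, h2.2⟩

theorem polyAt_submodule (A : Submodule ℝ E) (x : E) : PolyAt (A : Set E) x := by
  obtain ⟨B, hB⟩ := A.exists_isCompl
  have h := PolyAt.preimage (PLAt.linear (Submodule.projection B A hB.symm) (PolyAt.univ x))
    (PolyAt.singleton (0 : E) _)
  convert h using 1
  ext y
  simp

theorem polyAt_Ici_pi {ι : Type*} [Fintype ι] (x : ι → ℝ) : PolyAt (Set.Ici (0 : ι → ℝ)) x := by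
  have hp : PLAt (fun (y : ι → ℝ) i => min (y i) 0) Set.univ x := PLAt.pi (PolyAt.univ x)
    fun i => (PLAt.linear (LinearMap.proj i) (PolyAt.univ x)).min (PLAt.const 0 (PolyAt.univ x))
  have h := PolyAt.preimage hp (PolyAt.singleton (0 : ι → ℝ) _)
  convert h using 1
  ext y
  simp [Pi.le_def, funext_iff]

end GermConstructions

/-! ### Directions and normals of a face. -/

section FaceGeometry

variable {k : ℕ} (b : AffineBasis (Fin (k + 1)) ℝ (EuclideanSpace ℝ (Fin k)))
  {α : Finset (Fin (k + 1))}

theorem vectorSpan_face (hα : α.Nonempty) :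
    vectorSpan ℝ (b '' (α : Set (Fin (k + 1)))) = faceDir b α := by
  obtain ⟨i₀, hi₀⟩ := hα
  apply le_antisymm
  · rw [vectorSpan, Submodule.span_le]
    rintro _ ⟨_, ⟨i, hi, rfl⟩, _, ⟨j, hj, rfl⟩, rfl⟩
    refine (mem_faceDir b).2 fun l hl => ?_
    change dcoord b l (b i - b j) = 0
    rw [dcoord_sub, b.coord_apply_ne fun h : l = i => hl (h ▸ hi),
      b.coord_apply_ne fun h : l = j => hl (h ▸ hj), sub_zero]
  · intro a ha
    have h0 := (mem_faceDir b).1 ha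
    have h1 : a = ∑ i ∈ α, dcoord b i a • (b i - b i₀) := by
      simp only [smul_sub, Finset.sum_sub_distrib, ← Finset.sum_smul]
      rw [Finset.sum_subset (Finset.subset_univ α) fun i _ hi => h0 i hi,
        Finset.sum_subset (Finset.subset_univ α) fun i _ hi => by rw [h0 i hi, zero_smul],
        sum_dcoord, sum_dcoord_smul, zero_smul, sub_zero]
    rw [h1]
    exact Submodule.sum_mem _ fun i hi => Submodule.smul_mem _ _
      (vsub_mem_vectorSpan ℝ ⟨i, hi, rfl⟩ ⟨i₀, hi₀, rfl⟩)

theorem finrank_faceDir (hα : α.Nonempty) :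
    Module.finrank ℝ (faceDir b α) = α.card - 1 := by
  classical
  rw [← vectorSpan_face b hα]
  have h := b.ind.finrank_vectorSpan_image_finset (s := α) (n := α.card - 1)
    (by have := hα.card_pos; omega)
  rwa [Finset.coe_image] at h

theorem openFace_subset_face : openFace b α ⊆ face b α := fun u hu =>
  (mem_face_iff b).2 ⟨fun i => by
    by_cases h : i ∈ α
    · exact (hu.1 i h).le
    · exact (hu.2 i h).ge, hu.2⟩

theorem nonempty_of_mem_openFace {y : EuclideanSpace ℝ (Fin k)} (hy : y ∈ openFace b α) :
    α.Nonempty := by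
  by_contra h
  rw [Finset.not_nonempty_iff_eq_empty] at h
  have := b.sum_coord_apply_eq_one y
  rw [Finset.sum_eq_zero fun i _ => hy.2 i (by simp [h])] at this
  exact zero_ne_one this

/-- Differences of vertices span the direction of the face, and a point of the open face is
automatically in the affine span. -/
theorem isFoot_iff {y u : EuclideanSpace ℝ (Fin k)} (hy : y ∈ openFace b α) :
    IsFoot b α u y ↔ u - y ∈ (faceDir b α)ᗮ := by
  have hα := nonempty_of_mem_openFace b hy
  rw [← vectorSpan_face b hα]
  constructor
  · rintro ⟨-, h⟩
    rw [Submodule.mem_orthogonal']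
    intro w hw
    induction hw using Submodule.span_induction with
    | mem x hx =>
      obtain ⟨_, ⟨i, hi, rfl⟩, _, ⟨j, hj, rfl⟩, rfl⟩ := hx
      exact h i hi j hj
    | zero => exact inner_zero_right _
    | add x z _ _ hx hz => rw [inner_add_right, hx, hz, add_zero]
    | smul c x _ hx => rw [inner_smul_right, hx, mul_zero]
  · intro h
    refine ⟨convexHull_subset_affineSpan _ (openFace_subset_face b hy), fun i hi j hj => ?_⟩
    exact (Submodule.mem_orthogonal' _ _).1 h _ (vsub_mem_vectorSpan ℝ ⟨i, hi, rfl⟩ ⟨j, hj, rfl⟩)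

/-- The vectors orthogonal to a face are parametrized by their coordinates at the opposite
vertices. -/
theorem exists_faceNormal (hα : α.Nonempty) :
    ∃ N : ({j // j ∉ α} → ℝ) →ₗ[ℝ] EuclideanSpace ℝ (Fin k),
      (∀ y, N y ∈ (faceDir b α)ᗮ) ∧ (∀ y (j : {j // j ∉ α}), dcoord b j (N y) = y j) ∧
      ∀ w ∈ (faceDir b α)ᗮ, N (fun j => dcoord b j w) = w := by
  classical
  obtain ⟨i₀, hi₀⟩ := hα
  -- The component of `b j - b i₀` orthogonal to the face. Subtracting a face direction does not
  -- change the coordinates off `α`, so these vectors are dual to those coordinates.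
  let ω : {j // j ∉ α} → EuclideanSpace ℝ (Fin k) := fun j =>
    (b j - b i₀) - (faceDir b α).starProjection (b j - b i₀)
  have hω : ∀ i : {j // j ∉ α}, ∀ j : {j // j ∉ α}, dcoord b j (ω i) = if i = j then 1 else 0 := by
    intro i j
    have h1 := (mem_faceDir b).1 ((faceDir b α).starProjection_apply_mem (b i - b i₀)) j j.2
    rw [map_sub, h1, sub_zero, dcoord_sub, b.coord_apply, b.coord_apply,
      if_neg fun h : (j : Fin (k + 1)) = i₀ => j.2 (h ▸ hi₀), sub_zero]
    simp only [Subtype.ext_iff, eq_comm]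
  have hN : ∀ y : {j // j ∉ α} → ℝ, ∀ j : {j // j ∉ α}, dcoord b j (∑ i, y i • ω i) = y j := by
    intro y j
    rw [map_sum]
    simp [hω]
  have hmem : ∀ y : {j // j ∉ α} → ℝ, ∑ i, y i • ω i ∈ (faceDir b α)ᗮ := fun y =>
    Submodule.sum_mem _ fun i _ => Submodule.smul_mem _ _
      ((faceDir b α).sub_starProjection_mem_orthogonal _)
  refine ⟨Fintype.linearCombination ℝ ω, fun y => ?_, fun y j => ?_, fun w hw => ?_⟩
  · rw [Fintype.linearCombination_apply]
    exact hmem y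
  · rw [Fintype.linearCombination_apply]
    exact hN y j
  · rw [Fintype.linearCombination_apply, ← sub_eq_zero]
    have h1 : ∑ i : {j // j ∉ α}, dcoord b i w • ω i - w ∈ (faceDir b α)ᗮ :=
      Submodule.sub_mem _ (hmem fun j => dcoord b j w) hw
    -- A normal vector whose coordinates off `α` all vanish is also a face direction, hence zero.
    refine (Submodule.mem_bot ℝ).1 ((faceDir b α).inf_orthogonal_eq_bot ▸ ⟨?_, h1⟩)
    exact (mem_faceDir b).2 fun j hj => by
      rw [map_sub, hN (fun j => dcoord b j w) ⟨j, hj⟩, sub_self]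

theorem continuous_coord (i : Fin (k + 1)) : Continuous (b.coord i) :=
  (b.coord i).continuous_of_finiteDimensional

theorem faceDir_univ : faceDir b Finset.univ = ⊤ :=
  eq_top_iff.2 fun _ _ => (mem_faceDir b).2 fun i hi => absurd (Finset.mem_univ i) hi

/-- The coordinates that are positive at `y` stay positive nearby. -/
theorem eventually_coord_pos {y : EuclideanSpace ℝ (Fin k)} (hy : y ∈ openFace b α) :
    ∀ᶠ u in 𝓝 y, ∀ i ∈ α, 0 < b.coord i u := by
  rw [Filter.eventually_all_finset]
  exact fun i hi => (continuous_coord b i).continuousAt.eventually (lt_mem_nhds (hy.1 i hi))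

theorem exists_mem_openFace {u : EuclideanSpace ℝ (Fin k)} (hu : u ∈ simplex b) :
    ∃ α, u ∈ openFace b α := by
  classical
  have h := (mem_simplex_iff b).1 hu
  refine ⟨Finset.univ.filter fun i => 0 < b.coord i u, fun i hi => (Finset.mem_filter.1 hi).2,
    fun i hi => ?_⟩
  refine le_antisymm (not_lt.1 fun h' => hi ?_) (h i)
  exact Finset.mem_filter.2 ⟨Finset.mem_univ i, h'⟩

end FaceGeometry

/-! ### Properness as a statement about germs. -/

section LocalProduct

set_option linter.unusedSectionVars false

variable {k : ℕ} {b : AffineBasis (Fin (k + 1)) ℝ (EuclideanSpace ℝ (Fin k))}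
  {E : Type*} [NormedAddCommGroup E] [NormedSpace ℝ E] [FiniteDimensional ℝ E]
  {X : Set E} {f : E → EuclideanSpace ℝ (Fin k)} {α : Finset (Fin (k + 1))}

/-- Properness, in terms of germs and for all faces including the simplex itself. -/
theorem exists_retraction_germ (hf : IsHyperbolizedSimplex b X f) (hp : IsProperSimplexMap b X f)
    {z : E} (hz : z ∈ X) (hα : f z ∈ openFace b α) :
    ∃ (r : E → E) (ξ : E × EuclideanSpace ℝ (Fin k) → E), r z = z ∧
      GermHomeo (fun x => (r x, f x)) ξ X {p | p.1 ∈ X ∧ f p.1 ∈ openFace b α ∧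
        p.2 ∈ simplex b ∧ p.2 - f p.1 ∈ (faceDir b α)ᗮ} z := by
  have hne := nonempty_of_mem_openFace b hα
  have hfz := isPLOn_iff.1 hf.isPLOn z hz
  have hXz : PolyAt X z := hfz.polyAt
  -- For the full simplex the normal space is zero, so the pullback is the graph of `f` and the
  -- retraction is the identity.
  by_cases hu : α = Finset.univ
  · subst hu
    have hT : ∀ x ∈ X, f x ∈ openFace b Finset.univ →
        (x, f x) ∈ {p : E × EuclideanSpace ℝ (Fin k) | p.1 ∈ X ∧ f p.1 ∈ openFace b Finset.univ ∧
        p.2 ∈ simplex b ∧ p.2 - f p.1 ∈ (faceDir b Finset.univ)ᗮ} := fun x hx hfx =>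
      ⟨hx, hfx, hf.mapsTo hx, by rw [sub_self]; exact Submodule.zero_mem _⟩
    have hopen : ∀ᶠ x in 𝓝[X] z, f x ∈ openFace b Finset.univ :=
      (hfz.continuousWithinAt.eventually (eventually_coord_pos b hα)).mono fun x hx =>
        ⟨hx, fun i hi => absurd (Finset.mem_univ i) hi⟩
    have heq : ∀ p ∈ {p : E × EuclideanSpace ℝ (Fin k) | p.1 ∈ X ∧
        f p.1 ∈ openFace b Finset.univ ∧ p.2 ∈ simplex b ∧
        p.2 - f p.1 ∈ (faceDir b Finset.univ)ᗮ}, (p.1, f p.1) = p := by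
      intro p hp
      have h1 := hp.2.2.2
      rw [faceDir_univ, Submodule.top_orthogonal_eq_bot, Submodule.mem_bot, sub_eq_zero] at h1
      exact Prod.ext rfl h1.symm
    have hpl : PLAt (fun x => (x, f x)) X z := hXz.prodMk hfz
    have hl := Filter.Eventually.mono (hopen.and self_mem_nhdsWithin) fun x hx =>
      And.intro (hT x hx.2 hx.1) (rfl : Prod.fst (x, f x) = x)
    have hr := Filter.Eventually.mono (f := 𝓝[{p : E × EuclideanSpace ℝ (Fin k) | p.1 ∈ X ∧
        f p.1 ∈ openFace b Finset.univ ∧ p.2 ∈ simplex b ∧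
        p.2 - f p.1 ∈ (faceDir b Finset.univ)ᗮ}] (z, f z)) self_mem_nhdsWithin fun p hp =>
      And.intro (show p.1 ∈ X from hp.1) (heq p hp)
    refine ⟨id, Prod.fst, rfl, hz, hT z hz hα, hpl, ?_, ?_, ?_⟩
    · exact hpl.inverse continuous_fst.continuousWithinAt rfl hl hr
    · exact hl
    · exact hr
  · obtain ⟨B, δ, U, r, ⟨hB, hBn, -, hδ, -⟩, hUX, hUn, -, hr, hhom⟩ := hp α hne hu z ⟨hz, hα⟩
    have hzU : z ∈ U := mem_of_mem_nhdsWithin hz hUn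
    obtain ⟨ξ, hξ⟩ := hhom.exists_germHomeo
    have hrz : r z = z := hr z ⟨hzU, hα⟩
    refine ⟨r, ξ, hrz, (hξ z hzU).congr_set ?_ ?_⟩
    · exact le_antisymm (nhdsWithin_mono _ hUX) (nhdsWithin_le_of_mem hUn)
    · simp only [hrz]
      refine le_antisymm (nhdsWithin_mono _ ?_) (nhdsWithin_le_of_mem ?_)
      · rintro p ⟨h1, h2, h3⟩
        exact ⟨hUX h1.1, h1.2, h2.1, (isFoot_iff b h1.2).1 h3⟩
      · have hT1 : Filter.Tendsto Prod.fst (𝓝[{p : E × EuclideanSpace ℝ (Fin k) | p.1 ∈ X ∧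
            f p.1 ∈ openFace b α ∧ p.2 ∈ simplex b ∧ p.2 - f p.1 ∈ (faceDir b α)ᗮ}] (z, f z))
            (𝓝[X ∩ f ⁻¹' openFace b α] z) :=
          tendsto_nhdsWithin_of_tendsto_nhds_of_eventually_within _
            continuous_fst.continuousWithinAt (Filter.mem_of_superset self_mem_nhdsWithin
              fun p hp => ⟨hp.1, hp.2.1⟩)
        have hf' : Filter.Tendsto f (𝓝[X ∩ f ⁻¹' openFace b α] z) (𝓝[openFace b α] (f z)) :=
          tendsto_nhdsWithin_of_tendsto_nhds_of_eventually_within _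
            (hfz.continuousWithinAt.mono Set.inter_subset_left)
            (Filter.mem_of_superset self_mem_nhdsWithin fun p hp => hp.2)
        -- At `f z` the coordinates off `α` vanish, so the height restriction of the square is
        -- automatic nearby and may be dropped from the germ.
        have hsum : ∀ᶠ p : E × EuclideanSpace ℝ (Fin k) in 𝓝 (z, f z),
            ∑ j ∈ αᶜ, b.coord j p.2 < δ := by
          have hc : Continuous fun p : E × EuclideanSpace ℝ (Fin k) =>
              ∑ j ∈ αᶜ, b.coord j p.2 :=
            continuous_finsetSum _ fun j _ => (continuous_coord b j).comp continuous_snd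
          refine hc.continuousAt.eventually (gt_mem_nhds ?_)
          beta_reduce
          rwa [Finset.sum_eq_zero fun j hj => hα.2 j (Finset.mem_compl.1 hj)]
        filter_upwards [self_mem_nhdsWithin, (hf'.comp hT1).eventually_mem hBn,
          hT1.eventually_mem (nhdsWithin_mono _ Set.inter_subset_left hUn),
          nhdsWithin_le_nhds hsum] with p h1 h2 h3 h4
        have h5 := (isFoot_iff b h1.2.1).2 h1.2.2.2
        exact ⟨⟨h3, h1.2.1⟩, ⟨h1.2.2.1, ⟨_, h2, h5⟩, h4.le⟩, h5⟩

end LocalProduct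

/-! ### Local model of the hyperbolized simplex along a face. -/

section FaceModel

set_option linter.unusedSectionVars false

variable {k : ℕ} {b : AffineBasis (Fin (k + 1)) ℝ (EuclideanSpace ℝ (Fin k))}
  {E F : Type*} [NormedAddCommGroup E] [NormedSpace ℝ E] [FiniteDimensional ℝ E]
  [NormedAddCommGroup F] [NormedSpace ℝ F] [FiniteDimensional ℝ F]
  {X : Set E} {f : E → EuclideanSpace ℝ (Fin k)} {α : Finset (Fin (k + 1))}

/-- Allows the base point in the target to be written in simplified form. -/
theorem GermHomeo.of_eq {f : E → F} {g : F → E} {S : Set E} {T : Set F} {x : E} {y : F}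
    (hy : f x = y) (hx : x ∈ S) (hyT : y ∈ T) (hf : PLAt f S x) (hg : PLAt g T y)
    (hl : ∀ᶠ x' in 𝓝[S] x, f x' ∈ T ∧ g (f x') = x')
    (hr : ∀ᶠ y' in 𝓝[T] y, g y' ∈ S ∧ f (g y') = y') : GermHomeo f g S T x := by
  subst hy
  exact ⟨hx, hyT, hf, hg, hl, hr⟩

theorem exists_germHomeo_of_mem_manifoldInterior {n : ℕ} {M : Set E} {z : E}
    (h : z ∈ manifoldInterior n M) :
    ∃ (φ : E → Fin n → ℝ) (g : (Fin n → ℝ) → E), GermHomeo φ g M Set.univ z := by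
  obtain ⟨hz, O, φ, O', hzO, hO, hO', hφ⟩ := h
  obtain ⟨g, hg⟩ := hφ.exists_germHomeo
  have h1 := hg z ⟨hz, hzO⟩
  refine ⟨φ, g, h1.congr_set ?_ ?_⟩
  · exact nhdsWithin_inter_of_mem' (mem_nhdsWithin_of_mem_nhds (hO.mem_nhds hzO))
  · rw [nhdsWithin_univ]
    exact hO'.nhdsWithin_eq h1.map_mem

theorem plAt_coord {x : E} (hf : PLAt f X x) (i : Fin (k + 1)) :
    PLAt (fun y => b.coord i (f y)) X x := hf.affine_comp (b.coord i)

theorem plAt_coords {x : E} (hf : PLAt f X x) (α : Finset (Fin (k + 1))) :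
    PLAt (fun y (j : {j // j ∉ α}) => b.coord j (f y)) X x :=
  PLAt.pi hf.polyAt fun j => plAt_coord hf j

/-- Near a point over the interior of a face, a hyperbolized simplex is the product of the
direction of the face and an orthant. -/
theorem exists_faceModel (hf : IsHyperbolizedSimplex b X f) (hp : IsProperSimplexMap b X f)
    {z : E} (hz : z ∈ X) (hα : f z ∈ openFace b α) :
    ∃ (c : E → EuclideanSpace ℝ (Fin k))
      (Ψ : EuclideanSpace ℝ (Fin k) × ({j // j ∉ α} → ℝ) → E), c z = 0 ∧
      GermHomeo (fun x => (c x, fun j : {j // j ∉ α} => b.coord j (f x))) Ψ X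
        ((faceDir b α : Set (EuclideanSpace ℝ (Fin k))) ×ˢ Set.Ici 0) z := by
  have hne := nonempty_of_mem_openFace b hα
  have hfz := isPLOn_iff.1 hf.isPLOn z hz
  obtain ⟨r, ξ, hrz, hξ⟩ := exists_retraction_germ hf hp hz hα
  obtain ⟨N, hN1, hN2, hN3⟩ := exists_faceNormal b hne
  -- a chart of the preimage of the face
  obtain ⟨φ, g, hφ⟩ : ∃ (φ : E → Fin (α.card - 1) → ℝ) (g : (Fin (α.card - 1) → ℝ) → E),
      GermHomeo φ g (X ∩ f ⁻¹' openFace b α) Set.univ z := by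
    -- The boundary of the preimage of the face lies over the boundary of the face, and `f z` is in
    -- the open face.
    have hzm : z ∈ manifoldInterior (α.card - 1) (X ∩ f ⁻¹' face b α) := by
      by_contra hcon
      have h1 : z ∈ manifoldBoundary (α.card - 1) (X ∩ f ⁻¹' face b α) :=
        ⟨⟨hz, openFace_subset_face b hα⟩, hcon⟩
      rw [hf.boundary_eq α hne] at h1
      exact h1.2.2 hα
    obtain ⟨φ, g, h⟩ := exists_germHomeo_of_mem_manifoldInterior hzm
    refine ⟨φ, g, h.congr_set (le_antisymm (nhdsWithin_le_of_mem ?_) (nhdsWithin_mono _ ?_)) rfl⟩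
    · filter_upwards [nhdsWithin_mono _ Set.inter_subset_left
        (hfz.continuousWithinAt.eventually (eventually_coord_pos b hα)),
        self_mem_nhdsWithin] with x h1 h2
      exact ⟨h2.1, h1, ((mem_face_iff b).1 h2.2).2⟩
    · exact Set.inter_subset_inter_right _ (Set.preimage_mono (openFace_subset_face b))
  obtain ⟨J⟩ : Nonempty ((Fin (α.card - 1) → ℝ) ≃ₗ[ℝ] faceDir b α) :=
    FiniteDimensional.nonempty_linearEquiv_of_finrank_eq
      (by rw [finrank_faceDir b hne, Module.finrank_fin_fun])
  -- A linear extension of the inverse of `J` to the whole space, so that the inverse germ is given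
  -- by a formula on all of `EuclideanSpace ℝ (Fin k)`.
  obtain ⟨L, hL⟩ := ((faceDir b α).subtype ∘ₗ J.toLinearMap).exists_leftInverse_of_injective
    (LinearMap.ker_eq_bot.2 ((faceDir b α).injective_subtype.comp J.injective))
  have hLJ : ∀ v, L (J v) = v := fun v => LinearMap.congr_fun hL v
  have hJL : ∀ a ∈ faceDir b α, (J (L a) : EuclideanSpace ℝ (Fin k)) = a := fun a ha => by
    have h1 := hLJ (J.symm ⟨a, ha⟩)
    rw [J.apply_symm_apply] at h1
    rw [show L a = J.symm ⟨a, ha⟩ from h1, J.apply_symm_apply]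
  have hA : PLAt (fun a : EuclideanSpace ℝ (Fin k) × ({j // j ∉ α} → ℝ) => φ z + L a.1)
      ((faceDir b α : Set (EuclideanSpace ℝ (Fin k))) ×ˢ Set.Ici 0) (0, 0) := by
    have hP := (polyAt_submodule (faceDir b α) 0).prod (polyAt_Ici_pi (0 : {j // j ∉ α} → ℝ))
    exact (PLAt.const _ hP).add (hP.fst.linear_comp L)
  have hAz : φ z + L (0 : EuclideanSpace ℝ (Fin k)) = φ z := by rw [map_zero, add_zero]
  have hg : PLAt (fun a : EuclideanSpace ℝ (Fin k) × ({j // j ∉ α} → ℝ) => g (φ z + L a.1))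
      ((faceDir b α : Set (EuclideanSpace ℝ (Fin k))) ×ˢ Set.Ici 0) (0, 0) :=
    PLAt.comp (T := Set.univ) (by simpa only [hAz] using hφ.plAt_inv) hA
      (Filter.Eventually.of_forall fun _ => trivial)
  have hgz : g (φ z + L (0 : EuclideanSpace ℝ (Fin k))) = z := by rw [hAz, hφ.apply_inv]
  have hgev : ∀ᶠ a in 𝓝[(faceDir b α : Set (EuclideanSpace ℝ (Fin k))) ×ˢ Set.Ici 0]
      ((0, 0) : EuclideanSpace ℝ (Fin k) × ({j // j ∉ α} → ℝ)),
      g (φ z + L a.1) ∈ X ∩ f ⁻¹' openFace b α ∧ φ (g (φ z + L a.1)) = φ z + L a.1 := by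
    have h1 := hA.continuousWithinAt.tendsto
    have h2 := hφ.right_inv
    rw [nhdsWithin_univ] at h2
    simp only [hAz] at h1
    exact h1.eventually h2
  have hfg : PLAt (fun a : EuclideanSpace ℝ (Fin k) × ({j // j ∉ α} → ℝ) => f (g (φ z + L a.1)))
      ((faceDir b α : Set (EuclideanSpace ℝ (Fin k))) ×ˢ Set.Ici 0) (0, 0) :=
    PLAt.comp (T := X) (by simpa only [hgz] using hfz) hg (hgev.mono fun a h => h.1.1)
  have hu : PLAt (fun a : EuclideanSpace ℝ (Fin k) × ({j // j ∉ α} → ℝ) =>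
      f (g (φ z + L a.1)) + N a.2)
      ((faceDir b α : Set (EuclideanSpace ℝ (Fin k))) ×ˢ Set.Ici 0) (0, 0) :=
    hfg.add (hfg.polyAt.snd.linear_comp N)
  have hT : PolyAt {p : E × EuclideanSpace ℝ (Fin k) | p.1 ∈ X ∧ f p.1 ∈ openFace b α ∧
      p.2 ∈ simplex b ∧ p.2 - f p.1 ∈ (faceDir b α)ᗮ} (z, f z) := by
    have := hξ.plAt_inv.polyAt
    rwa [hrz] at this
  have hφ' : PLAt (fun p : E × EuclideanSpace ℝ (Fin k) =>
      ((J (φ p.1 - φ z) : EuclideanSpace ℝ (Fin k)), fun j : {j // j ∉ α} => b.coord j p.2))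
      {p | p.1 ∈ X ∧ f p.1 ∈ openFace b α ∧ p.2 ∈ simplex b ∧ p.2 - f p.1 ∈ (faceDir b α)ᗮ}
      (z, f z) := by
    have h1 : PLAt (fun p : E × EuclideanSpace ℝ (Fin k) => φ p.1)
        {p | p.1 ∈ X ∧ f p.1 ∈ openFace b α ∧ p.2 ∈ simplex b ∧ p.2 - f p.1 ∈ (faceDir b α)ᗮ}
        (z, f z) := PLAt.comp (f := Prod.fst) hφ.plAt hT.fst
      (Filter.mem_of_superset self_mem_nhdsWithin fun p hp => ⟨hp.1, hp.2.1⟩)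
    exact ((h1.sub (PLAt.const _ hT)).linear_comp ((faceDir b α).subtype ∘ₗ J.toLinearMap)).prodMk
      (plAt_coords hT.snd α)
  -- In the pullback a point is a pair `(v, u)` with `u - f v` normal to the face. Thus `v` can be
  -- prescribed by the chart and the normal part by its coordinates off `α`; membership of `u` in
  -- the simplex means that these are nonnegative, the other coordinates being positive near `f z`.
  have hB : GermHomeo (fun p : E × EuclideanSpace ℝ (Fin k) =>
      ((J (φ p.1 - φ z) : EuclideanSpace ℝ (Fin k)), fun j : {j // j ∉ α} => b.coord j p.2))
      (fun a => (g (φ z + L a.1), f (g (φ z + L a.1)) + N a.2))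
      {p | p.1 ∈ X ∧ f p.1 ∈ openFace b α ∧ p.2 ∈ simplex b ∧ p.2 - f p.1 ∈ (faceDir b α)ᗮ}
      ((faceDir b α : Set (EuclideanSpace ℝ (Fin k))) ×ˢ Set.Ici 0) (z, f z) := by
    refine GermHomeo.of_eq (y := (0, 0)) ?_ ?_ ?_ hφ' (hg.prodMk hu) ?_ ?_
    · refine Prod.ext ?_ (funext fun j => hα.2 j j.2)
      simp
    · exact ⟨hz, hα, hf.mapsTo hz, by rw [sub_self]; exact Submodule.zero_mem _⟩
    · exact ⟨Submodule.zero_mem _, Set.self_mem_Ici⟩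
    · have h1 : Filter.Tendsto Prod.fst (𝓝[{p : E × EuclideanSpace ℝ (Fin k) | p.1 ∈ X ∧
          f p.1 ∈ openFace b α ∧ p.2 ∈ simplex b ∧ p.2 - f p.1 ∈ (faceDir b α)ᗮ}] (z, f z))
          (𝓝[X ∩ f ⁻¹' openFace b α] z) :=
        tendsto_nhdsWithin_of_tendsto_nhds_of_eventually_within _
          continuous_fst.continuousWithinAt (Filter.mem_of_superset self_mem_nhdsWithin
            fun p hp => ⟨hp.1, hp.2.1⟩)
      filter_upwards [h1.eventually hφ.left_inv, self_mem_nhdsWithin] with p h2 h3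
      refine ⟨⟨(J _).2, fun j => (mem_simplex_iff b).1 h3.2.2.1 j⟩, ?_⟩
      have h4 : g (φ z + L (J (φ p.1 - φ z))) = p.1 := by
        rw [hLJ, add_sub_cancel, h2.2]
      have h5 : (fun j : {j // j ∉ α} => b.coord j p.2) =
          fun j : {j // j ∉ α} => dcoord b j (p.2 - f p.1) := by
        ext j
        rw [dcoord_sub, h3.2.1.2 j j.2, sub_zero]
      simp only [h4]
      rw [h5, hN3 _ h3.2.2.2, add_sub_cancel]
    · have h1 := hu.continuousWithinAt.tendsto
      have h2 : f (g (φ z + L (0 : EuclideanSpace ℝ (Fin k)))) +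
          N (0 : {j // j ∉ α} → ℝ) = f z := by rw [hgz, map_zero, add_zero]
      simp only [h2] at h1
      filter_upwards [hgev, h1.eventually (eventually_coord_pos b hα), self_mem_nhdsWithin]
        with a h3 h4 h5
      have h6 : ∀ j : {j // j ∉ α},
          b.coord j (f (g (φ z + L a.1)) + N a.2) = a.2 j := fun j => by
        rw [coord_add, hN2, h3.1.2.2 j j.2, zero_add]
      refine ⟨⟨h3.1.1, h3.1.2, (mem_simplex_iff b).2 fun i => ?_, ?_⟩, ?_⟩
      · by_cases hi : i ∈ α
        · exact (h4 i hi).le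
        · exact (h6 ⟨i, hi⟩).symm ▸ h5.2 ⟨i, hi⟩
      · simp only [add_sub_cancel_left]
        exact hN1 _
      · refine Prod.ext ?_ (funext h6)
        simp only [h3.2, add_sub_cancel_left]
        exact hJL _ h5.1
  refine ⟨fun x => J (φ (r x) - φ z), _, ?_, hξ.trans (T := _) (by rwa [hrz])⟩
  simp only [hrz, sub_self, map_zero]
  rfl

end FaceModel

/-! ### The orthant with an attached collar. -/

section CollarModel

set_option linter.unusedSectionVars false

variable {k : ℕ} {b : AffineBasis (Fin (k + 1)) ℝ (EuclideanSpace ℝ (Fin k))}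
  {E : Type*} [NormedAddCommGroup E] [NormedSpace ℝ E] [FiniteDimensional ℝ E]
  {X : Set E} {f : E → EuclideanSpace ℝ (Fin k)} {α : Finset (Fin (k + 1))}

/-- The size of the most negative coordinate. -/
noncomputable def negSup {ι : Type*} [Fintype ι] (e : ι → ℝ) : ℝ :=
  (Finset.univ : Finset (Option ι)).sup' ⟨none, Finset.mem_univ _⟩
    fun o => o.elim 0 fun j => -e j

section NegSup

variable {ι : Type*} [Fintype ι]

theorem negSup_nonneg (e : ι → ℝ) : 0 ≤ negSup e :=
  Finset.le_sup' (fun o : Option ι => o.elim 0 fun j => -e j) (Finset.mem_univ none)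

theorem neg_le_negSup (e : ι → ℝ) (j : ι) : -e j ≤ negSup e :=
  Finset.le_sup' (fun o : Option ι => o.elim 0 fun j => -e j) (Finset.mem_univ (some j))

theorem negSup_eq (e : ι → ℝ) : negSup e = 0 ∨ ∃ j, negSup e = -e j := by
  obtain ⟨o, -, ho⟩ := Finset.exists_mem_eq_sup' (s := (Finset.univ : Finset (Option ι)))
    ⟨none, Finset.mem_univ _⟩ fun o => o.elim 0 fun j => -e j
  rcases o with _ | j
  · exact Or.inl ho
  · exact Or.inr ⟨j, ho⟩

/-- A point of the orthant with collar has a vanishing coordinate as soon as its height `t` is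
positive, so `t` can be read off from the differences `y j - t`. This inverts the passage from the
collared orthant to the vector space. -/
theorem negSup_sub {y : ι → ℝ} {t : ℝ} (hy : 0 ≤ y) (ht : 0 ≤ t) (h : t = 0 ∨ ∃ j, y j = 0) :
    negSup (fun j => y j - t) = t := by
  apply le_antisymm
  · rcases negSup_eq fun j => y j - t with h1 | ⟨j, h1⟩
    · rw [h1]; exact ht
    · have := hy j
      rw [Pi.zero_apply] at this
      rw [h1]
      linarith
  · rcases h with h | ⟨j, h⟩
    · rw [h]; exact negSup_nonneg _
    · have := neg_le_negSup (fun j => y j - t) j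
      simp only [h] at this
      linarith

theorem plAt_negSup (e : ι → ℝ) : PLAt negSup Set.univ e :=
  PLAt.sup' _ _ fun o _ => by
    rcases o with _ | j
    · exact PLAt.const 0 (PolyAt.univ e)
    · exact (PLAt.linear (LinearMap.proj j) (PolyAt.univ e)).neg

end NegSup

theorem mem_faceBoundary_univ {u : EuclideanSpace ℝ (Fin k)} :
    u ∈ faceBoundary b Finset.univ ↔ u ∈ simplex b ∧ ∃ i, b.coord i u = 0 := by
  refine and_congr_right fun hu => ?_
  have h := (mem_simplex_iff b).1 hu
  constructor
  · intro h1
    by_contra! hcon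
    exact h1 ⟨fun i _ => lt_of_le_of_ne (h i) (hcon i).symm, fun i hi =>
      absurd (Finset.mem_univ i) hi⟩
  · rintro ⟨i, hi⟩ h1
    exact (h1.1 i (Finset.mem_univ i)).ne' hi

theorem isPolytope_simplex : IsPolytope (simplex b) :=
  isPolytope_convexHull ((Finset.finite_toSet _).image _)

/-- On the simplex the largest negated coordinate is at most zero, and it is zero exactly on the
boundary. -/
theorem polyAt_faceBoundary (u : EuclideanSpace ℝ (Fin k)) :
    PolyAt (faceBoundary b Finset.univ) u := by
  have h1 : PLAt (fun u => Finset.univ.sup' Finset.univ_nonempty fun i => -b.coord i u)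
      (simplex b) u :=
    PLAt.sup' _ _ fun i _ => (plAt_coord (f := fun u => u) (isPolytope_simplex.polyAt u) i).neg
  have h2 := PolyAt.preimage h1 (PolyAt.singleton (0 : ℝ) _)
  convert h2 using 1
  ext v
  rw [mem_faceBoundary_univ, Set.mem_inter_iff]
  refine and_congr_right fun hv => ?_
  have h := (mem_simplex_iff b).1 hv
  rw [Set.mem_preimage, Set.mem_singleton_iff]
  constructor
  · rintro ⟨i, hi⟩
    refine le_antisymm (Finset.sup'_le _ _ fun j _ => neg_nonpos.2 (h j)) ?_
    have := Finset.le_sup' (fun i => -b.coord i v) (Finset.mem_univ i)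
    rwa [hi, neg_zero] at this
  · intro h3
    obtain ⟨i, -, hi⟩ := Finset.exists_mem_eq_sup' Finset.univ_nonempty fun i => -b.coord i v
    exact ⟨i, by rw [h3] at hi; linarith⟩

/-- Adding a collar turns the local product with an orthant into a product with a vector space. -/
theorem exists_collarModel {z : E} (hα : f z ∈ openFace b α)
    (hfX : Set.MapsTo f X (simplex b)) (hfz : PLAt f X z) {c : E → EuclideanSpace ℝ (Fin k)}
    {Ψ : EuclideanSpace ℝ (Fin k) × ({j // j ∉ α} → ℝ) → E}
    (h : GermHomeo (fun x => (c x, fun j : {j // j ∉ α} => b.coord j (f x))) Ψ X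
      ((faceDir b α : Set (EuclideanSpace ℝ (Fin k))) ×ˢ Set.Ici 0) z) {M : Set (E × ℝ)}
    (hM : M = X ×ˢ {0} ∪ (X ∩ f ⁻¹' faceBoundary b Finset.univ) ×ˢ Set.Icc 0 1) :
    ∃ Ψ' : EuclideanSpace ℝ (Fin k) × ({j // j ∉ α} → ℝ) → E × ℝ,
      GermHomeo (fun q => (c q.1, fun j : {j // j ∉ α} => b.coord j (f q.1) - q.2)) Ψ' M
        ((faceDir b α : Set (EuclideanSpace ℝ (Fin k))) ×ˢ Set.univ) (z, 0) := by
  have hX := hfz.polyAt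
  have hMp : PolyAt M (z, 0) := by
    rw [hM]
    exact (hX.prod (PolyAt.singleton 0 0)).union
      ((PolyAt.preimage hfz (polyAt_faceBoundary _)).prod (PolyAt.Icc 0 1 0))
  have hMX : ∀ q ∈ M, q.1 ∈ X ∧ 0 ≤ q.2 ∧ q.2 ≤ 1 ∧ (q.2 = 0 ∨ ∃ i, b.coord i (f q.1) = 0) := by
    intro q hq
    rw [hM] at hq
    rcases hq with ⟨h1, h2⟩ | ⟨⟨h1, h2⟩, h3⟩
    · rw [Set.mem_singleton_iff] at h2
      exact ⟨h1, h2.ge, h2 ▸ zero_le_one, Or.inl h2⟩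
    · exact ⟨h1, h3.1, h3.2, Or.inr (mem_faceBoundary_univ.1 h2).2⟩
  have ht1 : Filter.Tendsto Prod.fst (𝓝[M] (z, (0 : ℝ))) (𝓝[X] z) :=
    tendsto_nhdsWithin_of_tendsto_nhds_of_eventually_within _
      continuous_fst.continuousWithinAt (Filter.mem_of_superset self_mem_nhdsWithin
        fun q hq => (hMX q hq).1)
  have hXM : ∀ᶠ q in 𝓝[M] (z, (0 : ℝ)), q.1 ∈ X :=
    Filter.mem_of_superset self_mem_nhdsWithin fun q hq => (hMX q hq).1
  have hz0 : (fun j : {j // j ∉ α} => b.coord j (f z)) = 0 := funext fun j => hα.2 j j.2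
  have hP := (polyAt_submodule (faceDir b α) (c z)).prod (PolyAt.univ (0 : {j // j ∉ α} → ℝ))
  have hτ : PLAt (fun a : EuclideanSpace ℝ (Fin k) × ({j // j ∉ α} → ℝ) => negSup a.2)
      ((faceDir b α : Set (EuclideanSpace ℝ (Fin k))) ×ˢ Set.univ) (c z, 0) :=
    PLAt.comp (f := Prod.snd) (plAt_negSup _) hP.snd (Filter.Eventually.of_forall fun _ => trivial)
  have hτ0 : negSup (0 : {j // j ∉ α} → ℝ) = 0 := by
    have := negSup_sub (y := (0 : {j // j ∉ α} → ℝ)) le_rfl le_rfl (Or.inl rfl)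
    simp only [sub_zero] at this
    exact this
  have hs : PLAt (fun a : EuclideanSpace ℝ (Fin k) × ({j // j ∉ α} → ℝ) =>
      (a.1, fun j => a.2 j + negSup a.2))
      ((faceDir b α : Set (EuclideanSpace ℝ (Fin k))) ×ˢ Set.univ) (c z, 0) :=
    hP.fst.prodMk (PLAt.pi hP fun j => (hP.snd.linear_comp (LinearMap.proj j)).add hτ)
  have hs0 : ((c z, fun j => (0 : {j // j ∉ α} → ℝ) j + negSup (0 : {j // j ∉ α} → ℝ)) :
      EuclideanSpace ℝ (Fin k) × ({j // j ∉ α} → ℝ)) =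
      (c z, fun j : {j // j ∉ α} => b.coord j (f z)) := by
    rw [hτ0, hz0]
    simp only [add_zero]
  have hsm : ∀ᶠ a in 𝓝[(faceDir b α : Set (EuclideanSpace ℝ (Fin k))) ×ˢ Set.univ]
      ((c z, 0) : EuclideanSpace ℝ (Fin k) × ({j // j ∉ α} → ℝ)),
      ((a.1, fun j => a.2 j + negSup a.2) : EuclideanSpace ℝ (Fin k) × ({j // j ∉ α} → ℝ)) ∈
      (faceDir b α : Set (EuclideanSpace ℝ (Fin k))) ×ˢ Set.Ici (0 : {j // j ∉ α} → ℝ) :=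
    Filter.mem_of_superset self_mem_nhdsWithin fun a ha => ⟨ha.1, fun j => by
      have := neg_le_negSup a.2 j
      simp only [Pi.zero_apply]
      linarith⟩
  -- From `e_j = y_j - t` recover `t` as the size of the most negative `e_j` and then `y_j = e_j +
  -- t`. If `t > 0`, the index attaining it has `y_j = 0`, which puts the point over the boundary.
  refine ⟨fun a => (Ψ (a.1, fun j => a.2 j + negSup a.2), negSup a.2),
    GermHomeo.of_eq (y := (c z, 0)) ?_ ?_ ?_ ?_ ?_ ?_ ?_⟩
  · simp only [sub_zero, hz0]
  · rw [hM]
    exact Or.inl ⟨h.mem, rfl⟩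
  · exact ⟨h.map_mem.1, trivial⟩
  · have h1 : PLAt (fun q : E × ℝ => c q.1) M (z, 0) :=
      PLAt.comp (f := Prod.fst) h.plAt.fst hMp.fst hXM
    have h2 : PLAt (fun q : E × ℝ => f q.1) M (z, 0) :=
      PLAt.comp (f := Prod.fst) hfz hMp.fst hXM
    exact h1.prodMk (PLAt.pi hMp fun j => (plAt_coord h2 j).sub hMp.snd)
  · refine PLAt.prodMk (PLAt.comp (g := Ψ) ?_ hs hsm) hτ
    simp only [hs0]
    exact h.plAt_inv
  · filter_upwards [ht1.eventually h.left_inv, self_mem_nhdsWithin,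
      ht1.eventually (hfz.continuousWithinAt.eventually (eventually_coord_pos b hα))]
      with q h1 h2 h3
    obtain ⟨h4, h5, -, h7⟩ := hMX q h2
    refine ⟨⟨h1.1.1, trivial⟩, ?_⟩
    -- The vanishing coordinate of a collar point must be off `α`, because those in `α` are positive
    -- near `z`.
    have h8 : negSup (fun j : {j // j ∉ α} => b.coord j (f q.1) - q.2) = q.2 := by
      refine negSup_sub h1.1.2 h5 (h7.imp_right ?_)
      rintro ⟨i, hi⟩
      exact ⟨⟨i, fun hiα => (h3 i hiα).ne' hi⟩, hi⟩
    simp only [h8, sub_add_cancel, h1.2]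
  · have h1 := tendsto_nhdsWithin_of_tendsto_nhds_of_eventually_within _
      hs.continuousWithinAt.tendsto hsm
    simp only [hs0] at h1
    have h2 := hτ.continuousWithinAt.tendsto
    simp only [hτ0] at h2
    filter_upwards [h1.eventually h.right_inv, h2.eventually (gt_mem_nhds one_pos)] with a h3 h4
    have h5 := congrArg Prod.fst h3.2
    have h6 := fun j => congrFun (congrArg Prod.snd h3.2) j
    simp only at h5 h6
    refine ⟨?_, Prod.ext h5 (funext fun j => ?_)⟩
    · rw [hM]
      rcases negSup_eq a.2 with h7 | ⟨j, h7⟩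
      · exact Or.inl ⟨h3.1, h7⟩
      · refine Or.inr ⟨⟨h3.1, mem_faceBoundary_univ.2 ⟨hfX h3.1, j, ?_⟩⟩, negSup_nonneg _, h4.le⟩
        rw [h6, h7, add_neg_cancel]
    · simp only [h6, add_sub_cancel_right]

end CollarModel

/-! ### The local normal form for the difference of the two maps. -/

section ProductGerm

set_option linter.unusedSectionVars false

variable {k : ℕ} {b : AffineBasis (Fin (k + 1)) ℝ (EuclideanSpace ℝ (Fin k))}
  {E Q : Type*} [NormedAddCommGroup E] [NormedSpace ℝ E] [FiniteDimensional ℝ E]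
  [NormedAddCommGroup Q] [NormedSpace ℝ Q] [FiniteDimensional ℝ Q]
  {K : Geometry.SimplicialComplex ℝ E} {α : Finset (Fin (k + 1))}

/-- The difference of the folding map and a map with a good local model is, up to a change of
coordinates in the complex, a projection. -/
theorem exists_productGerm (hfin : K.faces.Finite) (hdim : ∀ σ ∈ K.faces, σ.card ≤ k + 1)
    {s₀ : E} (hs₀ : s₀ ∈ K.space) (hα : foldMap b K s₀ ∈ openFace b α)
    {M : Set Q} {q₀ : Q} {c : Q → EuclideanSpace ℝ (Fin k)} {e : Q → ({j // j ∉ α} → ℝ)}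
    {Ψ : EuclideanSpace ℝ (Fin k) × ({j // j ∉ α} → ℝ) → Q}
    (h : GermHomeo (fun q => (c q, e q)) Ψ M
      ((faceDir b α : Set (EuclideanSpace ℝ (Fin k))) ×ˢ Set.univ) q₀) (hc0 : c q₀ = 0)
    {F : Q → EuclideanSpace ℝ (Fin k)} (hF : PLAt F M q₀) (hF0 : F q₀ = foldMap b K s₀)
    (hFc : ∀ᶠ q in 𝓝[M] q₀, ∀ j : {j // j ∉ α}, b.coord j (F q) = e q j) :
    ∃ (γ : E × Q → E) (g : E × EuclideanSpace ℝ (Fin k) → E × Q),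
      GermHomeo (fun w => (γ w, foldMap b K w.1 - F w.2)) g (K.space ×ˢ M) (K.space ×ˢ Set.univ)
        (s₀, q₀) := by
  obtain ⟨Λ, hΛ⟩ := exists_slide b hfin hdim hs₀ hα
  set y₀ := foldMap b K s₀ with hy₀
  set p := foldMap b K with hp
  let P : EuclideanSpace ℝ (Fin k) →ₗ[ℝ] EuclideanSpace ℝ (Fin k) := (faceDir b α).starProjection
  have hPmem : ∀ u, P u ∈ faceDir b α := fun u => (faceDir b α).starProjection_apply_mem u
  have hPid : ∀ u ∈ faceDir b α, P u = u := fun u hu => Submodule.starProjection_eq_self_iff.2 hu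
  have hpl : PLAt p K.space s₀ := isPLOn_iff.1 (isPLOn_foldMap b hfin) s₀ hs₀
  have hMp := h.plAt.polyAt
  have hW : PolyAt (K.space ×ˢ M) (s₀, q₀) := hpl.polyAt.prod hMp
  have hY : PolyAt (K.space ×ˢ (Set.univ : Set (EuclideanSpace ℝ (Fin k)))) (s₀, 0) :=
    hpl.polyAt.prod (PolyAt.univ 0)
  have he0 : e q₀ = 0 := funext fun j => by
    rw [← hFc.self_of_nhdsWithin h.mem j, hF0]
    exact hα.2 j j.2
  -- pieces of the forward map
  have hpw : PLAt (fun w : E × Q => p w.1) (K.space ×ˢ M) (s₀, q₀) :=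
    PLAt.comp (f := Prod.fst) hpl hW.fst (Filter.mem_of_superset self_mem_nhdsWithin
      fun w hw => hw.1)
  have hcw : PLAt (fun w : E × Q => c w.2) (K.space ×ˢ M) (s₀, q₀) :=
    PLAt.comp (f := Prod.snd) h.plAt.fst hW.snd (Filter.mem_of_superset self_mem_nhdsWithin
      fun w hw => hw.2)
  have hFw : PLAt (fun w : E × Q => F w.2) (K.space ×ˢ M) (s₀, q₀) :=
    PLAt.comp (f := Prod.snd) hF hW.snd (Filter.mem_of_superset self_mem_nhdsWithin
      fun w hw => hw.2)
  have huw : PLAt (fun w : E × Q => c w.2 - P (p w.1 - y₀)) (K.space ×ˢ M) (s₀, q₀) :=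
    hcw.sub ((hpw.sub (PLAt.const y₀ hW)).linear_comp P)
  have hu0 : c q₀ - P (p s₀ - y₀) = 0 := by rw [hc0, ← hy₀, sub_self, map_zero, sub_zero]
  -- pieces of the inverse map
  have hpd : PLAt (fun w : E × EuclideanSpace ℝ (Fin k) => p w.1) (K.space ×ˢ Set.univ) (s₀, 0) :=
    PLAt.comp (f := Prod.fst) hpl hY.fst (Filter.mem_of_superset self_mem_nhdsWithin
      fun w hw => hw.1)
  -- The model coordinates of `q`, computed from the slid point `s'` and the difference `d`: its
  -- face part is `P(p(s') - y₀)`, and its normal part consists of the coordinates of `p(s') - d`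
  -- off `α`.
  let a : E × EuclideanSpace ℝ (Fin k) → EuclideanSpace ℝ (Fin k) × ({j // j ∉ α} → ℝ) :=
    fun w => (P (p w.1 - y₀), fun j => b.coord j (p w.1 - w.2))
  have ha : PLAt a (K.space ×ˢ Set.univ) (s₀, 0) :=
    ((hpd.sub (PLAt.const y₀ hY)).linear_comp P).prodMk (plAt_coords (hpd.sub hY.snd) α)
  have ha0 : a (s₀, 0) = (c q₀, e q₀) := by
    refine Prod.ext ?_ (funext fun j => ?_)
    · simp only [a, ← hy₀, sub_self, map_zero, hc0]
    · simp only [a, ← hy₀, sub_zero, he0]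
      exact hα.2 j j.2
  have ham : ∀ᶠ w in 𝓝[K.space ×ˢ (Set.univ : Set (EuclideanSpace ℝ (Fin k)))] (s₀, 0),
      a w ∈ (faceDir b α : Set (EuclideanSpace ℝ (Fin k))) ×ˢ Set.univ :=
    Filter.Eventually.of_forall fun w => ⟨hPmem _, trivial⟩
  have hat : Filter.Tendsto a (𝓝[K.space ×ˢ (Set.univ : Set (EuclideanSpace ℝ (Fin k)))] (s₀, 0))
      (𝓝[(faceDir b α : Set (EuclideanSpace ℝ (Fin k))) ×ˢ Set.univ] (c q₀, e q₀)) := by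
    have := tendsto_nhdsWithin_of_tendsto_nhds_of_eventually_within _
      ha.continuousWithinAt.tendsto ham
    rwa [ha0] at this
  have hq : PLAt (fun w => Ψ (a w)) (K.space ×ˢ Set.univ) (s₀, 0) :=
    PLAt.comp (g := Ψ) (ha0 ▸ h.plAt_inv) ha ham
  have hq0 : Ψ (a (s₀, 0)) = q₀ := by rw [ha0]; exact h.apply_inv
  have hqM : ∀ᶠ w in 𝓝[K.space ×ˢ (Set.univ : Set (EuclideanSpace ℝ (Fin k)))] (s₀, 0),
      Ψ (a w) ∈ M := (hat.eventually h.right_inv).mono fun w hw => hw.1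
  have hFd : PLAt (fun w => F (Ψ (a w))) (K.space ×ˢ Set.univ) (s₀, 0) :=
    PLAt.comp (g := F) (by rw [hq0]; exact hF) hq hqM
  -- Once `q` is known, `p(s) = d + F(q)`, and `u = p(s) - p(s')` is the displacement that undoes
  -- the slide.
  let u : E × EuclideanSpace ℝ (Fin k) → EuclideanSpace ℝ (Fin k) :=
    fun w => w.2 - (p w.1 - F (Ψ (a w)))
  have hu : PLAt u (K.space ×ˢ Set.univ) (s₀, 0) := hY.snd.sub (hpd.sub hFd)
  have hu0' : u (s₀, 0) = 0 := by
    simp only [u, hq0, hF0, ← hy₀, sub_self]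
  refine ⟨fun w => w.1 + Λ (c w.2 - P (p w.1 - y₀)), fun w => (w.1 + Λ (u w), Ψ (a w)),
    GermHomeo.of_eq (y := (s₀, 0)) ?_ ⟨hs₀, h.mem⟩ ⟨hs₀, trivial⟩
      ((hW.fst.add (huw.linear_comp Λ)).prodMk (hpw.sub hFw))
      ((hY.fst.add (hu.linear_comp Λ)).prodMk hq) ?_ ?_⟩
  · simp only [hc0, map_zero, add_zero, hF0, ← hy₀, sub_self]
  · have h1 : Filter.Tendsto (fun w : E × Q => (w.1, c w.2 - P (p w.1 - y₀)))
        (𝓝[K.space ×ˢ M] (s₀, q₀)) (𝓝 (s₀, 0)) := by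
      have := (hW.fst.prodMk huw).continuousWithinAt.tendsto
      simp only [hu0] at this
      exact this
    have h2 : Filter.Tendsto Prod.snd (𝓝[K.space ×ˢ M] (s₀, q₀)) (𝓝[M] q₀) :=
      tendsto_nhdsWithin_of_tendsto_nhds_of_eventually_within _
        continuous_snd.continuousWithinAt (Filter.mem_of_superset self_mem_nhdsWithin
          fun q hq => hq.2)
    filter_upwards [h1.eventually hΛ, h2.eventually h.left_inv, h2.eventually hFc,
      self_mem_nhdsWithin] with w h3 h4 h5 h6
    have hd : c w.2 - P (p w.1 - y₀) ∈ faceDir b α := Submodule.sub_mem _ h4.1.1 (hPmem _)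
    obtain ⟨h7, h8⟩ := h3 h6.1 hd
    refine ⟨⟨h7, trivial⟩, ?_⟩
    -- The slide replaces the face part of `p(s) - y₀` by `c(q)` and does not affect the coordinates
    -- off `α`.
    have h9 : a (w.1 + Λ (c w.2 - P (p w.1 - y₀)), p w.1 - F w.2) = (c w.2, e w.2) := by
      refine Prod.ext ?_ (funext fun j => ?_)
      · simp only [a, h8]
        rw [add_sub_right_comm, map_add, hPid _ hd, add_sub_cancel]
      · simp only [a, h8]
        rw [← h5 j, show p w.1 + (c w.2 - P (p w.1 - y₀)) - (p w.1 - F w.2) =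
          F w.2 + (c w.2 - P (p w.1 - y₀)) by abel, coord_add, (mem_faceDir b).1 hd j j.2,
          add_zero]
    simp only [u, h9, h4.2, h8]
    refine Prod.ext ?_ rfl
    simp only
    rw [show p w.1 - F w.2 - (p w.1 + (c w.2 - P (p w.1 - y₀)) - F w.2) =
      -(c w.2 - P (p w.1 - y₀)) by abel, map_neg, add_neg_cancel_right]
  · have h1 : Filter.Tendsto (fun w : E × EuclideanSpace ℝ (Fin k) => (w.1, u w))
        (𝓝[K.space ×ˢ Set.univ] (s₀, 0)) (𝓝 (s₀, 0)) := by
      have := (hY.fst.prodMk hu).continuousWithinAt.tendsto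
      simp only [hu0'] at this
      exact this
    have h2 : Filter.Tendsto (fun w => Ψ (a w)) (𝓝[K.space ×ˢ Set.univ] (s₀, 0)) (𝓝[M] q₀) := by
      have := tendsto_nhdsWithin_of_tendsto_nhds_of_eventually_within _
        hq.continuousWithinAt.tendsto hqM
      rwa [hq0] at this
    filter_upwards [h1.eventually hΛ, hat.eventually h.right_inv, h2.eventually hFc,
      self_mem_nhdsWithin] with w h3 h4 h5 h6
    have h7 := congrArg Prod.fst h4.2
    have h8 := fun j => congrFun (congrArg Prod.snd h4.2) j
    simp only at h7 h8
    -- By the choice of `a`, the coordinates of `F(q)` and of `p(s') - d` agree off `α`; hence their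
    -- difference is a face direction and the slide applies.
    have hd : u w ∈ faceDir b α := (mem_faceDir b).2 fun j hj => by
      have h9 : b.coord j (F (Ψ (a w))) = b.coord j (p w.1 - w.2) :=
        (h5 ⟨j, hj⟩).trans (h8 ⟨j, hj⟩)
      rw [show u w = F (Ψ (a w)) - (p w.1 - w.2) by simp only [u]; abel, dcoord_sub, h9, sub_self]
    obtain ⟨h10, h11⟩ := h3 h6.1 hd
    refine ⟨⟨h10, h4.1⟩, ?_⟩
    refine Prod.ext ?_ ?_
    · simp only [h11, h7]
      rw [show (a w).1 = P (p w.1 - y₀) from rfl, add_sub_right_comm, map_add, hPid _ hd,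
        ← sub_sub, sub_self, zero_sub, map_neg, add_neg_cancel_right]
    · simp only [h11, u]
      abel

end ProductGerm

/-! ### From germs to charts and linear subspaces. -/

section Charts

set_option linter.unusedSectionVars false

variable {E F E' F' : Type*} [NormedAddCommGroup E] [NormedSpace ℝ E] [FiniteDimensional ℝ E]
  [NormedAddCommGroup F] [NormedSpace ℝ F] [FiniteDimensional ℝ F]
  [NormedAddCommGroup E'] [NormedSpace ℝ E'] [FiniteDimensional ℝ E']
  [NormedAddCommGroup F'] [NormedSpace ℝ F'] [FiniteDimensional ℝ F']

theorem GermHomeo.prod {f : E → F} {g : F → E} {S : Set E} {T : Set F} {x : E}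
    {f' : E' → F'} {g' : F' → E'} {S' : Set E'} {T' : Set F'} {x' : E'}
    (h : GermHomeo f g S T x) (h' : GermHomeo f' g' S' T' x') :
    GermHomeo (fun p => (f p.1, f' p.2)) (fun q => (g q.1, g' q.2)) (S ×ˢ S') (T ×ˢ T')
      (x, x') := by
  have hS := h.plAt.polyAt.prod h'.plAt.polyAt
  have hT := h.plAt_inv.polyAt.prod h'.plAt_inv.polyAt
  refine ⟨⟨h.mem, h'.mem⟩, ⟨h.map_mem, h'.map_mem⟩, ?_, ?_, ?_, ?_⟩
  · exact (PLAt.comp (f := Prod.fst) h.plAt hS.fst (Filter.mem_of_superset self_mem_nhdsWithin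
      fun p hp => hp.1)).prodMk (PLAt.comp (f := Prod.snd) h'.plAt hS.snd
        (Filter.mem_of_superset self_mem_nhdsWithin fun p hp => hp.2))
  · exact (PLAt.comp (f := Prod.fst) h.plAt_inv hT.fst (Filter.mem_of_superset self_mem_nhdsWithin
      fun p hp => hp.1)).prodMk (PLAt.comp (f := Prod.snd) h'.plAt_inv hT.snd
        (Filter.mem_of_superset self_mem_nhdsWithin fun p hp => hp.2))
  · rw [nhdsWithin_prod_eq]
    filter_upwards [h.left_inv.prod_mk h'.left_inv] with p hp
    exact ⟨⟨hp.1.1, hp.2.1⟩, Prod.ext hp.1.2 hp.2.2⟩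
  · rw [nhdsWithin_prod_eq]
    filter_upwards [h.right_inv.prod_mk h'.right_inv] with p hp
    exact ⟨⟨hp.1.1, hp.2.1⟩, Prod.ext hp.1.2 hp.2.2⟩

theorem germHomeo_linearEquiv (e : E ≃ₗ[ℝ] F) (x : E) :
    GermHomeo e e.symm Set.univ Set.univ x :=
  ⟨trivial, trivial, PLAt.linear e.toLinearMap (PolyAt.univ x),
    PLAt.linear e.symm.toLinearMap (PolyAt.univ _),
    Filter.Eventually.of_forall fun y => ⟨trivial, e.symm_apply_apply y⟩,
    Filter.Eventually.of_forall fun y => ⟨trivial, e.apply_symm_apply y⟩⟩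

theorem germHomeo_id {S : Set E} {x : E} (hx : x ∈ S) (hS : PolyAt S x) :
    GermHomeo (fun y => y) (fun y => y) S S x :=
  ⟨hx, hx, hS, hS, Filter.mem_of_superset self_mem_nhdsWithin fun _ hy => ⟨hy, rfl⟩,
    Filter.mem_of_superset self_mem_nhdsWithin fun _ hy => ⟨hy, rfl⟩⟩

/-- A germ of a homeomorphism onto a vector space gives a chart, in which the sets that correspond
to linear subspaces are linear subspaces. -/
theorem GermHomeo.exists_chart {n : ℕ} {f : E → F} {g : F → E} {W : Set E} {w : E}
    (h : GermHomeo f g W Set.univ w) (hn : Module.finrank ℝ F = n) {N : Set E} (hN : N ∈ 𝓝[W] w) :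
    ∃ (e : F ≃ₗ[ℝ] (Fin n → ℝ)) (O : Set E) (O' : Set (Fin n → ℝ)), w ∈ O ∧
      IsPLChart W O (fun y => e (f y)) O' ∧ ∀ (M : Set E) (A : Submodule ℝ F), M ⊆ W →
        (∀ y ∈ N, y ∈ M ↔ f y ∈ A) → (fun y => e (f y)) '' (M ∩ O) =
          (A.map e.toLinearMap : Set (Fin n → ℝ)) ∩ O' := by
  let e : F ≃ₗ[ℝ] (Fin n → ℝ) := LinearEquiv.ofFinrankEq F (Fin n → ℝ)
    (by rw [hn, Module.finrank_fin_fun])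
  obtain ⟨O, O', hO, hO', hwO, -, hON, -, hf, hg, hfm, hgm, hinv⟩ :=
    (h.trans (germHomeo_linearEquiv e (f w))).exists_isOpen hN Filter.univ_mem
  rw [Set.univ_inter] at hg hfm hgm hinv
  refine ⟨e, O, O', hwO, ⟨hO, hO', _, hf, hg, hfm, hgm, hinv⟩, fun M A hM hMA => ?_⟩
  ext a
  constructor
  · rintro ⟨y, ⟨hyM, hyO⟩, rfl⟩
    exact ⟨⟨f y, (hMA y (hON ⟨hM hyM, hyO⟩)).1 hyM, rfl⟩, hfm ⟨hM hyM, hyO⟩⟩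
  · rintro ⟨⟨v, hv, hva⟩, haO⟩
    have h1 := hgm haO
    have h2 := hinv.2 haO
    have h3 : f (g (e.symm a)) = v := e.injective (h2.trans hva.symm)
    exact ⟨_, ⟨(hMA _ (hON h1)).2 (h3.symm ▸ hv), h1.2⟩, h2⟩

theorem isLocallyFlat_of_germHomeo {m d : ℕ} {M W : Set E} (hM : M ⊆ W)
    (hd : Module.finrank ℝ F = d) (A : Submodule ℝ F) (hA : Module.finrank ℝ A = m)
    (h : ∀ w ∈ M, ∃ (f : E → F) (g : F → E), GermHomeo f g W Set.univ w ∧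
      ∀ᶠ y in 𝓝[W] w, y ∈ M ↔ f y ∈ A) : IsLocallyFlat m d M W := by
  refine ⟨hM, fun w hw => ?_⟩
  obtain ⟨f, g, hfg, hfA⟩ := h w hw
  obtain ⟨e, O, O', hwO, hc, himg⟩ := hfg.exists_chart hd hfA
  exact ⟨O, _, O', A.map e.toLinearMap, hwO, hc, by rw [LinearEquiv.finrank_map_eq, hA],
    himg M A hM fun y hy => hy⟩

/-- Linear coordinates on `F` transport the two model subspaces to `ℝᵈ` and preserve their sum. The
same two subspaces serve at all points of `M ∩ N`. -/
theorem areTransverse_of_germHomeo {d : ℕ} {M N W : Set E} (hM : M ⊆ W) (hN : N ⊆ W)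
    (hd : Module.finrank ℝ F = d) (A B : Submodule ℝ F) (hAB : A ⊔ B = ⊤)
    (h : ∀ w ∈ M ∩ N, ∃ (f : E → F) (g : F → E), GermHomeo f g W Set.univ w ∧
      ∀ᶠ y in 𝓝[W] w, (y ∈ M ↔ f y ∈ A) ∧ (y ∈ N ↔ f y ∈ B)) : AreTransverse d W M N := by
  refine ⟨hM, hN, fun w hw => ?_⟩
  obtain ⟨f, g, hfg, hfA⟩ := h w hw
  obtain ⟨e, O, O', hwO, hc, himg⟩ := hfg.exists_chart hd hfA
  refine ⟨O, _, O', A.map e.toLinearMap, B.map e.toLinearMap, hwO, hc, ?_,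
    himg M A hM fun y hy => hy.1, himg N B hN fun y hy => hy.2⟩
  rw [← Submodule.map_sup, hAB, Submodule.map_top, LinearEquiv.range]

theorem IsPLOn.plAt_of_isClosed {f : E → F} {S : Set E} (h : IsPLOn f S) (hS : IsClosed S)
    (x : E) : PLAt f S x := by
  by_cases hx : x ∈ S
  · exact isPLOn_iff.1 h x hx
  · refine PLAt.of_bot ?_
    rwa [← Filter.not_neBot, ← mem_closure_iff_nhdsWithin_neBot, hS.closure_eq]

end Charts

/-! ### Linearizing an arbitrary collar of the simplex. -/

section Straightening

set_option linter.unusedSectionVars false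

variable {k : ℕ} {b : AffineBasis (Fin (k + 1)) ℝ (EuclideanSpace ℝ (Fin k))}
  {α : Finset (Fin (k + 1))} {y₀ : EuclideanSpace ℝ (Fin k)}

/-- Linear coordinates adapted to a face: `P` is the projection to the face and `N` parametrizes
the normal directions by the coordinates at the opposite vertices. -/
structure IsFaceSplitting (b : AffineBasis (Fin (k + 1)) ℝ (EuclideanSpace ℝ (Fin k)))
    (α : Finset (Fin (k + 1))) (y₀ : EuclideanSpace ℝ (Fin k))
    (P : EuclideanSpace ℝ (Fin k) →ₗ[ℝ] EuclideanSpace ℝ (Fin k))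
    (N : ({j // j ∉ α} → ℝ) →ₗ[ℝ] EuclideanSpace ℝ (Fin k)) : Prop where
  mem : ∀ u, P u ∈ faceDir b α
  decomp : ∀ v, y₀ + P (v - y₀) + N (fun j => b.coord j v) = v
  proj : ∀ a ∈ faceDir b α, ∀ e, P (a + N e) = a
  coord : ∀ a ∈ faceDir b α, ∀ e, ∀ j : {j // j ∉ α}, b.coord j (y₀ + a + N e) = e j

theorem exists_isFaceSplitting (hα : y₀ ∈ openFace b α) : ∃ P N, IsFaceSplitting b α y₀ P N := by
  obtain ⟨N, hN1, hN2, hN3⟩ := exists_faceNormal b (nonempty_of_mem_openFace b hα)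
  refine ⟨(faceDir b α).starProjection.toLinearMap, N,
    fun u => (faceDir b α).starProjection_apply_mem u, fun v => ?_, fun a ha e => ?_,
    fun a ha e j => ?_⟩
  · have h1 : (fun j : {j // j ∉ α} => b.coord j v) = fun j : {j // j ∉ α} =>
        dcoord b j (v - y₀ - (faceDir b α).starProjection (v - y₀)) := by
      ext j
      rw [map_sub, dcoord_sub, hα.2 j j.2, (mem_faceDir b).1
        ((faceDir b α).starProjection_apply_mem (v - y₀)) j j.2, sub_zero, sub_zero]
    rw [h1, hN3 _ ((faceDir b α).sub_starProjection_mem_orthogonal _)]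
    simp
  · rw [map_add]
    have h1 : (faceDir b α).starProjection a = a := Submodule.starProjection_eq_self_iff.2 ha
    have h2 : (faceDir b α).starProjection (N e) = 0 :=
      (faceDir b α).starProjection_apply_eq_zero_iff.2 (hN1 e)
    simp [h1, h2]
  · rw [coord_add, coord_add, hN2, hα.2 j j.2, (mem_faceDir b).1 ha j j.2, zero_add, zero_add]

/-- The linear model of the collar map, in coordinates adapted to a face. -/
theorem IsFaceSplitting.germHomeo
    {P : EuclideanSpace ℝ (Fin k) →ₗ[ℝ] EuclideanSpace ℝ (Fin k)}
    {N : ({j // j ∉ α} → ℝ) →ₗ[ℝ] EuclideanSpace ℝ (Fin k)} (h : IsFaceSplitting b α y₀ P N)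
    (hα : y₀ ∈ openFace b α) :
    ∃ g, GermHomeo (fun q : EuclideanSpace ℝ (Fin k) × ℝ =>
        y₀ + P (q.1 - y₀) + N (fun j => b.coord j q.1 - q.2)) g
      (simplex b ×ˢ {0} ∪ faceBoundary b Finset.univ ×ˢ Set.Icc 0 1) Set.univ (y₀, 0) := by
  have hΔ : PolyAt (simplex b) y₀ := isPolytope_simplex.polyAt y₀
  have hy₀ : y₀ ∈ simplex b := by
    have := openFace_subset_face b hα
    exact (mem_simplex_iff b).2 ((mem_face_iff b).1 this).1
  have hc0 : (fun j : {j // j ∉ α} => b.coord j y₀) = 0 := funext fun j => hα.2 j j.2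
  have hB : PLAt (fun a : EuclideanSpace ℝ (Fin k) × ({j // j ∉ α} → ℝ) => y₀ + a.1 + N a.2)
      Set.univ (0, 0) :=
    ((PLAt.const y₀ (PolyAt.univ _)).add (PolyAt.univ _).fst).add
      ((PolyAt.univ _).snd.linear_comp N)
  have hBz : y₀ + (0 : EuclideanSpace ℝ (Fin k)) + N (0 : {j // j ∉ α} → ℝ) = y₀ := by
    rw [map_zero, add_zero, add_zero]
  have h1 : GermHomeo (fun u => (P (u - y₀), fun j : {j // j ∉ α} => b.coord j u))
      (fun a => y₀ + a.1 + N a.2) (simplex b)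
      ((faceDir b α : Set (EuclideanSpace ℝ (Fin k))) ×ˢ Set.Ici 0) y₀ := by
    refine GermHomeo.of_eq (y := (0, 0)) ?_ hy₀ ⟨Submodule.zero_mem _, Set.self_mem_Ici⟩
      (((hΔ.sub (PLAt.const _ hΔ)).linear_comp P).prodMk (plAt_coords hΔ α))
      (hB.mono ((polyAt_submodule _ _).prod (polyAt_Ici_pi _))
        (Filter.Eventually.of_forall fun _ => trivial)) ?_ ?_
    · simp only [sub_self, map_zero, hc0]
    · filter_upwards [self_mem_nhdsWithin] with u hu
      exact ⟨⟨h.mem _, fun j => (mem_simplex_iff b).1 hu j⟩, h.decomp u⟩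
    · have h2 := (hB.continuousWithinAt.tendsto)
      simp only [hBz, nhdsWithin_univ] at h2
      filter_upwards [self_mem_nhdsWithin,
        nhdsWithin_le_nhds (h2.eventually (eventually_coord_pos b hα))] with a ha ha'
      have h3 := h.coord a.1 ha.1 a.2
      refine ⟨(mem_simplex_iff b).2 fun i => ?_, Prod.ext ?_ (funext h3)⟩
      · by_cases hi : i ∈ α
        · exact (ha' i hi).le
        · exact (h3 ⟨i, hi⟩).symm ▸ ha.2 ⟨i, hi⟩
      · simp only
        rw [add_assoc, add_sub_cancel_left, h.proj _ ha.1]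
  -- The simplex with its identity map is itself an instance of the face model, with `P` as
  -- coordinate along the face.
  obtain ⟨Ψ, hΨ⟩ := exists_collarModel (X := simplex b) (f := fun u => u) hα (fun u hu => hu) hΔ h1
    (M := simplex b ×ˢ {0} ∪ faceBoundary b Finset.univ ×ˢ Set.Icc 0 1)
    (by rw [Set.preimage_id', Set.inter_eq_right.2 (show faceBoundary b Finset.univ ⊆ simplex b from
      fun u hu => hu.1)])
  have h2 : GermHomeo (fun a : EuclideanSpace ℝ (Fin k) × ({j // j ∉ α} → ℝ) => y₀ + a.1 + N a.2)
      (fun u => (P (u - y₀), fun j : {j // j ∉ α} => b.coord j u))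
      ((faceDir b α : Set (EuclideanSpace ℝ (Fin k))) ×ˢ Set.univ) Set.univ (0, 0) := by
    refine GermHomeo.of_eq (y := y₀) hBz ⟨Submodule.zero_mem _, trivial⟩ trivial
      (hB.mono ((polyAt_submodule _ _).prod (PolyAt.univ _))
        (Filter.Eventually.of_forall fun _ => trivial))
      ((((PolyAt.univ _).sub (PLAt.const _ (PolyAt.univ _))).linear_comp P).prodMk
        (plAt_coords (PolyAt.univ _) α)) ?_ ?_
    · filter_upwards [self_mem_nhdsWithin] with a ha
      refine ⟨trivial, Prod.ext ?_ (funext (h.coord a.1 ha.1 a.2))⟩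
      simp only
      rw [add_assoc, add_sub_cancel_left, h.proj _ ha.1]
    · exact Filter.Eventually.of_forall fun u => ⟨⟨h.mem _, trivial⟩, h.decomp u⟩
  have hb : ((P (y₀ - y₀), fun j : {j // j ∉ α} => b.coord j y₀ - 0) :
      EuclideanSpace ℝ (Fin k) × ({j // j ∉ α} → ℝ)) = (0, 0) := by
    simp only [sub_zero, sub_self, map_zero, hc0]
  rw [← hb] at h2
  exact ⟨_, hΨ.trans h2⟩

theorem interior_simplex : interior (simplex b) = openFace b Finset.univ := by
  have h : simplex b = convexHull ℝ (Set.range b) := by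
    rw [simplex, face, Finset.coe_univ, Set.image_univ]
  rw [h, b.interior_convexHull]
  ext u
  simp [openFace]

theorem isClosed_faceBoundary : IsClosed (faceBoundary b Finset.univ) := by
  rw [faceBoundary, ← interior_simplex]
  exact isPolytope_simplex.isCompact.isClosed.sdiff isOpen_interior

/-- Doubling about the barycenter replaces each coordinate `c` by `2c - 1/(k + 1)`. -/
theorem mem_bigSimplex_iff {u : EuclideanSpace ℝ (Fin k)} :
    u ∈ bigSimplex b ↔ ∀ i, -((k : ℝ) + 1)⁻¹ ≤ b.coord i u := by
  have hβ : ∀ i, b.coord i (Finset.univ.centroid ℝ b) = ((k : ℝ) + 1)⁻¹ := fun i => by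
    rw [b.coord_apply_centroid (Finset.mem_univ i), Finset.card_univ, Fintype.card_fin]
    push_cast
    rfl
  have hc : ∀ i v, b.coord i (AffineMap.homothety (Finset.univ.centroid ℝ b) (2 : ℝ) v) =
      2 * b.coord i v - ((k : ℝ) + 1)⁻¹ := fun i v => by
    rw [AffineMap.homothety_apply, vadd_eq_add, vsub_eq_sub, add_comm ((2 : ℝ) • _), coord_add, map_smul,
      dcoord_sub, hβ, smul_eq_mul]
    ring
  constructor
  · rintro ⟨v, hv, rfl⟩ i
    rw [hc]
    have := (mem_simplex_iff b).1 hv i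
    linarith
  · intro hu
    refine ⟨Finset.univ.centroid ℝ b + (2 : ℝ)⁻¹ • (u - Finset.univ.centroid ℝ b), ?_, ?_⟩
    · refine (mem_simplex_iff b).2 fun i => ?_
      rw [coord_add, map_smul, dcoord_sub, hβ, smul_eq_mul]
      have := hu i
      linarith
    · rw [AffineMap.homothety_apply, vsub_eq_sub, add_sub_cancel_left, smul_inv_smul₀ two_ne_zero,
        vadd_eq_add, sub_add_cancel]

theorem bigSimplex_mem_nhds (hy : y₀ ∈ simplex b) : bigSimplex b ∈ 𝓝 y₀ := by
  have : ∀ᶠ u in 𝓝 y₀, ∀ i, -((k : ℝ) + 1)⁻¹ < b.coord i u := by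
    rw [Filter.eventually_all]
    intro i
    refine (continuous_coord b i).continuousAt.eventually (lt_mem_nhds ?_)
    have h1 := (mem_simplex_iff b).1 hy i
    have h2 : 0 < ((k : ℝ) + 1)⁻¹ := by positivity
    linarith
  exact Filter.mem_of_superset this fun u hu => mem_bigSimplex_iff.2 fun i => (hu i).le

theorem isClosed_bigSimplex : IsClosed (bigSimplex b) := by
  have : bigSimplex b = ⋂ i, b.coord i ⁻¹' Set.Ici (-((k : ℝ) + 1)⁻¹) := by
    ext u
    simp [mem_bigSimplex_iff]
  rw [this]
  exact isClosed_iInter fun i => isClosed_Ici.preimage (continuous_coord b i)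

open Classical in
/-- The collar of the simplex given by a collar map is a neighbourhood of the simplex. -/
theorem IsCollarMap.germHomeo {G : EuclideanSpace ℝ (Fin k) × ℝ → EuclideanSpace ℝ (Fin k)}
    (hG : IsCollarMap b G) (hy : y₀ ∈ simplex b) :
    ∃ g, GermHomeo (fun q : EuclideanSpace ℝ (Fin k) × ℝ => if q.2 = 0 then q.1 else G q) g
      (simplex b ×ˢ {0} ∪ faceBoundary b Finset.univ ×ˢ Set.Icc 0 1) Set.univ (y₀, 0) := by
  obtain ⟨⟨g, hGpl, hgpl, hGm, hgm, hinv⟩, hG01⟩ := hG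
  have hI0 : (0 : ℝ) ∈ Set.Icc (0 : ℝ) 1 := ⟨le_rfl, zero_le_one⟩
  have hbd : ∀ u, u ∈ simplex b → u ∈ bigSimplex b \ interior (simplex b) →
      u ∈ faceBoundary b Finset.univ := fun u h1 h2 => ⟨h1, by
    rw [← interior_simplex]; exact h2.2⟩
  have hg0 : ∀ u ∈ faceBoundary b Finset.univ, g u = (u, 0) := fun u hu => by
    have := hinv.1 (x := (u, 0)) ⟨hu, hI0⟩
    rwa [(hG01 u hu).1] at this
  have hE0 : ∀ q ∈ faceBoundary b Finset.univ ×ˢ Set.Icc (0 : ℝ) 1,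
      (if q.2 = 0 then q.1 else G q) = G q := fun q hq => by
    split_ifs with h
    · rw [← (hG01 q.1 hq.1).1, ← h]
    · rfl
  have hS0 : PolyAt (simplex b ×ˢ {(0 : ℝ)}) (y₀, 0) :=
    (isPolytope_simplex.polyAt y₀).prod (PolyAt.singleton 0 0)
  have hR : IsClosed (bigSimplex b \ interior (simplex b)) :=
    isClosed_bigSimplex.sdiff isOpen_interior
  have hgS : ∀ u, u ∈ bigSimplex b \ interior (simplex b) →
      (if u ∈ simplex b then ((u, 0) : EuclideanSpace ℝ (Fin k) × ℝ) else g u) = g u :=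
    fun u hu => by
      split_ifs with h
      · exact (hg0 u (hbd u h hu)).symm
      · rfl
  refine ⟨fun u => if u ∈ simplex b then (u, 0) else g u, GermHomeo.of_eq (y := y₀) (if_pos rfl)
    (Or.inl ⟨hy, rfl⟩) trivial ?_ ?_ ?_ ?_⟩
  · refine PLAt.union ?_ ?_
    · exact hS0.fst.congr (Filter.mem_of_superset self_mem_nhdsWithin fun q hq => if_pos hq.2)
    · exact (hGpl.plAt_of_isClosed (isClosed_faceBoundary.prod isClosed_Icc) _).congr
        (Filter.mem_of_superset self_mem_nhdsWithin hE0)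
  · have h1 : PLAt (fun u => if u ∈ simplex b then ((u, 0) : EuclideanSpace ℝ (Fin k) × ℝ)
        else g u) (simplex b ∪ bigSimplex b \ interior (simplex b)) y₀ := by
      refine PLAt.union ?_ ?_
      · have h2 := isPolytope_simplex.polyAt (P := simplex b) y₀
        exact (h2.prodMk (PLAt.const (0 : ℝ) h2)).congr
          (Filter.mem_of_superset self_mem_nhdsWithin fun u hu => if_pos hu)
      · exact (hgpl.plAt_of_isClosed hR _).congr (Filter.mem_of_superset self_mem_nhdsWithin hgS)
    refine h1.congr_set ?_
    rw [nhdsWithin_univ]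
    refine nhdsWithin_eq_nhds.2 (Filter.mem_of_superset (bigSimplex_mem_nhds hy) fun u hu => ?_)
    by_cases h : u ∈ simplex b
    · exact Or.inl h
    · exact Or.inr ⟨hu, fun h' => h (interior_subset h')⟩
  · filter_upwards [self_mem_nhdsWithin] with q hq
    refine ⟨trivial, ?_⟩
    by_cases h : q.2 = 0
    · have h1 : q.1 ∈ simplex b := by
        rcases hq with h1 | h1
        · exact h1.1
        · exact h1.1.1
      simp only [if_pos h, if_pos h1]
      exact Prod.ext rfl h.symm
    · have h1 := hq.resolve_left fun h1 => h h1.2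
      simp only [if_neg h]
      rw [if_neg, hinv.1 h1]
      intro h2
      have h3 := hinv.1 h1
      rw [hg0 _ (hbd _ h2 (hGm h1))] at h3
      exact h (congrArg Prod.snd h3).symm
  · filter_upwards [nhdsWithin_le_nhds (bigSimplex_mem_nhds hy)] with u hu
    by_cases h : u ∈ simplex b
    · simp only [if_pos h, if_true]
      exact ⟨Or.inl ⟨h, rfl⟩, trivial⟩
    · have h1 : u ∈ bigSimplex b \ interior (simplex b) := ⟨hu, fun h' => h (interior_subset h')⟩
      simp only [if_neg h]
      exact ⟨Or.inr (hgm h1), (hE0 _ (hgm h1)).trans (hinv.2 h1)⟩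

open Classical in
/-- A homeomorphism of the ambient space near a point of the simplex, which is the identity on the
simplex and transforms a collar map to a linear one. -/
theorem IsCollarMap.exists_straightening
    {G : EuclideanSpace ℝ (Fin k) × ℝ → EuclideanSpace ℝ (Fin k)}
    (hG : IsCollarMap b G) (hα : y₀ ∈ openFace b α)
    {P : EuclideanSpace ℝ (Fin k) →ₗ[ℝ] EuclideanSpace ℝ (Fin k)}
    {N : ({j // j ∉ α} → ℝ) →ₗ[ℝ] EuclideanSpace ℝ (Fin k)} (h : IsFaceSplitting b α y₀ P N) :
    ∃ H H' : EuclideanSpace ℝ (Fin k) → EuclideanSpace ℝ (Fin k),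
      GermHomeo H H' Set.univ Set.univ y₀ ∧ H y₀ = y₀ ∧
      (∀ᶠ u in 𝓝 y₀, u ∈ simplex b → H u = u ∧ H' u = u) ∧
      ∀ᶠ q in 𝓝[simplex b ×ˢ {0} ∪ faceBoundary b Finset.univ ×ˢ Set.Icc 0 1] (y₀, (0 : ℝ)),
        H (if q.2 = 0 then q.1 else G q) =
          y₀ + P (q.1 - y₀) + N (fun j => b.coord j q.1 - q.2) ∧
        H' (y₀ + P (q.1 - y₀) + N (fun j => b.coord j q.1 - q.2)) =
          if q.2 = 0 then q.1 else G q := by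
  have hy₀ : y₀ ∈ simplex b :=
    (mem_simplex_iff b).2 ((mem_face_iff b).1 (openFace_subset_face b hα)).1
  obtain ⟨g, hg⟩ := hG.germHomeo hy₀
  obtain ⟨g', hg'⟩ := h.germHomeo hα
  have h1 := hg.symm
  simp only [if_true] at h1
  have hgy : g y₀ = (y₀, 0) := by simpa using hg.apply_inv
  obtain ⟨H, H', hH, hH', h2⟩ : ∃ H H' : EuclideanSpace ℝ (Fin k) → EuclideanSpace ℝ (Fin k),
      (∀ u, H u = y₀ + P ((g u).1 - y₀) + N (fun j => b.coord j (g u).1 - (g u).2)) ∧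
      (∀ u, H' u = if (g' u).2 = 0 then (g' u).1 else G (g' u)) ∧
      GermHomeo H H' Set.univ Set.univ y₀ :=
    -- The simplex with abstract collar is mapped homeomorphically near `(y₀, 0)` to `ℝᵏ` both by
    -- `G` and by the linear model; `H` is the inverse of the former followed by the latter. Both
    -- are the identity on the simplex at height `0`.
    ⟨_, _, fun _ => rfl, fun _ => rfl, h1.trans (T := _) (by rw [hgy]; exact hg')⟩
  have hev : ∀ᶠ q in 𝓝[simplex b ×ˢ {0} ∪ faceBoundary b Finset.univ ×ˢ Set.Icc 0 1]
      (y₀, (0 : ℝ)), H (if q.2 = 0 then q.1 else G q) =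
          y₀ + P (q.1 - y₀) + N (fun j => b.coord j q.1 - q.2) ∧
        H' (y₀ + P (q.1 - y₀) + N (fun j => b.coord j q.1 - q.2)) =
          if q.2 = 0 then q.1 else G q := by
    filter_upwards [hg.left_inv, hg'.left_inv] with q hq hq'
    rw [hH, hH', hq.2, hq'.2]
    exact ⟨rfl, rfl⟩
  have hsimp : ∀ᶠ u in 𝓝 y₀, u ∈ simplex b → H u = u ∧ H' u = u := by
    have ht : Filter.Tendsto (fun u => (u, (0 : ℝ))) (𝓝[simplex b] y₀)
        (𝓝[simplex b ×ˢ {0} ∪ faceBoundary b Finset.univ ×ˢ Set.Icc 0 1] (y₀, (0 : ℝ))) :=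
      tendsto_nhdsWithin_of_tendsto_nhds_of_eventually_within _
        ((Continuous.prodMk_left (0 : ℝ)).continuousWithinAt) (Filter.mem_of_superset
          self_mem_nhdsWithin fun u hu => Or.inl ⟨hu, rfl⟩)
    have h3 := eventually_nhdsWithin_iff.1 (ht.eventually hev)
    filter_upwards [h3] with u hu huΔ
    have h4 := hu huΔ
    simpa only [if_true, sub_zero, h.decomp] using h4
  exact ⟨H, H', h2, (hsimp.self_of_nhds hy₀).1, hsimp, hev⟩

end Straightening

/-! ### A global displacement decreasing the small coordinates. -/

section Shift

variable {k : ℕ} (b : AffineBasis (Fin (k + 1)) ℝ (EuclideanSpace ℝ (Fin k)))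

/-- A global piecewise linear displacement that decreases the small barycentric coordinates. -/
theorem exists_shift : ∃ sh : EuclideanSpace ℝ (Fin k) × ℝ → EuclideanSpace ℝ (Fin k),
    (∀ q, PLAt sh Set.univ q) ∧ (∀ y, sh (y, 0) = 0) ∧ ∃ η > 0, ∀ y t, 0 ≤ t → ∀ i,
      b.coord i y ≤ η → dcoord b i (sh (y, t)) = -min t (η - b.coord i y) := by
  -- Below the average value `1/(k + 1)` of the coordinates, the large coordinates exceed `η` by
  -- enough to absorb all that the small ones lose.
  obtain ⟨η, hη, hη'⟩ : ∃ η : ℝ, 0 < η ∧ (k + 1 : ℝ) * η < 1 := by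
    have hk : (0 : ℝ) < k + 1 := by positivity
    refine ⟨(k + 1 : ℝ)⁻¹ / 2, by positivity, ?_⟩
    rw [mul_div_assoc', mul_inv_cancel₀ hk.ne']
    norm_num
  -- Here `m j` is what coordinate `j` loses and `r j` is its excess over `η`. The total loss `S`
  -- must be returned so that the coordinates still sum to `1`. Proportional distribution is not
  -- piecewise linear, so the excesses are used as capacities filled one after the other: coordinate
  -- `j` gains `min S C_{j+1} - min S C_j`, where `C n` is the capacity of the first `n`
  -- coordinates.
  let m : Fin (k + 1) → EuclideanSpace ℝ (Fin k) × ℝ → ℝ :=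
    fun j q => min q.2 (max (η - b.coord j q.1) 0)
  let r : Fin (k + 1) → EuclideanSpace ℝ (Fin k) × ℝ → ℝ := fun j q => max (b.coord j q.1 - η) 0
  let S : EuclideanSpace ℝ (Fin k) × ℝ → ℝ := fun q => ∑ j, m j q
  let C : ℕ → EuclideanSpace ℝ (Fin k) × ℝ → ℝ := fun n q => ∑ l, if l.val < n then r l q else 0
  let δ : Fin (k + 1) → EuclideanSpace ℝ (Fin k) × ℝ → ℝ :=
    fun j q => min (S q) (C (j + 1) q) - min (S q) (C j q) - m j q
  have hU : ∀ q : EuclideanSpace ℝ (Fin k) × ℝ, PolyAt Set.univ q := fun q => PolyAt.univ q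
  have hcoord : ∀ j q, PLAt (fun q : EuclideanSpace ℝ (Fin k) × ℝ => b.coord j q.1) Set.univ q :=
    fun j q => plAt_coord (hU q).fst j
  have hm : ∀ j q, PLAt (m j) Set.univ q := fun j q =>
    (hU q).snd.min (((PLAt.const η (hU q)).sub (hcoord j q)).max (PLAt.const 0 (hU q)))
  have hr : ∀ j q, PLAt (r j) Set.univ q := fun j q =>
    ((hcoord j q).sub (PLAt.const η (hU q))).max (PLAt.const 0 (hU q))
  have hS : ∀ q, PLAt S Set.univ q := fun q => PLAt.sum (hU q) _ fun j _ => hm j q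
  have hC : ∀ n q, PLAt (C n) Set.univ q := fun n q => PLAt.sum (hU q) _ fun l _ => by
    by_cases h : l.val < n
    · simpa only [if_pos h] using hr l q
    · simpa only [if_neg h] using PLAt.const 0 (hU q)
  have hδ : ∀ j q, PLAt (δ j) Set.univ q := fun j q =>
    (((hS q).min (hC _ q)).sub ((hS q).min (hC _ q))).sub (hm j q)
  have hr0 : ∀ j q, 0 ≤ r j q := fun j q => le_max_right _ _
  have hC0 : ∀ n q, 0 ≤ C n q := fun n q => Finset.sum_nonneg fun l _ => by
    split_ifs
    exacts [hr0 l q, le_rfl]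
  have hsum : ∀ y t, 0 ≤ t → ∑ j, δ j (y, t) = 0 := by
    intro y t ht
    have hS0 : 0 ≤ S (y, t) := Finset.sum_nonneg fun j _ => le_min ht (le_max_right _ _)
    have hCk : C (k + 1) (y, t) = ∑ j, r j (y, t) :=
      Finset.sum_congr rfl fun l _ => if_pos l.isLt
    have hCz : C 0 (y, t) = 0 := Finset.sum_eq_zero fun l _ => if_neg (Nat.not_lt_zero _)
    -- The total capacity suffices: termwise `m j + (y_j - η) ≤ r j`, and the sum of `y_j - η` is
    -- positive.
    have hle : S (y, t) ≤ C (k + 1) (y, t) := by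
      have h1 : ∑ j, (b.coord j y - η) = 1 - (k + 1 : ℝ) * η := by
        rw [Finset.sum_sub_distrib, b.sum_coord_apply_eq_one, Finset.sum_const, Finset.card_univ,
          Fintype.card_fin, nsmul_eq_mul]
        push_cast
        rfl
      have h2 : ∑ j, (m j (y, t) + (b.coord j y - η)) ≤ ∑ j, r j (y, t) := by
        refine Finset.sum_le_sum fun j _ => ?_
        simp only [m, r]
        rcases le_total (b.coord j y) η with h | h
        · rw [max_eq_left (by linarith), max_eq_right (by linarith)]
          have := min_le_right t (η - b.coord j y)
          linarith
        · rw [max_eq_right (by linarith), max_eq_left (by linarith), min_eq_right ht]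
          linarith
      rw [Finset.sum_add_distrib, h1] at h2
      rw [hCk]
      simp only [S]
      linarith
    simp only [δ, Finset.sum_sub_distrib (g := fun j => m j (y, t))]
    rw [Fin.sum_univ_eq_sum_range (fun n => min (S (y, t)) (C (n + 1) (y, t)) -
      min (S (y, t)) (C n (y, t))) (k + 1), Finset.sum_range_sub (fun n => min (S (y, t))
      (C n (y, t))), hCz, min_eq_left hle, min_eq_right hS0, sub_zero, sub_self]
  refine ⟨fun q => ∑ j, δ j q • b j, fun q => PLAt.sum (hU q) _ fun j _ => (hδ j q).smul_const _,
    fun y => ?_, η, hη, fun y t ht i hi => ?_⟩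
  · refine Finset.sum_eq_zero fun j _ => ?_
    have h1 : ∀ j, m j (y, 0) = 0 := fun j => min_eq_left (le_max_right _ _)
    have h2 : S (y, 0) = 0 := Finset.sum_eq_zero fun j _ => h1 j
    simp only [δ, h1, h2, min_eq_left (hC0 _ _), sub_self, zero_smul]
  · rw [dcoord_sum_smul b (hsum y t ht)]
    -- A coordinate that is at most `η` has no capacity, so it only loses.
    have h1 : C (i + 1) (y, t) = C i (y, t) := Finset.sum_congr rfl fun l _ => by
      rcases eq_or_ne l i with rfl | h
      · have : r l (y, t) = 0 := max_eq_right (by simpa using hi)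
        simp [this]
      · have : l.val ≠ i.val := fun h' => h (Fin.ext h')
        simp only [show l.val < i.val + 1 ↔ l.val < i.val by omega]
    simp only [δ, h1, sub_self, zero_sub, m]
    rw [max_eq_left (by linarith)]

end Shift

/-! ### A shear of the target factors. -/

section Shear

variable {C V : Type*} [NormedAddCommGroup C] [NormedSpace ℝ C] [FiniteDimensional ℝ C]
  [NormedAddCommGroup V] [NormedSpace ℝ V] [FiniteDimensional ℝ V]

/-- Subtracting `τ` flattens the graph of a map into the first factor, and taking the difference of
the factors flattens the diagonal. -/
theorem germHomeo_shear {τ : C → V} {c : C} (hτ : PLAt τ Set.univ c) (v : V × V) :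
    GermHomeo (fun p : C × (V × V) => (p.1, (p.2.1 - τ p.1, p.2.2 - p.2.1)))
      (fun p => (p.1, (p.2.1 + τ p.1, p.2.2 + (p.2.1 + τ p.1)))) Set.univ Set.univ (c, v) := by
  have hU : ∀ p : C × (V × V), PolyAt Set.univ p := fun p => PolyAt.univ p
  have h : ∀ v, PLAt (fun p : C × (V × V) => τ p.1) Set.univ (c, v) := fun v =>
    PLAt.comp (f := Prod.fst) hτ (hU _).fst (Filter.Eventually.of_forall fun _ => trivial)
  refine ⟨trivial, trivial, ?_, ?_, ?_, ?_⟩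
  · exact (hU _).fst.prodMk (((hU _).snd.fst.sub (h _)).prodMk ((hU _).snd.snd.sub (hU _).snd.fst))
  · exact (hU _).fst.prodMk (((hU _).snd.fst.add (h _)).prodMk
      ((hU _).snd.snd.add ((hU _).snd.fst.add (h _))))
  · exact Filter.Eventually.of_forall fun p => ⟨trivial, by simp⟩
  · exact Filter.Eventually.of_forall fun p => ⟨trivial, by simp⟩

end Shear

/-! ### The fiber product, its defining map, and transversality. -/

section Main

set_option linter.unusedSectionVars false

variable {k : ℕ} {E E' : Type*}
  [NormedAddCommGroup E] [NormedSpace ℝ E] [FiniteDimensional ℝ E]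
  [NormedAddCommGroup E'] [NormedSpace ℝ E'] [FiniteDimensional ℝ E']
  {b : AffineBasis (Fin (k + 1)) ℝ (EuclideanSpace ℝ (Fin k))}
  {K : Geometry.SimplicialComplex ℝ E} {X : Set E'} {f : E' → EuclideanSpace ℝ (Fin k)}
  {α : Finset (Fin (k + 1))}

/-- For the full simplex the boundary condition identifies the intrinsic boundary of `X` with the
preimage of the boundary of the simplex, so the collar is described by barycentric coordinates. -/
theorem IsHyperbolizedSimplex.collared_eq (hf : IsHyperbolizedSimplex b X f) :
    collared k X = X ×ˢ {0} ∪ (X ∩ f ⁻¹' faceBoundary b Finset.univ) ×ˢ Set.Icc 0 1 := by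
  have h := hf.boundary_eq Finset.univ Finset.univ_nonempty
  rw [Finset.card_univ, Fintype.card_fin, Nat.add_sub_cancel,
    Set.inter_eq_left.2 (show X ⊆ f ⁻¹' face b Finset.univ from hf.mapsTo)] at h
  rw [collared, h]

theorem IsHyperbolizedSimplex.mem_collared (hf : IsHyperbolizedSimplex b X f) {q : E' × ℝ}
    (hq : q ∈ collared k X) : q.1 ∈ X ∧ 0 ≤ q.2 ∧
      (q.1, q.2) ∈ X ×ˢ {0} ∪ (X ∩ f ⁻¹' faceBoundary b Finset.univ) ×ˢ Set.Icc 0 1 ∧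
      (f q.1, q.2) ∈ simplex b ×ˢ {0} ∪ faceBoundary b Finset.univ ×ˢ Set.Icc (0 : ℝ) 1 := by
  rw [hf.collared_eq] at hq
  refine ⟨?_, ?_, hq, ?_⟩ <;> rcases hq with ⟨h1, h2⟩ | ⟨h1, h2⟩
  · exact h1
  · exact h1.1
  · exact (Set.mem_singleton_iff.1 h2).ge
  · exact h2.1
  · exact Or.inl ⟨hf.mapsTo h1, h2⟩
  · exact Or.inr ⟨h1.2, h2⟩

theorem IsHyperbolizedSimplex.plAt_collared (hf : IsHyperbolizedSimplex b X f) (q : E' × ℝ) :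
    PLAt (fun q : E' × ℝ => f q.1) (collared k X) q := by
  have hfX := hf.isPLOn.plAt_of_isClosed hf.isCompact.isClosed q.1
  have hP : PolyAt (collared k X) q := by
    rw [hf.collared_eq]
    exact (hfX.polyAt.prod (PolyAt.singleton 0 q.2)).union
      ((PolyAt.preimage hfX (polyAt_faceBoundary _)).prod (PolyAt.Icc 0 1 q.2))
  exact PLAt.comp (f := Prod.fst) hfX hP.fst
    (Filter.mem_of_superset self_mem_nhdsWithin fun q hq => (hf.mem_collared hq).1)

theorem IsHyperbolizedSimplex.isCompact_collared (hf : IsHyperbolizedSimplex b X f) :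
    IsCompact (collared k X) := by
  rw [hf.collared_eq]
  refine (hf.isCompact.prod isCompact_singleton).union (IsCompact.prod ?_ isCompact_Icc)
  exact hf.isCompact.of_isClosed_subset (hf.isPLOn.continuousOn.preimage_isClosed_of_isClosed
    hf.isCompact.isClosed isClosed_faceBoundary) Set.inter_subset_left

/-- The local structure of the ambient manifold, for a map that extends `f` over the collar and
that is well behaved in the directions normal to the faces. -/
theorem exists_ambient_germ (hfin : K.faces.Finite) (hdim : ∀ σ ∈ K.faces, σ.card ≤ k + 1)
    (hf : IsHyperbolizedSimplex b X f) (hp : IsProperSimplexMap b X f) {s₀ : E} {z : E'}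
    (hs₀ : s₀ ∈ K.space) (hz : z ∈ X) (hsz : foldMap b K s₀ = f z) (hα : f z ∈ openFace b α)
    {F : E' × ℝ → EuclideanSpace ℝ (Fin k)} (hF : PLAt F (collared k X) (z, 0))
    (hF0 : F (z, 0) = f z)
    (hFc : ∀ᶠ q in 𝓝[collared k X] (z, (0 : ℝ)), ∀ j : {j // j ∉ α},
      b.coord j (F q) = b.coord j (f q.1) - q.2) :
    ∃ (γ : E × (E' × ℝ) → E) (g : E × EuclideanSpace ℝ (Fin k) → E × (E' × ℝ)),
      GermHomeo (fun w : E × (E' × ℝ) => (γ w, foldMap b K w.1 - F w.2)) g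
      (ambient k K X) (K.space ×ˢ Set.univ) (s₀, (z, 0)) := by
  obtain ⟨c, Ψ, hc0, hΨ⟩ := exists_faceModel hf hp hz hα
  obtain ⟨Ψ', hΨ'⟩ := exists_collarModel hα hf.mapsTo (isPLOn_iff.1 hf.isPLOn z hz) hΨ
    hf.collared_eq
  exact exists_productGerm hfin hdim hs₀ (hsz ▸ hα) (c := fun q => c q.1) hΨ' hc0 hF
    (hF0.trans hsz.symm) hFc

theorem exists_chart_space (hK : IsClosedPLManifold k K.space) {s : E} (hs : s ∈ K.space) :
    ∃ (κ : E → Fin k → ℝ) (g : (Fin k → ℝ) → E), GermHomeo κ g K.space Set.univ s := by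
  refine exists_germHomeo_of_mem_manifoldInterior ?_
  by_contra h
  have : s ∈ manifoldBoundary k K.space := ⟨hs, h⟩
  rw [hK.2.2] at this
  exact this

/-- The fiber product is the zero set of a map that is locally a projection of a product. -/
theorem exists_defining_map (hfin : K.faces.Finite) (hdim : ∀ σ ∈ K.faces, σ.card ≤ k + 1)
    (hf : IsHyperbolizedSimplex b X f) (hp : IsProperSimplexMap b X f) :
    ∃ D : E × (E' × ℝ) → EuclideanSpace ℝ (Fin k), IsPLOn D (ambient k K X) ∧
      fiberProduct b K X f = {w ∈ ambient k K X | D w = 0} ∧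
      ∀ w ∈ fiberProduct b K X f, ∃ (γ : E × (E' × ℝ) → E)
        (g : E × EuclideanSpace ℝ (Fin k) → E × (E' × ℝ)), GermHomeo (fun w => (γ w, D w)) g
        (ambient k K X) (K.space ×ˢ Set.univ) w := by
  obtain ⟨sh, hsh, hsh0, η, hη, hshc⟩ := exists_shift b
  have hF : ∀ q, PLAt (fun q : E' × ℝ => f q.1 + sh (f q.1, q.2)) (collared k X) q := fun q => by
    have h1 := hf.plAt_collared q
    exact h1.add (PLAt.comp (f := fun q : E' × ℝ => (f q.1, q.2)) (hsh _)
      (h1.prodMk h1.polyAt.snd) (Filter.Eventually.of_forall fun _ => trivial))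
  refine ⟨fun w => foldMap b K w.1 - (f w.2.1 + sh (f w.2.1, w.2.2)), ?_, ?_, ?_⟩
  · refine isPLOn_iff.2 fun w hw => ?_
    have hp' := isPLOn_iff.1 (isPLOn_foldMap b hfin) w.1 hw.1
    have hW : PolyAt (ambient k K X) w := hp'.polyAt.prod (hF w.2).polyAt
    exact (PLAt.comp (f := Prod.fst) hp' hW.fst (Filter.mem_of_superset self_mem_nhdsWithin
      fun w hw => hw.1)).sub (PLAt.comp (f := Prod.snd) (hF w.2) hW.snd
        (Filter.mem_of_superset self_mem_nhdsWithin fun w hw => hw.2))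
  · ext ⟨s, x, t⟩
    simp only [fiberProduct, ambient, Set.mem_ofPred_eq, Set.mem_prod]
    constructor
    · rintro ⟨h1, h2, rfl, h4⟩
      refine ⟨⟨h1, Or.inl ⟨h2, rfl⟩⟩, ?_⟩
      rw [hsh0, add_zero, h4, sub_self]
    · rintro ⟨⟨h1, h2⟩, h3⟩
      obtain ⟨h4, h5, h6, -⟩ := hf.mem_collared h2
      -- On the collar some coordinate of `f` vanishes. For `t > 0` the shift makes it negative,
      -- whereas the folding map takes values in the simplex.
      have ht : t = 0 := by
        by_contra ht
        rcases h6 with h6 | h6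
        · exact ht h6.2
        · obtain ⟨i, hi⟩ := (mem_faceBoundary_univ.1 h6.1.2).2
          simp only at hi h5
          have h7 := (mem_simplex_iff b).1 (foldMap_mem_simplex b h1) i
          rw [sub_eq_zero.1 h3, coord_add, hi, hshc _ _ h5 i (hi ▸ hη.le), hi, sub_zero,
            zero_add] at h7
          have h8 : 0 < min t η := lt_min (lt_of_le_of_ne h5 (Ne.symm ht)) hη
          linarith
      subst ht
      rw [hsh0, add_zero] at h3
      exact ⟨h1, h4, rfl, sub_eq_zero.1 h3⟩
  · rintro ⟨s, x, t⟩ ⟨h1, h2, h3, h4⟩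
    simp only at h1 h2 h3 h4
    subst h3
    obtain ⟨α, hα⟩ := exists_mem_openFace b (hf.mapsTo h2)
    refine exists_ambient_germ hfin hdim hf hp h1 h2 h4 hα (hF _)
      (by simp only [hsh0, add_zero]) ?_
    -- Near the fiber product the cutoff in the shift is inactive, and each coordinate off `α`
    -- decreases by exactly `t`, as the local model requires.
    have hlt : ∀ᶠ q in 𝓝[collared k X] (x, (0 : ℝ)), ∀ j : {j // j ∉ α},
        q.2 < η - b.coord j (f q.1) := by
      rw [Filter.eventually_all]
      intro j
      have hc := (plAt_coord (hf.plAt_collared (x, 0)) (b := b) j).continuousWithinAt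
      have hs : ContinuousWithinAt (fun q : E' × ℝ => η - b.coord j (f q.1) - q.2)
          (collared k X) (x, 0) :=
        (continuousWithinAt_const.sub hc).sub continuous_snd.continuousWithinAt
      refine (hs.eventually (lt_mem_nhds (a := 0) ?_)).mono fun q hq => sub_pos.1 hq
      simp only [hα.2 j j.2, sub_zero]
      exact hη
    filter_upwards [hlt, self_mem_nhdsWithin] with q h5 h6 j
    obtain ⟨-, h7, -, -⟩ := hf.mem_collared h6
    have h8 := h5 j
    rw [coord_add, hshc _ _ h7 j (by linarith), min_eq_left h8.le, sub_eq_add_neg]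

/-- In the local product structure for the defining map, the factor `K` is replaced by a chart; the
fiber product becomes the kernel of the projection to the second factor. -/
theorem isLocallyFlat_fiberProduct (hfin : K.faces.Finite)
    (hdim : ∀ σ ∈ K.faces, σ.card ≤ k + 1) (hK : IsClosedPLManifold k K.space)
    (hf : IsHyperbolizedSimplex b X f) (hp : IsProperSimplexMap b X f) :
    IsLocallyFlat k (2 * k) (fiberProduct b K X f) (ambient k K X) := by
  obtain ⟨D, -, hDZ, hD⟩ := exists_defining_map (b := b) hfin hdim hf hp
  refine isLocallyFlat_of_germHomeo (F := (Fin k → ℝ) × EuclideanSpace ℝ (Fin k))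
    (by rw [hDZ]; exact Set.sep_subset _ _) (by simp; ring)
    (LinearMap.ker (LinearMap.snd ℝ (Fin k → ℝ) (EuclideanSpace ℝ (Fin k)))) ?_ fun w hw => ?_
  · rw [LinearMap.ker_snd, LinearMap.finrank_range_of_inj LinearMap.inl_injective,
      Module.finrank_fin_fun]
  · obtain ⟨γ, g, h⟩ := hD w hw
    obtain ⟨κ, g', hκ⟩ := exists_chart_space hK h.map_mem.1
    have h1 := h.trans (hκ.prod (germHomeo_id (Set.mem_univ (D w)) (PolyAt.univ _)))
    rw [Set.univ_prod_univ] at h1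
    refine ⟨_, _, h1, ?_⟩
    filter_upwards [self_mem_nhdsWithin] with y hy
    rw [hDZ]
    exact and_iff_right hy

/-- The defining map has a local product structure with factor `K` along its compact zero set, so
the general result on zero sets applies. -/
theorem hasTrivialNormalBundle_fiberProduct (hfin : K.faces.Finite)
    (hdim : ∀ σ ∈ K.faces, σ.card ≤ k + 1)
    (hf : IsHyperbolizedSimplex b X f) (hp : IsProperSimplexMap b X f) :
    HasTrivialNormalBundle k (fiberProduct b K X f) (ambient k K X) := by
  obtain ⟨D, hDpl, hDZ, hD⟩ := exists_defining_map (b := b) hfin hdim hf hp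
  let L : EuclideanSpace ℝ (Fin k) ≃ₗ[ℝ] (Fin k → ℝ) := WithLp.linearEquiv 2 ℝ (Fin k → ℝ)
  have hL : ∀ w, L (D w) = 0 ↔ D w = 0 := fun w => L.map_eq_zero_iff
  have hDL : IsPLOn (fun w => L (D w)) (ambient k K X) :=
    isPLOn_iff.2 fun w hw => (isPLOn_iff.1 hDpl w hw).linear_comp L.toLinearMap
  have hZ : fiberProduct b K X f = {w ∈ ambient k K X | L (D w) = 0} := by
    rw [hDZ]
    simp only [hL]
  have hWc : IsCompact (ambient k K X) := (isCompact_space hfin).prod hf.isCompact_collared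
  rw [hZ]
  refine hasTrivialNormalBundle_of_hasProductGerm (isPLOn_space hfin) hDL ?_ fun w hw hw0 => ?_
  · exact hWc.of_isClosed_subset (hDL.continuousOn.preimage_isClosed_of_isClosed hWc.isClosed
      isClosed_singleton) (Set.sep_subset _ _)
  · obtain ⟨γ, g, h⟩ := hD w (by rw [hZ]; exact ⟨hw, hw0⟩)
    exact ⟨_, _, h.trans ((germHomeo_id h.map_mem.1 (isPLOn_iff.1 (isPLOn_space hfin) _
      h.map_mem.1)).prod (germHomeo_linearEquiv L (D w))), Filter.Eventually.of_forall fun _ => rfl⟩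

/-- In suitable coordinates `((a, d), (h₁, h₂))`, with `d = p - F`, `h₁ = H v₁ - p` and `h₂ = H v₂ -
H v₁`, the graph is `h₁ = 0, h₂ = -d` and the diagonal product is `h₂ = 0`. -/
theorem areTransverse_productGraph (hfin : K.faces.Finite)
    (hdim : ∀ σ ∈ K.faces, σ.card ≤ k + 1) (hK : IsClosedPLManifold k K.space)
    (hf : IsHyperbolizedSimplex b X f) (hp : IsProperSimplexMap b X f)
    {G : EuclideanSpace ℝ (Fin k) × ℝ → EuclideanSpace ℝ (Fin k)} (hG : IsCollarMap b G) :
    AreTransverse (4 * k) (ambient k K X ×ˢ Set.univ) (productGraph b K X f G)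
      (diagonalProduct k K X) := by
  classical
  refine areTransverse_of_germHomeo (F := ((Fin k → ℝ) × EuclideanSpace ℝ (Fin k)) ×
      (EuclideanSpace ℝ (Fin k) × EuclideanSpace ℝ (Fin k)))
    (fun y hy => ⟨hy.1, trivial⟩) (fun y hy => ⟨hy.1, trivial⟩) (by simp; ring)
    { carrier := {v | v.2.1 = 0 ∧ v.2.2 = -v.1.2}
      add_mem' := fun {u v} hu hv => ⟨by simp [hu.1, hv.1], by simp [hu.2, hv.2]; abel⟩
      zero_mem' := by simp
      smul_mem' := fun c v hv => ⟨by simp [hv.1], by simp [hv.2]⟩ }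
    { carrier := {v | v.2.2 = 0}
      add_mem' := fun {u v} hu hv => by
        have h1 : u.2.2 = 0 := hu
        have h2 : v.2.2 = 0 := hv
        simp [h1, h2]
      zero_mem' := by simp
      smul_mem' := fun c v hv => by
        have h1 : v.2.2 = 0 := hv
        simp [h1] } ?_ ?_
  · rw [eq_top_iff]
    rintro ⟨⟨a, d⟩, h₁, h₂⟩ -
    refine Submodule.mem_sup.2 ⟨((0, -h₂), (0, h₂)), ⟨rfl, by simp⟩, ((a, d + h₂), (h₁, 0)), rfl,
      ?_⟩
    simp
  rintro ⟨⟨s₀, z, t₀⟩, u₁, u₂⟩ ⟨⟨⟨hs₀, hq₀⟩, hgr⟩, -, hdiag⟩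
  have hu₁ : u₁ = foldMap b K s₀ := congrArg Prod.fst hgr
  have hu₂ : u₂ = extendToCollar f G (z, t₀) := congrArg Prod.snd hgr
  have hu : u₁ = u₂ := hdiag
  obtain ⟨hz, ht₀, -, hq₀'⟩ := hf.mem_collared hq₀
  simp only at hs₀ hz ht₀ hq₀'
  -- A point of the simplex outside its interior is a boundary point, and the collar map already
  -- attains it at height `0`; injectivity excludes positive heights.
  have ht : t₀ = 0 := by
    by_contra ht
    have h0 : u₂ = G (f z, t₀) := hu₂.trans (if_neg ht)
    have h1 := hq₀'.resolve_left fun h => ht h.2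
    obtain ⟨g, -, -, hGm, -, hinv⟩ := hG.1
    have h2 := hGm h1
    have h3 : G (f z, t₀) ∈ faceBoundary b Finset.univ :=
      ⟨h0 ▸ hu ▸ hu₁ ▸ foldMap_mem_simplex b hs₀, by rw [← interior_simplex]; exact h2.2⟩
    have h4 := hinv.1.injOn h1 ⟨h3, le_rfl, zero_le_one⟩ (hG.2 _ h3).1.symm
    exact ht (congrArg Prod.snd h4)
  subst ht
  have hu₂z : u₂ = f z := hu₂.trans (if_pos rfl)
  have hu₁z : u₁ = f z := hu.trans hu₂z
  have hsz : foldMap b K s₀ = f z := hu₁.symm.trans hu₁z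
  clear hgr hdiag hu hu₁ hu₂
  subst hu₁z hu₂z
  obtain ⟨α, hα⟩ := exists_mem_openFace b (hf.mapsTo hz)
  obtain ⟨P, N, hPN⟩ := exists_isFaceSplitting hα
  obtain ⟨H, H', hH, hHy, hHs, hHG⟩ := hG.exists_straightening hα hPN
  -- This is the straightened extension `H` of the collar extension of `f`; its coordinates off `α`
  -- are those of `f` minus the height.
  obtain ⟨F, hFq⟩ : ∃ F : E' × ℝ → EuclideanSpace ℝ (Fin k), ∀ q, F q = f z + P (f q.1 - f z) +
      N (fun j => b.coord j (f q.1) - q.2) := ⟨_, fun _ => rfl⟩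
  have hfc := hf.plAt_collared (z, 0)
  have hF : PLAt F (collared k X) (z, 0) :=
    (((PLAt.const _ hfc.polyAt).add ((hfc.sub (PLAt.const _ hfc.polyAt)).linear_comp P)).add
      ((PLAt.pi hfc.polyAt fun j : {j // j ∉ α} =>
        (plAt_coord (b := b) hfc j).sub hfc.polyAt.snd).linear_comp N)).congr
      (Filter.Eventually.of_forall hFq)
  have hF0 : F (z, 0) = f z := by rw [hFq]; simp only [sub_zero, hPN.decomp]
  obtain ⟨γ, g, hγ⟩ := exists_ambient_germ hfin hdim hf hp hs₀ hz hsz hα hF hF0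
    (Filter.Eventually.of_forall fun q j => by rw [hFq, hPN.coord _ (hPN.mem _)])
  obtain ⟨κ, g', hκ⟩ := exists_chart_space hK hγ.map_mem.1
  obtain ⟨A, gA, hA, hA2⟩ : ∃ (A : E × (E' × ℝ) → (Fin k → ℝ) × EuclideanSpace ℝ (Fin k)) (gA : _),
      GermHomeo A gA (ambient k K X) Set.univ (s₀, (z, 0)) ∧
      ∀ w, (A w).2 = foldMap b K w.1 - F w.2 := by
    have h1 := hγ.trans (hκ.prod (germHomeo_id (Set.mem_univ _) (PolyAt.univ _)))
    rw [Set.univ_prod_univ] at h1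
    exact ⟨_, _, h1, fun _ => rfl⟩
  have hps := isPLOn_iff.1 (isPLOn_foldMap b hfin) s₀ hs₀
  -- The folding map as a function of the chart coordinates, for use in the shear. No homeomorphism
  -- is needed to straighten it, since `H` fixes the simplex pointwise near the base point.
  have hτ : PLAt (fun c => foldMap b K (gA c).1) Set.univ (A (s₀, (z, 0))) :=
    PLAt.comp (T := K.space) (by rw [hA.apply_inv]; exact hps) hA.plAt_inv.fst
      (hA.right_inv.mono fun c hc => hc.1.1)
  have hB := hA.prod (hH.prod hH)
  rw [Set.univ_prod_univ, Set.univ_prod_univ] at hB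
  refine ⟨_, _, hB.trans (germHomeo_shear hτ _), ?_⟩
  -- the events near the base point
  have hW1 : Filter.Tendsto (fun y : (E × (E' × ℝ)) × (EuclideanSpace ℝ (Fin k) ×
      EuclideanSpace ℝ (Fin k)) => y.1) (𝓝[ambient k K X ×ˢ Set.univ] ((s₀, (z, 0)), (f z, f z)))
      (𝓝[ambient k K X] (s₀, (z, 0))) :=
    tendsto_nhdsWithin_of_tendsto_nhds_of_eventually_within _
      continuous_fst.continuousWithinAt (Filter.mem_of_superset self_mem_nhdsWithin
        fun q hq => hq.1)
  have hs : Filter.Tendsto (fun w : E × (E' × ℝ) => foldMap b K w.1)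
      (𝓝[ambient k K X] (s₀, (z, 0))) (𝓝 (f z)) := by
    have h1 : Filter.Tendsto Prod.fst (𝓝[ambient k K X] (s₀, (z, (0 : ℝ)))) (𝓝[K.space] s₀) :=
      tendsto_nhdsWithin_of_tendsto_nhds_of_eventually_within _
        continuous_fst.continuousWithinAt (Filter.mem_of_superset self_mem_nhdsWithin
          fun q hq => hq.1)
    have h2 := hps.continuousWithinAt.tendsto
    rw [hsz] at h2
    exact h2.comp h1
  have hq : Filter.Tendsto (fun w : E × (E' × ℝ) => (f w.2.1, w.2.2))
      (𝓝[ambient k K X] (s₀, (z, 0)))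
      (𝓝[simplex b ×ˢ {0} ∪ faceBoundary b Finset.univ ×ˢ Set.Icc 0 1] (f z, (0 : ℝ))) := by
    have h1 : Filter.Tendsto Prod.snd (𝓝[ambient k K X] (s₀, (z, (0 : ℝ))))
        (𝓝[collared k X] (z, 0)) :=
      tendsto_nhdsWithin_of_tendsto_nhds_of_eventually_within _
        continuous_snd.continuousWithinAt (Filter.mem_of_superset self_mem_nhdsWithin
          fun q hq => hq.2)
    have h2 : Filter.Tendsto (fun q : E' × ℝ => (f q.1, q.2)) (𝓝[collared k X] (z, 0))
        (𝓝[simplex b ×ˢ {0} ∪ faceBoundary b Finset.univ ×ˢ Set.Icc 0 1] (f z, (0 : ℝ))) :=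
      tendsto_nhdsWithin_of_tendsto_nhds_of_eventually_within _
        (hfc.prodMk hfc.polyAt.snd).continuousWithinAt (Filter.mem_of_superset self_mem_nhdsWithin
          fun q hq => (hf.mem_collared hq).2.2.2)
    exact h2.comp h1
  have hl := hH.left_inv
  rw [nhdsWithin_univ] at hl
  have hu1 : Filter.Tendsto (fun y : (E × (E' × ℝ)) × (EuclideanSpace ℝ (Fin k) ×
      EuclideanSpace ℝ (Fin k)) => y.2.1) (𝓝 ((s₀, (z, 0)), (f z, f z))) (𝓝 (f z)) :=
    (continuous_fst.comp continuous_snd).continuousAt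
  have hu2 : Filter.Tendsto (fun y : (E × (E' × ℝ)) × (EuclideanSpace ℝ (Fin k) ×
      EuclideanSpace ℝ (Fin k)) => y.2.2) (𝓝 ((s₀, (z, 0)), (f z, f z))) (𝓝 (f z)) :=
    (continuous_snd.comp continuous_snd).continuousAt
  filter_upwards [nhdsWithin_le_nhds (hu1.eventually hl), nhdsWithin_le_nhds (hu2.eventually hl),
    hW1.eventually (hs.eventually hHs), hW1.eventually (hq.eventually hHG),
    hW1.eventually hA.left_inv, self_mem_nhdsWithin] with y e1 e2 e3 e4 e5 hy
  obtain ⟨e7, e7'⟩ := e3 (foldMap_mem_simplex b hy.1.1)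
  obtain ⟨e4, e4'⟩ := e4
  rw [← hFq] at e4 e4'
  have e6 : (A y.1).2 = foldMap b K y.1.1 - F y.1.2 := hA2 _
  obtain ⟨w, v₁, v₂⟩ := y
  simp only at e1 e2 e7 e7' e4 e4' e5 e6
  constructor
  · change w ∈ ambient k K X ∧ (v₁, v₂) = (foldMap b K w.1, extendToCollar f G w.2) ↔
      H v₁ - foldMap b K (gA (A w)).1 = 0 ∧ H v₂ - H v₁ = -(A w).2
    rw [e5.2, e6, and_iff_right hy.1, Prod.mk.injEq]
    constructor
    · rintro ⟨rfl, h2⟩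
      have h3 : H v₂ = F w.2 := by rw [h2]; exact e4
      rw [e7, h3, sub_self, neg_sub]
      exact ⟨rfl, rfl⟩
    · rintro ⟨h1, h2⟩
      have h3 : H v₁ = foldMap b K w.1 := sub_eq_zero.1 h1
      have h4 : H v₂ = F w.2 := by
        rw [h3, neg_sub] at h2
        exact sub_left_inj.1 h2
      refine ⟨by rw [← e1.2, h3, e7'], ?_⟩
      rw [← e2.2, h4, e4']
      rfl
  · change (w ∈ ambient k K X ∧ v₁ = v₂) ↔ H v₂ - H v₁ = 0
    rw [and_iff_right hy.1, sub_eq_zero]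
    constructor
    · rintro rfl
      rfl
    · intro h
      rw [← e1.2, ← e2.2, h]

end Main

end PL

theorem lemmaA1 {k : ℕ} {E E' : Type*}
    [NormedAddCommGroup E] [NormedSpace ℝ E] [FiniteDimensional ℝ E]
    [NormedAddCommGroup E'] [NormedSpace ℝ E'] [FiniteDimensional ℝ E']
    (b : AffineBasis (Fin (k + 1)) ℝ (EuclideanSpace ℝ (Fin k)))
    (K : Geometry.SimplicialComplex ℝ E) (hfin : K.faces.Finite)
    (hdim : ∀ σ ∈ K.faces, σ.card ≤ k + 1) (hK : PL.IsClosedPLManifold k K.space)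
    (X : Set E') (f : E' → EuclideanSpace ℝ (Fin k))
    (hf : PL.IsHyperbolizedSimplex b X f) (hproper : PL.IsProperSimplexMap b X f)
    (G : EuclideanSpace ℝ (Fin k) × ℝ → EuclideanSpace ℝ (Fin k)) (hG : PL.IsCollarMap b G) :
    PL.AreTransverse (4 * k)
        (PL.ambient k K X ×ˢ
          (Set.univ : Set (EuclideanSpace ℝ (Fin k) × EuclideanSpace ℝ (Fin k))))
        (PL.productGraph b K X f G) (PL.diagonalProduct k K X) ∧
      PL.IsLocallyFlat k (2 * k) (PL.fiberProduct b K X f) (PL.ambient k K X) ∧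
      PL.HasTrivialNormalBundle k (PL.fiberProduct b K X f) (PL.ambient k K X) :=
  ⟨PL.areTransverse_productGraph hfin hdim hK hf hproper hG,
    PL.isLocallyFlat_fiberProduct hfin hdim hK hf hproper,
    PL.hasTrivialNormalBundle_fiberProduct hfin hdim hf hproper⟩
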